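/- All graphs are finite and simple. For a graph $G$, $|G|$ denotes its number of vertices and $\overline{G}$ its complement. An ideal of graphs is a class of graphs closed under isomorphism and under taking induced subgraphs. Disjoint sets $A, B \subseteq V(G)$ are complete if every vertex of $A$ is adjacent to every vertex of $B$, and anticomplete if no vertex of $A$ is adjacent to a vertex of $B$. An ideal $\mathcal{I}$ has the strong Erdős–Hajnal property if there is some $\epsilon > 0$ such that every $G \in \mathcal{I}$ with $|G| \ge 2$ contains disjoint sets $A, B \subseteq V(G)$ with $|A| \ge \epsilon |G|$ and $|B| \ge \epsilon |G|$ that are either complete or anticomplete. A subdivision of a graph $H$ is a graph obtained from $H$ by replacing its edges by paths of length at least one with the same ends, internally disjoint from each other and from $V(H)$, or a graph isomorphic to such a graph; $G$ contains an induced subdivision of $H$ if some induced subgraph of $G$ is a subdivision of $H$. **Theorem.** For every graph $H$, the class of graphs $G$ such that neither $G$ nor $\overline{G}$ contains an induced subdivision of $H$ is an ideal that has the strong Erdős–Hajnal property. That is, for every graph $H$ there is $\epsilon > 0$ such that every graph $G$ with at least two vertices, for which neither $G$ nor $\overline{G}$ contains an induced subdivision of $H$, has disjoint vertex sets $A, B$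 with $|A|, |B| \ge \epsilon |G|$ that are complete or anticomplete. -/

import Mathlib

universe u v w

namespace SimpleGraph

/-- A realisation of the graph `J` as a subdivision of the graph `H`: `J` is obtained from `H` by
replacing every edge `uv` by a path between (the images of) `u` and `v`, where these paths are
internally disjoint from each other and contain no further vertices of `H`. A path of length one
means that the edge is left unsubdivided. -/
structure Subdivision {W : Type v} {V : Type u} (H : SimpleGraph W) (J : SimpleGraph V) where
  /-- the vertex of `J` that represents a vertex of `H` -/
  branch : W → V
  branch_injective : Function.Injective branch
  /-- the path of `J` that replaces an edge of `H` -/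
  path : ∀ {a b : W}, H.Adj a b → J.Walk (branch a) (branch b)
  isPath : ∀ {a b : W} (h : H.Adj a b), (path h).IsPath
  /-- the path depends only on the edge, up to the direction of traversal -/
  path_symm : ∀ {a b : W} (h : H.Adj a b), path h.symm = (path h).reverse
  /-- the only branch vertices on a path are its ends -/
  branch_mem : ∀ {a b : W} (h : H.Adj a b) (c : W),
    branch c ∈ (path h).support → c = a ∨ c = b
  /-- paths replacing different edges meet only in branch vertices -/
  disjoint : ∀ {a b c d : W} (h : H.Adj a b) (h' : H.Adj c d), s(a, b) ≠ s(c, d) →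
    ∀ x, x ∈ (path h).support → x ∈ (path h').support → x ∈ Set.range branch
  /-- `J` has no other vertices -/
  vertex_cover : ∀ x : V,
    x ∈ Set.range branch ∨ ∃ (a b : W) (h : H.Adj a b), x ∈ (path h).support
  /-- `J` has no other edges -/
  edge_cover : ∀ e ∈ J.edgeSet, ∃ (a b : W) (h : H.Adj a b), e ∈ (path h).edges

/-- `J` is (isomorphic to) a subdivision of `H`. -/
def IsSubdivision {W : Type v} {V : Type u} (H : SimpleGraph W) (J : SimpleGraph V) : Prop :=
  Nonempty (Subdivision H J)

/-- `G` contains an induced subdivision of `H`: some induced subgraph of `G` is a subdivision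
of `H`. -/
def ContainsInducedSubdivision {V : Type u} {W : Type v} (G : SimpleGraph V)
    (H : SimpleGraph W) : Prop :=
  ∃ S : Set V, H.IsSubdivision (G.induce S)

/-- `A` and `B` are anticomplete in `G`: no vertex in `A` has a neighbour in `B`. -/
def IsAnticompleteBetween {V : Type u} (G : SimpleGraph V) (A B : Set V) : Prop :=
  ∀ a ∈ A, ∀ b ∈ B, ¬ G.Adj a b

/-- An isomorphic copy of a subdivision of `H` is a subdivision of `H`. -/
theorem IsSubdivision.of_iso {W : Type v} {V : Type u} {V' : Type w} {H : SimpleGraph W}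
    {J : SimpleGraph V} {J' : SimpleGraph V'} (hJ : H.IsSubdivision J) (φ : J ≃g J') :
    H.IsSubdivision J' := by
  obtain ⟨s⟩ := hJ
  refine ⟨{
    branch := fun c => φ.toHom (s.branch c)
    branch_injective := fun _ _ hcd => s.branch_injective (φ.injective hcd)
    path := fun h => (s.path h).map φ.toHom
    isPath := fun h => (s.isPath h).map φ.injective
    path_symm := fun h => by rw [s.path_symm h, Walk.reverse_map]
    branch_mem := ?_
    disjoint := ?_
    vertex_cover := ?_
    edge_cover := ?_ }⟩
  · intro a b h c hc
    rw [Walk.support_map, List.mem_map] at hc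
    obtain ⟨y, hy, hyc⟩ := hc
    have : y = s.branch c := φ.injective hyc
    exact s.branch_mem h c (this ▸ hy)
  · intro a b c d h h' hne x hx hx'
    rw [Walk.support_map, List.mem_map] at hx hx'
    obtain ⟨y, hy, rfl⟩ := hx
    obtain ⟨z, hz, hzy⟩ := hx'
    have : z = y := φ.injective hzy
    subst this
    obtain ⟨e, he⟩ := s.disjoint h h' hne z hy hz
    exact ⟨e, congrArg φ he⟩
  · intro x
    obtain ⟨y, rfl⟩ := φ.surjective x
    rcases s.vertex_cover y with ⟨c, hc⟩ | ⟨a, b, h, hy⟩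
    · exact Or.inl ⟨c, congrArg φ hc⟩
    · exact Or.inr ⟨a, b, h, by
        rw [Walk.support_map]; exact List.mem_map_of_mem hy⟩
  · intro e
    induction e with
    | h x y =>
      obtain ⟨x, rfl⟩ := φ.surjective x
      obtain ⟨y, rfl⟩ := φ.surjective y
      intro he
      have hxy : s(x, y) ∈ J.edgeSet := φ.map_adj_iff.1 he
      obtain ⟨a, b, h, hm⟩ := s.edge_cover _ hxy
      refine ⟨a, b, h, ?_⟩
      rw [Walk.edges_map]
      exact List.mem_map.2 ⟨s(x, y), hm, rfl⟩

/-- Containing an induced subdivision of `H` passes from an induced subgraph to the graph. -/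
theorem ContainsInducedSubdivision.of_embedding {W : Type v} {V : Type u} {V' : Type w}
    {H : SimpleGraph W} {G : SimpleGraph V} {G' : SimpleGraph V'}
    (hG : G.ContainsInducedSubdivision H) (f : G ↪g G') : G'.ContainsInducedSubdivision H := by
  obtain ⟨S, hS⟩ := hG
  exact ⟨f '' S, hS.of_iso
    { toEquiv := Equiv.Set.image f S f.injective
      map_rel_iff' := f.map_adj_iff }⟩

end SimpleGraph

/-- An ideal of graphs: a class of finite graphs closed under isomorphism and under taking induced
subgraphs. -/
structure GraphIdeal where
  /-- membership in the class -/
  Mem : ∀ {V : Type u} [Finite V], SimpleGraph V → Prop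
  mem_of_iso : ∀ {V V' : Type u} [Finite V] [Finite V'] {G : SimpleGraph V}
    {G' : SimpleGraph V'}, (G ≃g G') → Mem G → Mem G'
  mem_induce : ∀ {V : Type u} [Finite V] {G : SimpleGraph V} (S : Set V),
    Mem G → Mem (G.induce S)

/-- The strong Erdős–Hajnal property of an ideal. -/
def GraphIdeal.HasStrongErdosHajnalProperty (I : GraphIdeal.{u}) : Prop :=
  ∃ ε : ℝ, 0 < ε ∧ ∀ (V : Type u) [Finite V] (G : SimpleGraph V), I.Mem G → 2 ≤ Nat.card V →
    ∃ A B : Set V, Disjoint A B ∧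
      ε * (Nat.card V : ℝ) ≤ (A.ncard : ℝ) ∧ ε * (Nat.card V : ℝ) ≤ (B.ncard : ℝ) ∧
      (G.IsCompleteBetween A B ∨ G.IsAnticompleteBetween A B)

/-- The ideal of graphs `G` such that neither `G` nor its complement contains an induced
subdivision of `H`. -/
def inducedSubdivisionFreeIdeal {W : Type v} (H : SimpleGraph W) : GraphIdeal.{u} where
  Mem G := ¬ G.ContainsInducedSubdivision H ∧ ¬ Gᶜ.ContainsInducedSubdivision H
  mem_of_iso φ hG :=
    ⟨fun h => hG.1 (h.of_embedding φ.symm.toEmbedding),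
      fun h => hG.2 (h.of_embedding (SimpleGraph.Embedding.complEquiv φ.symm.toEmbedding))⟩
  mem_induce S hG :=
    ⟨fun h => hG.1 (h.of_embedding (SimpleGraph.Embedding.induce S)),
      fun h => hG.2 (h.of_embedding (SimpleGraph.Embedding.complEquiv (SimpleGraph.Embedding.induce S)))⟩

/-! Since `H` is a subdivision of itself, neither `G` nor its complement has an induced copy of `H`.
By Rödl's theorem (`exists_degSum_le`) some linear-sized set is very sparse in `G` or in the
complement; the hypotheses are symmetric, so say in `G`. Suppose that it contains no linear-sized
anticomplete pair. Then the graph induced on a subset of bounded degree is `Coherent`: closed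
neighbourhoods are small, and a connected set that is not small sees all but a few vertices. It
remains to find an induced subdivision in a coherent graph with many vertices. By
`SubdivisionModel.containsInducedSubdivision` it suffices to find `m` pairwise nonadjacent vertices
joined by pairwise anticomplete connected links, since chordless paths can be taken inside the
links. This is `exists_subdivisionModel_of_coherent`, which rests on a dichotomy.

Suppose that there are many pairwise anticomplete connected sets with large private neighbourhoods
(`PrivateSystem`). Induced stars with leaves in distinct neighbourhoods give the branch vertices
with their first edges, and the connected sets, paired off by edges between their neighbourhoods,
give the links (`PrivateSystem.exists_model`).

Otherwise the greedy search for such sets jams. It leaves fewer than `K` large sets, a hub, such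
that every connected set with many neighbours in the remaining core covers half of one of them.
Repeating this inside the core gives nested cores and hubs, with size bounds that grow
geometrically. Take a connected set `X` in the last core, covering half of a set `Y` of the last
hub. Each covered `c` in `Y` starts an arm inside `X`, stopped as soon as it is large enough to
cover half of a set of the `k`-th hub. By double counting, one vertex, the hinge, is touched by the
arms of a constant proportion of these `c`, so any two of them are linked through two arms and the
hinge. This is a `Token`, and there is one for each `k < M`. Arms stopped at level `k` have few
neighbours compared with later hubs, so they rarely touch later hinges or other ends. Pigeonhole
leaves `m * m` tokens with a large common set of ends; `m` ends without conflicts become the branch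
vertices, and each pair of them uses a token of its own (`HubSequence.exists_model_of_tokens`). -/

namespace SimpleGraph

open scoped Classical

/-! ### Connected sets, neighbourhoods and chordless paths. -/

section Basic

variable {V : Type u}

/-- Every nonempty proper subset of the nonempty set `X` is joined to the rest of `X`
by an edge. -/
def ConnectedOn (G : SimpleGraph V) (X : Finset V) : Prop :=
  X.Nonempty ∧ ∀ A ⊆ X, A.Nonempty → A ≠ X → ∃ a ∈ A, ∃ b ∈ X, b ∉ A ∧ G.Adj a b

/-- No edge joins the finite sets `A` and `B`. -/
def Anti (G : SimpleGraph V) (A B : Finset V) : Prop :=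
  ∀ a ∈ A, ∀ b ∈ B, ¬ G.Adj a b

/-- The vertices of `Z` with a neighbour in `X`. -/
noncomputable def nbrIn (G : SimpleGraph V) (X Z : Finset V) : Finset V :=
  Z.filter fun z => ∃ x ∈ X, G.Adj x z

/-- The vertices of `W` that lie in `X` or have a neighbour in `X`. -/
noncomputable def closedNbrIn (G : SimpleGraph V) (X W : Finset V) : Finset V :=
  W.filter fun w => w ∈ X ∨ ∃ x ∈ X, G.Adj x w

variable {G : SimpleGraph V} {X Y Z W A B : Finset V} {x y z : V}

lemma mem_nbrIn : z ∈ G.nbrIn X Z ↔ z ∈ Z ∧ ∃ x ∈ X, G.Adj x z := by simp [nbrIn]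

lemma mem_closedNbrIn : z ∈ G.closedNbrIn X W ↔ z ∈ W ∧ (z ∈ X ∨ ∃ x ∈ X, G.Adj x z) := by
  simp [closedNbrIn]

lemma nbrIn_subset : G.nbrIn X Z ⊆ Z := Finset.filter_subset _ _

lemma closedNbrIn_subset : G.closedNbrIn X W ⊆ W := Finset.filter_subset _ _

lemma nbrIn_mono (h : X ⊆ Y) (h' : Z ⊆ W) : G.nbrIn X Z ⊆ G.nbrIn Y W := by
  intro z hz
  obtain ⟨h1, x, hx, h2⟩ := mem_nbrIn.1 hz
  exact mem_nbrIn.2 ⟨h' h1, x, h hx, h2⟩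

lemma closedNbrIn_mono (h : X ⊆ Y) (h' : Z ⊆ W) : G.closedNbrIn X Z ⊆ G.closedNbrIn Y W := by
  intro z hz
  obtain ⟨h1, h2⟩ := mem_closedNbrIn.1 hz
  refine mem_closedNbrIn.2 ⟨h' h1, ?_⟩
  rcases h2 with h2 | ⟨x, hx, h2⟩
  · exact Or.inl (h h2)
  · exact Or.inr ⟨x, h hx, h2⟩

lemma nbrIn_subset_closedNbrIn (h : Z ⊆ W) : G.nbrIn X Z ⊆ G.closedNbrIn X W := by
  intro z hz
  obtain ⟨h1, h2⟩ := mem_nbrIn.1 hz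
  exact mem_closedNbrIn.2 ⟨h h1, Or.inr h2⟩

lemma Anti.symm (h : G.Anti A B) : G.Anti B A := fun b hb a ha hab => h a ha b hb hab.symm

lemma Anti.mono {A' B' : Finset V} (h : G.Anti A B) (hA : A' ⊆ A) (hB : B' ⊆ B) :
    G.Anti A' B' := fun a ha b hb => h a (hA ha) b (hB hb)

lemma anti_sdiff_closedNbrIn : G.Anti X (W \ G.closedNbrIn X W) := by
  intro a ha b hb hab
  rw [Finset.mem_sdiff, mem_closedNbrIn] at hb
  exact hb.2 ⟨hb.1, Or.inr ⟨a, ha, hab⟩⟩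

lemma disjoint_sdiff_closedNbrIn : Disjoint X (W \ G.closedNbrIn X W) := by
  rw [Finset.disjoint_left]
  intro a ha hb
  rw [Finset.mem_sdiff, mem_closedNbrIn] at hb
  exact hb.2 ⟨hb.1, Or.inl ha⟩

lemma anti_sdiff_nbrIn : G.Anti X (W \ G.nbrIn X W) := by
  intro a ha b hb hab
  rw [Finset.mem_sdiff, mem_nbrIn] at hb
  exact hb.2 ⟨hb.1, a, ha, hab⟩

lemma connectedOn_singleton (x : V) : G.ConnectedOn {x} := by
  refine ⟨Finset.singleton_nonempty x, fun A hA hne hne' => ?_⟩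
  rcases Finset.subset_singleton_iff.1 hA with h | h
  · simp [h] at hne
  · exact absurd h hne'

lemma ConnectedOn.insert_of_adj (hX : G.ConnectedOn X) (hx : x ∈ X) (h : G.Adj x y) :
    G.ConnectedOn (insert y X) := by
  refine ⟨Finset.insert_nonempty _ _, fun A hA hne hne' => ?_⟩
  by_cases hAX : X ⊆ A
  · by_cases hy : y ∈ A
    · exact absurd (Finset.Subset.antisymm hA (Finset.insert_subset hy hAX)) hne'
    · exact ⟨x, hAX hx, y, Finset.mem_insert_self _ _, hy, h⟩
  · by_cases hAe : (A ∩ X).Nonempty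
    · obtain ⟨a, ha, b, hb, hbA, hab⟩ := hX.2 (A ∩ X) Finset.inter_subset_right hAe
        (fun h => hAX (h ▸ Finset.inter_subset_left))
      refine ⟨a, (Finset.mem_inter.1 ha).1, b, Finset.mem_insert_of_mem hb, fun hbA' => ?_, hab⟩
      exact hbA (Finset.mem_inter.2 ⟨hbA', hb⟩)
    · obtain ⟨a, ha⟩ := hne
      have haX : a ∉ X := fun h => hAe ⟨a, Finset.mem_inter.2 ⟨ha, h⟩⟩
      have hay : a = y := by
        rcases Finset.mem_insert.1 (hA ha) with h | h
        · exact h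
        · exact absurd h haX
      subst hay
      exact ⟨a, ha, x, Finset.mem_insert_of_mem hx,
        fun h => hAe ⟨x, Finset.mem_inter.2 ⟨h, hx⟩⟩, h.symm⟩

lemma ConnectedOn.union (hX : G.ConnectedOn X) (hY : G.ConnectedOn Y)
    (h : ∃ x ∈ X, ∃ y ∈ Y, x = y ∨ G.Adj x y) : G.ConnectedOn (X ∪ Y) := by
  obtain ⟨x, hx, y, hy, hxy⟩ := h
  refine ⟨hX.1.mono Finset.subset_union_left, fun A hA hne hne' => ?_⟩
  have key : ∀ (P : Finset V), G.ConnectedOn P → P ⊆ X ∪ Y → (A ∩ P).Nonempty → ¬ P ⊆ A →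
      ∃ a ∈ A, ∃ b ∈ X ∪ Y, b ∉ A ∧ G.Adj a b := by
    intro P hP hPs hAP hPA
    obtain ⟨a, ha, b, hb, hbA, hab⟩ := hP.2 (A ∩ P) Finset.inter_subset_right hAP
        (fun h => hPA (h ▸ Finset.inter_subset_left))
    exact ⟨a, (Finset.mem_inter.1 ha).1, b, hPs hb,
      fun hbA' => hbA (Finset.mem_inter.2 ⟨hbA', hb⟩), hab⟩
  by_cases hXA : X ⊆ A
  · by_cases hYA : Y ⊆ A
    · exact absurd (Finset.Subset.antisymm hA (Finset.union_subset hXA hYA)) hne'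
    · by_cases hAY : (A ∩ Y).Nonempty
      · exact key Y hY Finset.subset_union_right hAY hYA
      · have hyA : y ∉ A := fun h => hAY ⟨y, Finset.mem_inter.2 ⟨h, hy⟩⟩
        rcases hxy with rfl | hxy
        · exact absurd (hXA hx) hyA
        · exact ⟨x, hXA hx, y, Finset.mem_union_right _ hy, hyA, hxy⟩
  · by_cases hAX : (A ∩ X).Nonempty
    · exact key X hX Finset.subset_union_left hAX hXA
    · have hxA : x ∉ A := fun h => hAX ⟨x, Finset.mem_inter.2 ⟨h, hx⟩⟩
      by_cases hYA : Y ⊆ A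
      · rcases hxy with rfl | hxy
        · exact absurd (hYA hy) hxA
        · exact ⟨y, hYA hy, x, Finset.mem_union_left _ hx, hxA, hxy.symm⟩
      · obtain ⟨a, ha⟩ := hne
        have haY : a ∈ Y := by
          rcases Finset.mem_union.1 (hA ha) with h | h
          · exact absurd ⟨a, Finset.mem_inter.2 ⟨ha, h⟩⟩ hAX
          · exact h
        exact key Y hY Finset.subset_union_right ⟨a, Finset.mem_inter.2 ⟨ha, haY⟩⟩ hYA

/-- A connected set can be grown vertex by vertex until it first satisfies `P`. -/
lemma ConnectedOn.grow (hX : G.ConnectedOn X) (hx : x ∈ X) (P : Finset V → Prop) (hP : P X) :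
    ∃ Q ⊆ X, x ∈ Q ∧ G.ConnectedOn Q ∧ P Q ∧
      (Q = {x} ∨ ∃ Q' y, G.ConnectedOn Q' ∧ Q' ⊆ X ∧ ¬ P Q' ∧ Q = insert y Q') := by
  by_cases h0 : P {x}
  · exact ⟨{x}, by simpa using hx, by simp, connectedOn_singleton x, h0, Or.inl rfl⟩
  -- A largest connected set through `x` that fails `P`: any further vertex of `X` attached to it
  -- makes `P` true.
  obtain ⟨Q, hQ, hmax⟩ := Finset.exists_max_image
    (X.powerset.filter fun Q => x ∈ Q ∧ G.ConnectedOn Q ∧ ¬ P Q) Finset.card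
    ⟨{x}, by simp [hx, connectedOn_singleton, h0]⟩
  simp only [Finset.mem_filter, Finset.mem_powerset] at hQ hmax
  obtain ⟨hQX, hxQ, hQc, hQP⟩ := hQ
  obtain ⟨a, ha, b, hb, hbQ, hab⟩ := hX.2 Q hQX hQc.1 (fun h => hQP (h ▸ hP))
  have hins : insert b Q ⊆ X := Finset.insert_subset hb hQX
  refine ⟨insert b Q, hins, Finset.mem_insert_of_mem hxQ, hQc.insert_of_adj ha hab, ?_,
    Or.inr ⟨Q, b, hQc, hQX, hQP, rfl⟩⟩
  by_contra hP'
  have := hmax _ ⟨hins, Finset.mem_insert_of_mem hxQ, hQc.insert_of_adj ha hab, hP'⟩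
  rw [Finset.card_insert_of_notMem hbQ] at this
  omega

lemma ConnectedOn.exists_walk (hX : G.ConnectedOn X) (hx : x ∈ X) (hy : y ∈ X) :
    ∃ p : G.Walk x y, ∀ z ∈ p.support, z ∈ X := by
  set A := X.filter fun z => ∃ p : G.Walk x z, ∀ t ∈ p.support, t ∈ X with hA
  have hxA : x ∈ A := by
    rw [hA, Finset.mem_filter]
    exact ⟨hx, Walk.nil, by simpa using hx⟩
  have hAX : A = X := by
    by_contra hne
    obtain ⟨a, ha, b, hb, hbA, hab⟩ := hX.2 A (Finset.filter_subset _ _) ⟨x, hxA⟩ hne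
    rw [hA, Finset.mem_filter] at ha
    obtain ⟨_, p, hp⟩ := ha
    refine hbA ?_
    rw [hA, Finset.mem_filter]
    refine ⟨hb, p.concat hab, fun t ht => ?_⟩
    rw [Walk.support_concat] at ht
    simp only [List.mem_append, List.mem_singleton] at ht
    rcases ht with ht | rfl
    · exact hp t ht
    · exact hb
  rw [← hAX, hA, Finset.mem_filter] at hy
  exact hy.2

/-- A shortest walk inside a vertex set is a chordless path. -/
lemma exists_isPath_isChordless {T : Set V} (p : G.Walk x y) (hp : ∀ z ∈ p.support, z ∈ T) :
    ∃ q : G.Walk x y, q.IsPath ∧ q.IsChordless ∧ ∀ z ∈ q.support, z ∈ T := by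
  have hex : ∃ n, ∃ q : G.Walk x y, (∀ z ∈ q.support, z ∈ T) ∧ q.length = n := ⟨_, p, hp, rfl⟩
  obtain ⟨q₀, hq₀, hlen₀⟩ := Nat.find_spec hex
  have hmin : ∀ q : G.Walk x y, (∀ z ∈ q.support, z ∈ T) → q₀.bypass.length ≤ q.length := by
    intro q hq
    have h1 := Nat.find_min' hex ⟨q, hq, rfl⟩
    have h2 := q₀.length_bypass_le_length
    omega
  have hT : ∀ z ∈ q₀.bypass.support, z ∈ T := fun z hz => hq₀ z (q₀.support_bypass_subset_support hz)
  refine ⟨q₀.bypass, q₀.bypass_isPath, ?_, hT⟩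
  generalize q₀.bypass = q at hmin hT
  -- Replacing `r1` by the edge `ab` gives a walk that stays in `T`, so minimality forces `r1` to be
  -- a single edge.
  have key : ∀ (a b : V) (q1 : G.Walk x a) (r1 : G.Walk a b) (r2 : G.Walk b y),
      q = q1.append (r1.append r2) → G.Adj a b → s(a, b) ∈ q.edges := by
    rintro a b q1 r1 r2 rfl hab
    have h := hmin (q1.append (Walk.cons hab r2)) (by
      intro z hz
      apply hT
      simp only [Walk.mem_support_append_iff, Walk.support_cons, List.mem_cons] at hz ⊢
      rcases hz with hz | rfl | hz
      · exact Or.inl hz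
      · exact Or.inl (Walk.end_mem_support _)
      · exact Or.inr (Or.inr hz))
    simp only [Walk.length_append, Walk.length_cons] at h
    cases r1 with
    | nil => exact absurd rfl hab.ne
    | cons h' r =>
      cases r with
      | nil => simp
      | cons h'' r' => simp only [Walk.length_cons] at h; omega
  rw [Walk.isChordless_iff_forall_mem_edges]
  intro a b ha hb hab
  obtain ⟨q1, q2, rfl⟩ := Walk.mem_support_iff_exists_append.1 ha
  rw [Walk.mem_support_append_iff] at hb
  rcases hb with hb | hb
  · obtain ⟨r1, r2, rfl⟩ := Walk.mem_support_iff_exists_append.1 hb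
    rw [Sym2.eq_swap]
    exact key b a r1 r2 q2 (by rw [Walk.append_assoc]) hab.symm
  · obtain ⟨r1, r2, rfl⟩ := Walk.mem_support_iff_exists_append.1 hb
    exact key a b q1 r1 r2 rfl hab

end Basic

/-! ### Subdivision models. -/

section Model

variable {V : Type u} {G : SimpleGraph V}

/-- A family of pairwise nonadjacent vertices in which any two are joined by a connected set, such
that no further edges occur between these vertices and sets. -/
structure SubdivisionModel (G : SimpleGraph V) (m : ℕ) where
  /-- the branch vertices -/
  vert : Fin m → V
  vert_injective : Function.Injective vert
  not_adj : ∀ a b, ¬ G.Adj (vert a) (vert b)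
  /-- the connected set joining two branch vertices -/
  link : Fin m → Fin m → Finset V
  connectedOn : ∀ a b, a < b → G.ConnectedOn (link a b)
  adj_left : ∀ a b, a < b → ∃ x ∈ link a b, G.Adj (vert a) x
  adj_right : ∀ a b, a < b → ∃ x ∈ link a b, G.Adj (vert b) x
  vert_notMem : ∀ a b c, a < b → vert c ∉ link a b
  vert_anti : ∀ a b c, a < b → c ≠ a → c ≠ b → ∀ x ∈ link a b, ¬ G.Adj (vert c) x
  disjoint : ∀ a b c d, a < b → c < d → (a, b) ≠ (c, d) → Disjoint (link a b) (link c d)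
  anti : ∀ a b c d, a < b → c < d → (a, b) ≠ (c, d) → G.Anti (link a b) (link c d)

lemma SubdivisionModel.exists_walk {m : ℕ} (M : G.SubdivisionModel m) {a b : Fin m} (h : a < b) :
    ∃ q : G.Walk (M.vert a) (M.vert b), q.IsPath ∧ q.IsChordless ∧
      ∀ z ∈ q.support, z = M.vert a ∨ z = M.vert b ∨ z ∈ M.link a b := by
  obtain ⟨x, hx, hax⟩ := M.adj_left a b h
  obtain ⟨y, hy, hby⟩ := M.adj_right a b h
  obtain ⟨p, hp⟩ := (M.connectedOn a b h).exists_walk hx hy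
  refine exists_isPath_isChordless
    (T := {z | z = M.vert a ∨ z = M.vert b ∨ z ∈ M.link a b})
    (Walk.cons hax (p.concat hby.symm)) fun z hz => ?_
  rw [Walk.support_cons, Walk.support_concat] at hz
  simp only [List.mem_append, List.mem_cons, List.not_mem_nil,
    or_false] at hz
  rcases hz with rfl | hz | rfl
  · exact Or.inl rfl
  · exact Or.inr (Or.inr (hp z hz))
  · exact Or.inr (Or.inl rfl)

end Model

/-! ### From a subdivision model to an induced subdivision. -/

section Extraction

variable {V : Type u} {W : Type v} {G : SimpleGraph V}

lemma Walk.mem_support_induce {S : Set V} {x y : V} (p : G.Walk x y) (hp : ∀ z ∈ p.support, z ∈ S)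
    (z : S) : z ∈ (p.induce S hp).support ↔ (z : V) ∈ p.support := by
  rw [Walk.support_induce, List.mem_attachWith]

lemma Walk.mem_edges_induce {S : Set V} {x y : V} (p : G.Walk x y) (hp : ∀ z ∈ p.support, z ∈ S)
    (a b : S) (h : s((a : V), (b : V)) ∈ p.edges) : s(a, b) ∈ (p.induce S hp).edges := by
  induction p with
  | nil => simp at h
  | cons h' q ih =>
    rw [Walk.edges_cons, List.mem_cons] at h
    rw [Walk.induce_cons, Walk.edges_cons, List.mem_cons]
    refine h.imp (fun h => ?_) (fun h => ih _ h)
    rw [Sym2.eq_iff] at h ⊢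
    exact h.imp (fun h => ⟨Subtype.ext h.1, Subtype.ext h.2⟩)
      (fun h => ⟨Subtype.ext h.1, Subtype.ext h.2⟩)

lemma Walk.isPath_induce {S : Set V} {x y : V} (p : G.Walk x y) (hp : ∀ z ∈ p.support, z ∈ S)
    (h : p.IsPath) : (p.induce S hp).IsPath := by
  rw [← p.map_induce hp] at h
  exact h.of_map

lemma Walk.induce_eq_reverse {S : Set V} {x y : V} {p : G.Walk x y} {q : G.Walk y x}
    (h : q = p.reverse) (hp : ∀ z ∈ p.support, z ∈ S) (hq : ∀ z ∈ q.support, z ∈ S) :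
    q.induce S hq = (p.induce S hp).reverse := by
  apply Walk.ext_support
  apply List.map_injective_iff.2 Subtype.val_injective
  subst h
  simp [Walk.support_induce]

/-- The path is chosen for `a < b` and reversed for the opposite order; independent choices would
violate the symmetry required by `Subdivision`. -/
lemma SubdivisionModel.exists_paths {m : ℕ} (M : G.SubdivisionModel m) :
    ∃ P : ∀ a b : Fin m, a ≠ b → G.Walk (M.vert a) (M.vert b),
      (∀ a b h, (P a b h).IsPath) ∧ (∀ a b h, (P a b h).IsChordless) ∧
      (∀ a b h, P b a h.symm = (P a b h).reverse) ∧
      ∀ a b h, ∀ z ∈ (P a b h).support,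
        z = M.vert a ∨ z = M.vert b ∨ z ∈ M.link (min a b) (max a b) := by
  choose q hq1 hq2 hq3 using fun (a b : Fin m) (h : a < b) => M.exists_walk h
  refine ⟨fun a b h => if hab : a < b then q a b hab else
    (q b a (lt_of_le_of_ne (not_lt.1 hab) h.symm)).reverse, ?_, ?_, ?_, ?_⟩
  · intro a b h
    by_cases hab : a < b
    · simp only [hab, dif_pos]; exact hq1 _ _ _
    · simp only [hab, dif_neg, not_false_eq_true]; exact (hq1 _ _ _).reverse
  · intro a b h
    by_cases hab : a < b
    · simp only [hab, dif_pos]; exact hq2 _ _ _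
    · simp only [hab, dif_neg, not_false_eq_true]
      have := hq2 b a (lt_of_le_of_ne (not_lt.1 hab) h.symm)
      rw [Walk.isChordless_iff_forall_mem_edges] at this ⊢
      simpa using this
  · intro a b h
    rcases lt_or_gt_of_ne h with hab | hab
    · simp [hab, hab.not_gt]
    · simp [hab, hab.not_gt]
  · intro a b h z hz
    rcases lt_or_gt_of_ne h with hab | hab
    · simp only [hab, dif_pos] at hz
      rw [min_eq_left hab.le, max_eq_right hab.le]
      exact hq3 _ _ _ z hz
    · simp only [hab.not_gt, dif_neg, not_false_eq_true, Walk.support_reverse,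
        List.mem_reverse] at hz
      rw [min_eq_right hab.le, max_eq_left hab.le]
      rcases hq3 _ _ _ z hz with h | h | h
      · exact Or.inr (Or.inl h)
      · exact Or.inl h
      · exact Or.inr (Or.inr h)

lemma mk_min_max_ne {m : ℕ} {a b c d : Fin m} (h : s(a, b) ≠ s(c, d)) :
    (min a b, max a b) ≠ (min c d, max c d) := by
  intro h'
  rw [Prod.mk.injEq] at h'
  apply h
  rw [Sym2.eq_iff]
  rcases le_total a b with h1 | h1 <;> rcases le_total c d with h2 | h2 <;>
    simp only [h1, h2, min_eq_left, min_eq_right, max_eq_left, max_eq_right] at h' <;> tauto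

/-- A graph with a subdivision model on `m` branch vertices contains an induced subdivision of
every graph with `m` vertices. -/
theorem SubdivisionModel.containsInducedSubdivision {m : ℕ} (M : G.SubdivisionModel m)
    (H : SimpleGraph W) (e : W ≃ Fin m) : G.ContainsInducedSubdivision H := by
  obtain ⟨P, hP, hPc, hPs, hPm⟩ := M.exists_paths
  have hne : ∀ {a b : W}, H.Adj a b → e a ≠ e b := fun h => e.injective.ne h.ne
  have hlt : ∀ {a b : W}, H.Adj a b → min (e a) (e b) < max (e a) (e b) :=
    fun h => min_lt_max.2 (hne h)
  set S : Set V := {z | (∃ a, z = M.vert (e a)) ∨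
    ∃ (a b : W) (h : H.Adj a b), z ∈ (P (e a) (e b) (hne h)).support} with hS
  have hPS : ∀ {a b : W} (h : H.Adj a b), ∀ z ∈ (P (e a) (e b) (hne h)).support, z ∈ S :=
    fun {a b} h z hz => Or.inr ⟨a, b, h, hz⟩
  have hvertlink : ∀ {a b : W} (h : H.Adj a b) (c : W),
      M.vert (e c) ∉ M.link (min (e a) (e b)) (max (e a) (e b)) :=
    fun h c => M.vert_notMem _ _ _ (hlt h)
  have hcase : ∀ {a b : W} (h : H.Adj a b), ∀ z ∈ (P (e a) (e b) (hne h)).support,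
      (∃ c, z = M.vert (e c)) ∨ z ∈ M.link (min (e a) (e b)) (max (e a) (e b)) := by
    intro a b h z hz
    rcases hPm _ _ _ z hz with h' | h' | h'
    · exact Or.inl ⟨a, h'⟩
    · exact Or.inl ⟨b, h'⟩
    · exact Or.inr h'
  have hends : ∀ {a b : W} (h : H.Adj a b) (c : W), ∀ z ∈ (P (e a) (e b) (hne h)).support,
      z ∈ M.link (min (e a) (e b)) (max (e a) (e b)) → G.Adj (M.vert (e c)) z →
      s(M.vert (e c), z) ∈ (P (e a) (e b) (hne h)).edges := by
    intro a b h c z hz hzl hadj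
    refine (hPc _ _ _).mem_edges ?_ hz hadj
    by_cases hca : e c = e a
    · rw [hca]; exact Walk.start_mem_support _
    by_cases hcb : e c = e b
    · rw [hcb]; exact Walk.end_mem_support _
    refine absurd hadj (M.vert_anti _ _ _ (hlt h) ?_ ?_ z hzl)
    · rcases min_choice (e a) (e b) with h | h <;> rw [h] <;> assumption
    · rcases max_choice (e a) (e b) with h | h <;> rw [h] <;> assumption
  refine ⟨S, ⟨{
    branch := fun c => ⟨M.vert (e c), Or.inl ⟨c, rfl⟩⟩
    branch_injective := fun a b h => e.injective (M.vert_injective (congrArg Subtype.val h))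
    path := fun {a b} h => (P (e a) (e b) (hne h)).induce S (hPS h)
    isPath := fun h => Walk.isPath_induce _ _ (hP _ _ _)
    path_symm := ?_
    branch_mem := ?_
    disjoint := ?_
    vertex_cover := ?_
    edge_cover := ?_ }⟩⟩
  · intro a b h
    exact Walk.induce_eq_reverse (hPs _ _ (hne h)) _ _
  · intro a b h c hc
    rw [Walk.mem_support_induce] at hc
    rcases hPm _ _ _ _ hc with h' | h' | h'
    · exact Or.inl (e.injective (M.vert_injective h'))
    · exact Or.inr (e.injective (M.vert_injective h'))
    · exact absurd h' (hvertlink h c)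
  · intro a b c d h h' hne' x hx hx'
    rw [Walk.mem_support_induce] at hx hx'
    rcases hcase h _ hx with ⟨i, hi⟩ | hx1
    · exact ⟨i, Subtype.ext hi.symm⟩
    rcases hcase h' _ hx' with ⟨i, hi⟩ | hx2
    · exact ⟨i, Subtype.ext hi.symm⟩
    have hes : s(e a, e b) ≠ s(e c, e d) := fun heq =>
      hne' (Sym2.map.injective e.injective (by simpa using heq))
    exact absurd hx2 (Finset.disjoint_left.1
      (M.disjoint _ _ _ _ (hlt h) (hlt h') (mk_min_max_ne hes)) hx1)
  · rintro ⟨x, ⟨c, hc⟩ | ⟨a, b, h, hx⟩⟩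
    · exact Or.inl ⟨c, Subtype.ext hc.symm⟩
    · exact Or.inr ⟨a, b, h, (Walk.mem_support_induce _ _ _).2 hx⟩
  -- Branch vertices are pairwise nonadjacent, different links are anticomplete, and a branch vertex
  -- sees only links that end at it. So both ends of the edge lie on one path, and chordlessness
  -- puts the edge on that path.
  · intro ed
    induction ed with
    | h x y =>
      intro hxy
      have hadj : G.Adj x.1 y.1 := hxy
      have hmem : ∀ z : S, (∃ c, (z : V) = M.vert (e c)) ∨ ∃ (a b : W) (h : H.Adj a b),
          (z : V) ∈ (P (e a) (e b) (hne h)).support ∧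
          (z : V) ∈ M.link (min (e a) (e b)) (max (e a) (e b)) := by
        rintro ⟨z, ⟨c, hc⟩ | ⟨a, b, h, hz⟩⟩
        · exact Or.inl ⟨c, hc⟩
        · rcases hcase h z hz with h' | h'
          · exact Or.inl h'
          · exact Or.inr ⟨a, b, h, hz, h'⟩
      rcases hmem x with ⟨c, hc⟩ | ⟨a, b, h, hx, hxl⟩
      · rcases hmem y with ⟨d, hd⟩ | ⟨a, b, h, hy, hyl⟩
        · rw [hc, hd] at hadj
          exact absurd hadj (M.not_adj _ _)
        · refine ⟨a, b, h, Walk.mem_edges_induce _ _ _ _ ?_⟩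
          rw [hc] at hadj ⊢
          exact hends h c _ hy hyl hadj
      · rcases hmem y with ⟨d, hd⟩ | ⟨a', b', h', hy, hyl⟩
        · refine ⟨a, b, h, Walk.mem_edges_induce _ _ _ _ ?_⟩
          rw [hd] at hadj ⊢
          rw [Sym2.eq_swap]
          exact hends h d _ hx hxl hadj.symm
        · by_cases hes : s(e a, e b) = s(e a', e b')
          · refine ⟨a, b, h, Walk.mem_edges_induce _ _ _ _ ((hPc _ _ _).mem_edges hx ?_ hadj)⟩
            rw [Sym2.eq_iff] at hes
            rcases hes with ⟨h1, h2⟩ | ⟨h1, h2⟩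
            · obtain rfl := e.injective h1
              obtain rfl := e.injective h2
              exact hy
            · obtain rfl := e.injective h1
              obtain rfl := e.injective h2
              rw [hPs _ _ (hne h), Walk.support_reverse, List.mem_reverse] at hy
              exact hy
          · exact absurd hadj (M.anti _ _ _ _ (hlt h) (hlt h') (mk_min_max_ne hes) _ hxl _ hyl)

/-- A graph that contains `H` as an induced subgraph contains an induced subdivision of `H`. -/
theorem containsInducedSubdivision_of_embedding {H : SimpleGraph W} (f : H ↪g G) :
    G.ContainsInducedSubdivision H := by
  have key : H.IsSubdivision H := ⟨{
    branch := id
    branch_injective := Function.injective_id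
    path := fun h => h.toWalk
    isPath := fun h => h.isPath_toWalk
    path_symm := fun h => rfl
    branch_mem := fun h c hc => by simpa using hc
    disjoint := fun _ _ _ x _ _ => ⟨x, rfl⟩
    vertex_cover := fun x => Or.inl ⟨x, rfl⟩
    edge_cover := fun e => by
      induction e with
      | h x y => exact fun h => ⟨x, y, (mem_edgeSet H).1 h, by simp⟩ }⟩
  refine ContainsInducedSubdivision.of_embedding (G := H) ⟨Set.univ, key.of_iso ?_⟩ f
  exact (induceUnivIso H).symm

end Extraction

/-! ### Coherent graphs and greedy selection in them. -/

section Coherent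

variable {V : Type u} [Fintype V] {G : SimpleGraph V} {e : ℕ}

/-- All closed neighbourhoods have at most `e` vertices, and of any two disjoint anticomplete sets
one has fewer than `e` vertices. -/
structure Coherent (G : SimpleGraph V) (e : ℕ) : Prop where
  card_closedNbr_le : ∀ v, (G.closedNbrIn {v} Finset.univ).card ≤ e
  card_lt_of_anti : ∀ A B : Finset V, Disjoint A B → G.Anti A B → A.card < e ∨ B.card < e

lemma Coherent.card_closedNbrIn_le (h : G.Coherent e) (X W : Finset V) :
    (G.closedNbrIn X W).card ≤ X.card * e := by
  calc (G.closedNbrIn X W).card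
      ≤ (X.biUnion fun x => G.closedNbrIn {x} Finset.univ).card := by
        apply Finset.card_le_card
        intro z hz
        obtain ⟨_, h2⟩ := mem_closedNbrIn.1 hz
        rw [Finset.mem_biUnion]
        rcases h2 with h2 | ⟨x, hx, h2⟩
        · exact ⟨z, h2, mem_closedNbrIn.2 ⟨Finset.mem_univ _, Or.inl (by simp)⟩⟩
        · exact ⟨x, hx, mem_closedNbrIn.2 ⟨Finset.mem_univ _, Or.inr ⟨x, by simp, h2⟩⟩⟩
    _ ≤ X.card * e := Finset.card_biUnion_le_card_mul _ _ _ fun x _ => h.card_closedNbr_le x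

lemma Coherent.card_nbrIn_singleton_le (h : G.Coherent e) (v : V) (W : Finset V) :
    (G.nbrIn {v} W).card ≤ e := by
  refine (Finset.card_le_card ?_).trans (h.card_closedNbr_le v)
  exact nbrIn_subset_closedNbrIn (Finset.subset_univ _)

lemma Coherent.card_closedNbrIn_insert_le (h : G.Coherent e) (y : V) (X W : Finset V) :
    (G.closedNbrIn (insert y X) W).card ≤ (G.closedNbrIn X W).card + e := by
  have : G.closedNbrIn (insert y X) W ⊆ G.closedNbrIn X W ∪ G.closedNbrIn {y} Finset.univ := by
    intro z hz
    rw [Finset.mem_union]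
    obtain ⟨h1, h2⟩ := mem_closedNbrIn.1 hz
    rcases h2 with h2 | ⟨x, hx, h2⟩
    · rcases Finset.mem_insert.1 h2 with rfl | h2
      · exact Or.inr (mem_closedNbrIn.2 ⟨Finset.mem_univ _, Or.inl (by simp)⟩)
      · exact Or.inl (mem_closedNbrIn.2 ⟨h1, Or.inl h2⟩)
    · rcases Finset.mem_insert.1 hx with rfl | hx
      · exact Or.inr (mem_closedNbrIn.2 ⟨Finset.mem_univ _, Or.inr ⟨x, by simp, h2⟩⟩)
      · exact Or.inl (mem_closedNbrIn.2 ⟨h1, Or.inr ⟨x, hx, h2⟩⟩)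
  calc _ ≤ _ := Finset.card_le_card this
    _ ≤ _ := Finset.card_union_le _ _
    _ ≤ _ := Nat.add_le_add_left (h.card_closedNbr_le y) _

lemma Coherent.card_nbrIn_insert_le (h : G.Coherent e) (y : V) (X Z : Finset V) :
    (G.nbrIn (insert y X) Z).card ≤ (G.nbrIn X Z).card + e := by
  have : G.nbrIn (insert y X) Z ⊆ G.nbrIn X Z ∪ G.nbrIn {y} Z := by
    intro z hz
    rw [Finset.mem_union]
    obtain ⟨h1, x, hx, h2⟩ := mem_nbrIn.1 hz
    rcases Finset.mem_insert.1 hx with rfl | hx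
    · exact Or.inr (mem_nbrIn.2 ⟨h1, x, by simp, h2⟩)
    · exact Or.inl (mem_nbrIn.2 ⟨h1, x, hx, h2⟩)
  calc _ ≤ _ := Finset.card_le_card this
    _ ≤ _ := Finset.card_union_le _ _
    _ ≤ _ := Nat.add_le_add_left (h.card_nbrIn_singleton_le y Z) _

/-- If `X` is large then few vertices of `W` have no neighbour in `X`. -/
lemma Coherent.card_sdiff_closedNbrIn_lt (h : G.Coherent e) {X : Finset V} (hX : e ≤ X.card)
    (W : Finset V) : (W \ G.closedNbrIn X W).card < e := by
  rcases h.card_lt_of_anti X (W \ G.closedNbrIn X W) disjoint_sdiff_closedNbrIn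
    anti_sdiff_closedNbrIn with h | h
  · omega
  · exact h

/-- A large set contains a large connected set. -/
lemma Coherent.exists_connectedOn (h : G.Coherent e) (he : 0 < e) {W : Finset V}
    (hW : 3 * e ≤ W.card) : ∃ X ⊆ W, G.ConnectedOn X ∧ e ≤ X.card := by
  -- `A` is a smallest union of components of `W` with at least `e` vertices. If it split into two
  -- anticomplete parts, both would have fewer than `e` vertices, so more than `e` vertices of `W`
  -- would lie outside `A`, anticomplete to it.
  obtain ⟨A, hA, hmin⟩ := Finset.exists_min_image
    (W.powerset.filter fun A => e ≤ A.card ∧ G.Anti A (W \ A)) Finset.card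
    ⟨W, Finset.mem_filter.2 ⟨by simp, by omega, fun a _ b hb => by simp at hb⟩⟩
  simp only [Finset.mem_filter, Finset.mem_powerset] at hA hmin
  obtain ⟨hAW, hAe, hanti⟩ := hA
  refine ⟨A, hAW, ⟨Finset.card_pos.1 (by omega), ?_⟩, hAe⟩
  by_contra hcon
  push Not at hcon
  obtain ⟨B, hBA, hBne, hBA', hB⟩ := hcon
  have hAB : G.Anti B (A \ B) := fun a ha b hb => by
    rw [Finset.mem_sdiff] at hb
    exact hB a ha b hb.1 hb.2
  have h1 : G.Anti B (W \ B) := by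
    intro a ha b hb hab
    rw [Finset.mem_sdiff] at hb
    by_cases hbA : b ∈ A
    · exact hB a ha b hbA hb.2 hab
    · exact hanti a (hBA ha) b (Finset.mem_sdiff.2 ⟨hb.1, hbA⟩) hab
  have h2 : G.Anti (A \ B) (W \ (A \ B)) := by
    intro a ha b hb hab
    rw [Finset.mem_sdiff] at hb ha
    by_cases hbA : b ∈ A
    · have hbB : b ∈ B := by
        by_contra hbB
        exact hb.2 (Finset.mem_sdiff.2 ⟨hbA, hbB⟩)
      exact hB b hbB a ha.1 ha.2 hab.symm
    · exact hanti a ha.1 b (Finset.mem_sdiff.2 ⟨hb.1, hbA⟩) hab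
  have hcA : (A \ B).card + B.card = A.card := Finset.card_sdiff_add_card_eq_card hBA
  have hBpos : 0 < B.card := Finset.card_pos.2 hBne
  have hBlt : B.card < A.card := Finset.card_lt_card (hBA.ssubset_of_ne hBA')
  have h3 : B.card < e := by
    by_contra h3
    have := hmin B ⟨hBA.trans hAW, by omega, h1⟩
    omega
  have h4 : (A \ B).card < e := by
    by_contra h4
    have := hmin (A \ B) ⟨Finset.sdiff_subset.trans hAW, by omega, h2⟩
    omega
  have hcW : (W \ A).card + A.card = W.card := Finset.card_sdiff_add_card_eq_card hAW
  rcases h.card_lt_of_anti A (W \ A) Finset.disjoint_sdiff hanti with h5 | h5 <;> omega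

/-- Sequential choice of finitely many objects subject to pairwise constraints. -/
lemma exists_seq_of_forall {α : Type*} [Nonempty α] (n : ℕ) (A : ℕ → α → Prop)
    (B : ℕ → ℕ → α → α → Prop)
    (h : ∀ k < n, ∀ f : ℕ → α, (∀ t < k, A t (f t)) → (∀ t < k, ∀ s < t, B s t (f s) (f t)) →
      ∃ x, A k x ∧ ∀ s < k, B s k (f s) x) :
    ∃ f : ℕ → α, (∀ t < n, A t (f t)) ∧ ∀ t < n, ∀ s < t, B s t (f s) (f t) := by
  have key : ∀ k ≤ n, ∃ f : ℕ → α, (∀ t < k, A t (f t)) ∧ ∀ t < k, ∀ s < t, B s t (f s) (f t) := by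
    intro k
    induction k with
    | zero => exact fun _ => ⟨fun _ => Classical.arbitrary α, by simp, by simp⟩
    | succ k ih =>
      intro hk
      obtain ⟨f, hf1, hf2⟩ := ih (by omega)
      obtain ⟨x, hx1, hx2⟩ := h k (by omega) f hf1 hf2
      refine ⟨Function.update f k x, fun t ht => ?_, fun t ht s hs => ?_⟩
      · rcases Nat.lt_succ_iff_lt_or_eq.1 ht with ht | rfl
        · rw [Function.update_of_ne ht.ne]; exact hf1 t ht
        · rw [Function.update_self]; exact hx1
      · rcases Nat.lt_succ_iff_lt_or_eq.1 ht with ht | rfl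
        · rw [Function.update_of_ne ht.ne, Function.update_of_ne (by omega)]
          exact hf2 t ht s hs
        · rw [Function.update_self, Function.update_of_ne hs.ne]
          exact hx2 s hs
  exact key n le_rfl

/-- Greedy choice of pairwise anticomplete small sets. -/
lemma Coherent.greedy (h : G.Coherent e) {ι α : Type*} [Fintype ι] (cand : ι → α → Prop)
    (supp : α → Finset V) (b : ℕ) (F₀ : Finset V)
    (hb : ∀ i x, cand i x → (supp x).card ≤ b)
    (havail : ∀ i, ∀ F : Finset V, F.card ≤ F₀.card + Fintype.card ι * (b * e) → F₀ ⊆ F →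
      ∃ x, cand i x ∧ Disjoint (supp x) F) :
    ∃ f : ι → α, (∀ i, cand i (f i)) ∧ (∀ i, Disjoint (supp (f i)) F₀) ∧
      ∀ i j, i ≠ j → Disjoint (supp (f i)) (supp (f j)) ∧ G.Anti (supp (f i)) (supp (f j)) := by
  rcases isEmpty_or_nonempty ι with hι | ⟨⟨i₀⟩⟩
  · exact ⟨fun i => isEmptyElim i, fun i => isEmptyElim i, fun i => isEmptyElim i,
      fun i => isEmptyElim i⟩
  have : Nonempty α := ⟨(havail i₀ F₀ (by omega) (le_refl _)).choose⟩
  let σ := Fintype.equivFin ι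
  let g : ℕ → ι := fun t => if ht : t < Fintype.card ι then σ.symm ⟨t, ht⟩ else i₀
  obtain ⟨f, hf1, hf2⟩ := exists_seq_of_forall (Fintype.card ι)
    (fun t x => cand (g t) x ∧ Disjoint (supp x) F₀)
    (fun _ _ x y => Disjoint (supp y) (G.closedNbrIn (supp x) Finset.univ)) (by
      intro k hk f hf _
      -- Besides `F₀`, it suffices to avoid the closed neighbourhoods of the earlier supports, each
      -- of at most `b * e` vertices.
      obtain ⟨x, hx1, hx2⟩ := havail (g k) (F₀ ∪ (Finset.range k).biUnion fun t =>
        G.closedNbrIn (supp (f t)) Finset.univ) (by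
          refine (Finset.card_union_le _ _).trans (Nat.add_le_add_left ?_ _)
          refine (Finset.card_biUnion_le_card_mul _ _ (b * e) ?_).trans ?_
          · intro t ht
            rw [Finset.mem_range] at ht
            exact (h.card_closedNbrIn_le _ _).trans (Nat.mul_le_mul_right _ (hb _ _ (hf t ht).1))
          · rw [Finset.card_range]
            exact Nat.mul_le_mul_right _ hk.le) Finset.subset_union_left
      rw [Finset.disjoint_union_right, Finset.disjoint_biUnion_right] at hx2
      exact ⟨x, ⟨hx1, hx2.1⟩, fun s hs => hx2.2 s (Finset.mem_range.2 hs)⟩)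
  have hg : ∀ i, g (σ i) = i := fun i => by simp [g]
  have hfar : ∀ {x y : α}, Disjoint (supp y) (G.closedNbrIn (supp x) Finset.univ) →
      Disjoint (supp x) (supp y) ∧ G.Anti (supp x) (supp y) := by
    intro x y hxy
    rw [Finset.disjoint_left] at hxy
    refine ⟨Finset.disjoint_right.2 fun z hz hz' => hxy hz ?_, fun a ha c hc hac => hxy hc ?_⟩
    · exact mem_closedNbrIn.2 ⟨Finset.mem_univ _, Or.inl hz'⟩
    · exact mem_closedNbrIn.2 ⟨Finset.mem_univ _, Or.inr ⟨a, ha, hac⟩⟩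
  refine ⟨fun i => f (σ i), fun i => ?_, fun i => (hf1 _ (σ i).2).2, fun i j hij => ?_⟩
  · have := (hf1 _ (σ i).2).1
    rwa [hg] at this
  · have hne : (σ i : ℕ) ≠ σ j := fun h => hij (σ.injective (Fin.ext h))
    rcases lt_or_gt_of_ne hne with hlt | hlt
    · exact hfar (hf2 _ (σ j).2 _ hlt)
    · have := hfar (hf2 _ (σ i).2 _ hlt)
      exact ⟨this.1.symm, this.2.symm⟩

end Coherent

/-! ### Induced stars with leaves in distinct sets. -/

section Star

variable {V : Type u} [Fintype V] {G : SimpleGraph V} {e : ℕ}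

/-- A subset of `X` that first covers half of one of the sets `Y j`. -/
lemma Coherent.exists_half_cover (h : G.Coherent e) {ι : Type*} (J : Finset ι) (Y : ι → Finset V)
    (X : Finset V) (hX : e ≤ X.card) (hJ : J.Nonempty) (hY : ∀ j ∈ J, 4 * e ≤ (Y j).card)
    (hXY : ∀ j ∈ J, Disjoint X (Y j)) (he : 0 < e) :
    ∃ S ⊆ X, ∃ j ∈ J, (Y j).card ≤ 2 * (G.nbrIn S (Y j)).card ∧
      ∀ k ∈ J, (Y k).card ≤ 4 * (Y k \ G.nbrIn S (Y k)).card := by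
  have hex : ((X.powerset).filter fun S => ∃ j ∈ J,
      (Y j).card ≤ 2 * (G.nbrIn S (Y j)).card).Nonempty := by
    obtain ⟨j, hj⟩ := hJ
    refine ⟨X, Finset.mem_filter.2 ⟨by simp, j, hj, ?_⟩⟩
    have h1 : (Y j \ G.nbrIn X (Y j)).card < e := by
      rcases h.card_lt_of_anti X (Y j \ G.nbrIn X (Y j))
        ((hXY j hj).mono_right Finset.sdiff_subset) anti_sdiff_nbrIn with h | h
      · omega
      · exact h
    have h2 := Finset.card_sdiff_add_card_eq_card (nbrIn_subset (G := G) (X := X) (Z := Y j))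
    have := hY j hj
    omega
  -- With `S` of least size, `S` minus a vertex covers less than half of every `Y k`, and the last
  -- vertex adds at most `e`, which is at most a quarter of `Y k`. Hence a quarter always stays
  -- uncovered.
  obtain ⟨S, hS, hmin⟩ := Finset.exists_min_image _ Finset.card hex
  simp only [Finset.mem_filter, Finset.mem_powerset] at hS hmin
  obtain ⟨hSX, j, hj, hSj⟩ := hS
  refine ⟨S, hSX, j, hj, hSj, fun k hk => ?_⟩
  have h2 := Finset.card_sdiff_add_card_eq_card (nbrIn_subset (G := G) (X := S) (Z := Y k))
  have h3 := hY k hk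
  have hSne : S.Nonempty := by
    have : 0 < (G.nbrIn S (Y j)).card := by have := hY j hj; omega
    obtain ⟨z, hz⟩ := Finset.card_pos.1 this
    obtain ⟨_, x, hx, _⟩ := mem_nbrIn.1 hz
    exact ⟨x, hx⟩
  obtain ⟨x, hx⟩ := hSne
  have h4 : 2 * (G.nbrIn (S.erase x) (Y k)).card < (Y k).card := by
    by_contra h4
    have := hmin (S.erase x) ⟨(Finset.erase_subset _ _).trans hSX, k, hk, by omega⟩
    rw [Finset.card_erase_of_mem hx] at this
    have := Finset.card_pos.2 ⟨x, hx⟩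
    omega
  have h5 := h.card_nbrIn_insert_le x (S.erase x) (Y k)
  rw [Finset.insert_erase hx] at h5
  omega

/-- Among many large disjoint sets there is an induced star with its leaves in distinct sets. -/
lemma Coherent.exists_star_aux (h : G.Coherent e) (he : 0 < e) {ι : Type*} (Y₀ : ι → Finset V)
    (hdisj : ∀ i j, i ≠ j → Disjoint (Y₀ i) (Y₀ j)) (d : ℕ) (n : ℕ) :
    ∀ (A : Finset ι) (Y : ι → Finset V) (C : ι → Finset ι) (S : ι → Finset V),
      A.card = n + 1 → 2 ^ d ≤ ∑ j ∈ A, 2 ^ (C j).card →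
      (∀ j ∈ A, Y j ⊆ Y₀ j) → (∀ j ∈ A, 4 ^ n * (4 * e) ≤ (Y j).card) →
      (∀ j ∈ A, Disjoint (C j) A) → (∀ j ∈ A, ∀ i ∈ C j, S i ⊆ Y₀ i) →
      (∀ j ∈ A, ∀ i ∈ C j, ∀ y ∈ Y j, ∃ w ∈ S i, G.Adj y w) →
      (∀ j ∈ A, ∀ i ∈ C j, ∀ k ∈ A, k ≠ j → G.Anti (S i) (Y k)) →
      (∀ j ∈ A, ∀ i ∈ C j, ∀ i' ∈ C j, i ≠ i' → G.Anti (S i) (S i')) →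
      ∃ j, ∃ u ∈ Y₀ j, ∃ I : Finset ι, d ≤ I.card ∧ j ∉ I ∧ ∃ w : ι → V,
        (∀ i ∈ I, w i ∈ Y₀ i ∧ G.Adj u (w i)) ∧ ∀ i ∈ I, ∀ i' ∈ I, ¬ G.Adj (w i) (w i') := by
  -- `A` holds the active indices and `C j` the indices retired in favour of `j`; for `i` in `C j`
  -- every vertex of the current `Y j` has a neighbour in `S i`, a future leaf. The active `i` with
  -- the smallest `C i` is retired: a part `T` of `Y i` covers half of some `Y j`, which shrinks to
  -- the neighbours of `T`, while every other `Y k` shrinks to the non-neighbours. The term `2 ^ (C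
  -- j).card` doubles, which pays for the lost term of `i`. When one index is left, `C j` has at
  -- least `d` elements.
  induction n with
  | zero =>
    intro A Y C S hA hsum hY hcard hCA hS hcov hanti hSS
    obtain ⟨j, rfl⟩ := Finset.card_eq_one.1 hA
    rw [Finset.sum_singleton] at hsum
    have hj : j ∈ ({j} : Finset ι) := by simp
    obtain ⟨u, hu⟩ : (Y j).Nonempty := by
      have := hcard j hj
      exact Finset.card_pos.1 (by omega)
    have : Nonempty V := ⟨u⟩
    choose! w hw hw' using fun i hi => hcov j hj i hi u hu
    refine ⟨j, u, hY j hj hu, C j, (Nat.pow_le_pow_iff_right (by norm_num)).1 hsum,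
      fun hjC => Finset.disjoint_left.1 (hCA j hj) hjC hj, w,
      fun i hi => ⟨hS j hj i hi (hw i hi), hw' i hi⟩, fun i hi i' hi' => ?_⟩
    by_cases hii : i = i'
    · subst hii; exact G.irrefl
    · exact hSS j hj i hi i' hi' hii _ (hw i hi) _ (hw i' hi')
  | succ n ih =>
    intro A Y C S hA hsum hY hcard hCA hS hcov hanti hSS
    have hAne : A.Nonempty := Finset.card_pos.1 (by omega)
    obtain ⟨i, hi, himin⟩ := Finset.exists_min_image A (fun j => (C j).card) hAne
    have hle : ∀ j ∈ A, 4 * e ≤ (Y j).card := fun j hj => by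
      have h1 := hcard j hj
      have h2 : 1 * (4 * e) ≤ 4 ^ (n + 1) * (4 * e) :=
        Nat.mul_le_mul_right _ (Nat.one_le_pow _ _ (by norm_num))
      omega
    have hcA : (A.erase i).card = n + 1 := by rw [Finset.card_erase_of_mem hi, hA]; rfl
    obtain ⟨T, hTY, j, hj, hTj, hTk⟩ := h.exists_half_cover (A.erase i) Y (Y i)
      (by have := hle i hi; omega) (Finset.card_pos.1 (by omega))
      (fun j hj => hle j (Finset.mem_of_mem_erase hj))
      (fun j hj => (hdisj i j (Finset.ne_of_mem_erase hj).symm).mono (hY i hi)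
        (hY j (Finset.mem_of_mem_erase hj))) he
    have hjA := Finset.mem_of_mem_erase hj
    have hji := Finset.ne_of_mem_erase hj
    have hiC : ∀ k ∈ A, i ∉ C k := fun k hk hik => Finset.disjoint_left.1 (hCA k hk) hik hi
    set Y' : ι → Finset V := fun k => if k = j then G.nbrIn T (Y k) else Y k \ G.nbrIn T (Y k)
      with hY'
    set C' : ι → Finset ι := Function.update C j (insert i (C j)) with hC'
    set S' : ι → Finset V := Function.update S i T with hS'
    have hYY : ∀ k, Y' k ⊆ Y k := by
      intro k
      by_cases hk : k = j
      · simp only [hY', hk, if_true]; exact nbrIn_subset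
      · simp only [hY', hk, if_false]; exact Finset.sdiff_subset
    have hCof : ∀ k ∈ A.erase i, ∀ l ∈ C' k, (k = j ∧ l = i ∧ S' l = T) ∨
        (l ∈ C k ∧ S' l = S l) := by
      intro k hk l hl
      by_cases hkj : k = j
      · subst hkj
        rw [hC', Function.update_self, Finset.mem_insert] at hl
        rcases hl with rfl | hl
        · exact Or.inl ⟨rfl, rfl, Function.update_self _ _ _⟩
        · have : l ≠ i := fun hli => hiC k hjA (hli ▸ hl)
          exact Or.inr ⟨hl, Function.update_of_ne this _ _⟩
      · rw [hC', Function.update_of_ne hkj] at hl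
        have : l ≠ i := fun hli => hiC k (Finset.mem_of_mem_erase hk) (hli ▸ hl)
        exact Or.inr ⟨hl, Function.update_of_ne this _ _⟩
    apply ih (A.erase i) Y' C' S' hcA
    · -- the potential does not decrease
      refine hsum.trans ?_
      rw [← Finset.add_sum_erase A _ hi, ← Finset.add_sum_erase _ _ hj,
        ← Finset.add_sum_erase _ _ hj]
      have h1 : ∑ x ∈ (A.erase i).erase j, 2 ^ (C' x).card
          = ∑ x ∈ (A.erase i).erase j, 2 ^ (C x).card := by
        refine Finset.sum_congr rfl fun x hx => ?_
        rw [hC', Function.update_of_ne (Finset.ne_of_mem_erase hx)]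
      have h2 : (C' j).card = (C j).card + 1 := by
        rw [hC', Function.update_self, Finset.card_insert_of_notMem (hiC j hjA)]
      have h3 : 2 ^ (C i).card ≤ 2 ^ (C j).card :=
        Nat.pow_le_pow_right (by norm_num) (himin j hjA)
      rw [h1, h2, pow_succ]
      omega
    · exact fun k hk => (hYY k).trans (hY k (Finset.mem_of_mem_erase hk))
    · intro k hk
      have h1 := hcard k (Finset.mem_of_mem_erase hk)
      rw [pow_succ] at h1
      by_cases hkj : k = j
      · simp only [hY', hkj, if_true]
        subst hkj
        have : 4 ^ n * (4 * e) * 4 ≤ (Y k).card := by linarith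
        omega
      · simp only [hY', hkj, if_false]
        have h2 := hTk k hk
        have : 4 ^ n * (4 * e) * 4 ≤ (Y k).card := by linarith
        omega
    · intro k hk
      rw [Finset.disjoint_left]
      intro l hl hlA
      rcases hCof k hk l hl with ⟨-, rfl, -⟩ | ⟨hl', -⟩
      · exact Finset.notMem_erase _ _ hlA
      · exact Finset.disjoint_left.1 (hCA k (Finset.mem_of_mem_erase hk)) hl'
          (Finset.mem_of_mem_erase hlA)
    · intro k hk l hl
      rcases hCof k hk l hl with ⟨-, rfl, hSl⟩ | ⟨hl', hSl⟩
      · rw [hSl]; exact hTY.trans (hY _ hi)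
      · rw [hSl]; exact hS k (Finset.mem_of_mem_erase hk) l hl'
    · intro k hk l hl y hy
      rcases hCof k hk l hl with ⟨rfl, rfl, hSl⟩ | ⟨hl', hSl⟩
      · simp only [hY', if_true] at hy
        obtain ⟨_, x, hx, hxy⟩ := mem_nbrIn.1 hy
        exact ⟨x, hSl ▸ hx, hxy.symm⟩
      · rw [hSl]; exact hcov k (Finset.mem_of_mem_erase hk) l hl' y (hYY k hy)
    · intro k hk l hl k' hk' hne
      rcases hCof k hk l hl with ⟨rfl, rfl, hSl⟩ | ⟨hl', hSl⟩
      · rw [hSl]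
        simp only [hY', hne, if_false]
        exact anti_sdiff_nbrIn
      · rw [hSl]
        exact (hanti k (Finset.mem_of_mem_erase hk) l hl' k' (Finset.mem_of_mem_erase hk')
          hne).mono le_rfl (hYY k')
    · intro k hk l hl l' hl' hne
      rcases hCof k hk l hl with ⟨rfl, rfl, hSl⟩ | ⟨hl1, hSl⟩
      · rcases hCof k hk l' hl' with ⟨-, rfl, _⟩ | ⟨hl2, hSl2⟩
        · exact absurd rfl hne
        · rw [hSl, hSl2]
          exact ((hanti k hjA l' hl2 l hi hji.symm).mono le_rfl hTY).symm
      · rcases hCof k hk l' hl' with ⟨rfl, rfl, hSl2⟩ | ⟨hl2, hSl2⟩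
        · rw [hSl, hSl2]
          exact (hanti k hjA l hl1 l' hi hji.symm).mono le_rfl hTY
        · rw [hSl, hSl2]
          exact hSS k (Finset.mem_of_mem_erase hk) l hl1 l' hl2 hne

/-- With all `2 ^ d` indices active and none retired, the potential is exactly `2 ^ d`. Each
retirement costs the sets at most a factor of four. -/
lemma Coherent.exists_star (h : G.Coherent e) (he : 0 < e) (d : ℕ) (Y : Fin (2 ^ d) → Finset V)
    (hdisj : ∀ i j, i ≠ j → Disjoint (Y i) (Y j))
    (hY : ∀ i, 4 ^ (2 ^ d) * (4 * e) ≤ (Y i).card) :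
    ∃ j, ∃ u ∈ Y j, ∃ I : Finset (Fin (2 ^ d)), I.card = d ∧ j ∉ I ∧ ∃ w : Fin (2 ^ d) → V,
      (∀ i ∈ I, w i ∈ Y i ∧ G.Adj u (w i)) ∧ ∀ i ∈ I, ∀ i' ∈ I, ¬ G.Adj (w i) (w i') := by
  have hpos : 0 < 2 ^ d := Nat.two_pow_pos d
  obtain ⟨j, u, hu, I, hI, hjI, w, hw, hww⟩ := h.exists_star_aux he Y hdisj d (2 ^ d - 1)
    Finset.univ Y (fun _ => ∅) (fun _ => ∅) (by simp; omega) (by simp) (fun _ _ => le_rfl)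
    (fun j _ => (Nat.mul_le_mul_right _ (Nat.pow_le_pow_right (by norm_num) (by omega))).trans
      (hY j)) (by simp) (by simp) (by simp) (by simp) (by simp)
  obtain ⟨I', hI', hc⟩ := Finset.exists_subset_card_eq hI
  exact ⟨j, u, hu, I', hc, fun h => hjI (hI' h), w, fun i hi => hw i (hI' hi),
    fun i hi i' hi' => hww i (hI' hi) i' (hI' hi')⟩

end Star

/-! ### Private systems yield subdivision models. -/

section PrivateSystem

variable {V : Type u}

/-- Pairwise anticomplete connected sets `conn i`, each covering a large set `nbr i` that is
anticomplete to all the others. -/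
structure PrivateSystem (G : SimpleGraph V) (ι : Type*) (z : ℕ) where
  /-- the connected sets -/
  conn : ι → Finset V
  /-- their private neighbourhoods -/
  nbr : ι → Finset V
  connectedOn : ∀ i, G.ConnectedOn (conn i)
  covers : ∀ i, ∀ y ∈ nbr i, ∃ x ∈ conn i, G.Adj x y
  le_card : ∀ i, z ≤ (nbr i).card
  disjoint_conn : ∀ i j, i ≠ j → Disjoint (conn i) (conn j)
  anti_conn : ∀ i j, i ≠ j → G.Anti (conn i) (conn j)
  disjoint_conn_nbr : ∀ i j, Disjoint (conn i) (nbr j)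
  anti_conn_nbr : ∀ i j, i ≠ j → G.Anti (conn i) (nbr j)
  disjoint_nbr : ∀ i j, i ≠ j → Disjoint (nbr i) (nbr j)

/-- Reindex a private system along an injection. -/
def PrivateSystem.comap {G : SimpleGraph V} {ι κ : Type*} {z : ℕ} (P : G.PrivateSystem ι z)
    (f : κ → ι) (hf : Function.Injective f) : G.PrivateSystem κ z where
  conn := P.conn ∘ f
  nbr := P.nbr ∘ f
  connectedOn _ := P.connectedOn _
  covers _ := P.covers _
  le_card _ := P.le_card _
  disjoint_conn _ _ h := P.disjoint_conn _ _ (hf.ne h)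
  anti_conn _ _ h := P.anti_conn _ _ (hf.ne h)
  disjoint_conn_nbr _ _ := P.disjoint_conn_nbr _ _
  anti_conn_nbr _ _ h := P.anti_conn_nbr _ _ (hf.ne h)
  disjoint_nbr _ _ h := P.disjoint_nbr _ _ (hf.ne h)

variable [Fintype V] {G : SimpleGraph V} {e z m : ℕ}

/-- The index set is `m` blocks of `2 ^ m` sets. Each block supplies a star with `m` leaves, and a
greedy choice makes the stars of different blocks anticomplete; a star has `m + 1` vertices, whence
the second summand in `hz`. -/
lemma PrivateSystem.exists_stars (P : G.PrivateSystem (Fin m × Fin (2 ^ m)) z)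
    (h : G.Coherent e) (he : 0 < e)
    (hz : 4 ^ (2 ^ m) * (4 * e) + m * ((m + 1) * e) ≤ z) :
    ∃ (u : Fin m → V) (j : Fin m → Fin (2 ^ m)) (leg : Fin m → Fin m → Fin (2 ^ m))
      (w : Fin m → Fin m → V),
      (∀ a, u a ∈ P.nbr (a, j a)) ∧ (∀ a, Function.Injective (leg a)) ∧
      (∀ a b, leg a b ≠ j a) ∧ (∀ a b, w a b ∈ P.nbr (a, leg a b)) ∧
      (∀ a b, G.Adj (u a) (w a b)) ∧
      (∀ a b c, a ≠ c → ¬ G.Adj (u c) (w a b)) ∧ (∀ a c, ¬ G.Adj (u a) (u c)) ∧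
      ∀ a b c d, ¬ G.Adj (w a b) (w c d) := by
  obtain ⟨f, hf, -, hff⟩ := h.greedy (ι := Fin m)
    (α := V × Fin (2 ^ m) × (Fin m → Fin (2 ^ m)) × (Fin m → V))
    (fun a x => x.1 ∈ P.nbr (a, x.2.1) ∧ Function.Injective x.2.2.1 ∧
      (∀ b, x.2.2.1 b ≠ x.2.1) ∧ (∀ b, x.2.2.2 b ∈ P.nbr (a, x.2.2.1 b)) ∧
      (∀ b, G.Adj x.1 (x.2.2.2 b)) ∧ ∀ b c, ¬ G.Adj (x.2.2.2 b) (x.2.2.2 c))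
    (fun x => insert x.1 (Finset.univ.image x.2.2.2)) (m + 1) ∅
    (fun _ x _ => (Finset.card_insert_le _ _).trans
      (Nat.succ_le_succ (Finset.card_image_le.trans (by simp)))) (by
      intro a F hF _
      simp only [Finset.card_empty, zero_add, Fintype.card_fin] at hF
      obtain ⟨j, u, hu, I, hI, hj, w, hw, hww⟩ := h.exists_star he m
        (fun i => P.nbr (a, i) \ F)
        (fun i i' hii => (P.disjoint_nbr _ _ (by simpa using hii)).mono
          Finset.sdiff_subset Finset.sdiff_subset)
        (fun i => by
          have h1 := P.le_card (a, i)
          have h2 := Finset.le_card_sdiff F (P.nbr (a, i))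
          omega)
      refine ⟨(u, j, I.orderEmbOfFin hI, fun b => w (I.orderEmbOfFin hI b)),
        ⟨(Finset.mem_sdiff.1 hu).1, (I.orderEmbOfFin hI).injective, fun b hb => hj ?_,
          fun b => ?_, fun b => ?_, fun b c => ?_⟩, ?_⟩
      · have hb' : I.orderEmbOfFin hI b = j := hb
        exact hb' ▸ I.orderEmbOfFin_mem hI b
      · exact (Finset.mem_sdiff.1 (hw _ (I.orderEmbOfFin_mem hI b)).1).1
      · exact (hw _ (I.orderEmbOfFin_mem hI b)).2
      · exact hww _ (I.orderEmbOfFin_mem hI b) _ (I.orderEmbOfFin_mem hI c)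
      · rw [Finset.disjoint_left]
        intro y hy hyF
        rcases Finset.mem_insert.1 hy with rfl | hy
        · exact (Finset.mem_sdiff.1 hu).2 hyF
        · obtain ⟨b, -, rfl⟩ := Finset.mem_image.1 hy
          exact (Finset.mem_sdiff.1 (hw _ (I.orderEmbOfFin_mem hI b)).1).2 hyF)
  have hu : ∀ a, (f a).1 ∈ insert (f a).1 (Finset.univ.image (f a).2.2.2) :=
    fun a => Finset.mem_insert_self _ _
  have hw : ∀ a b, (f a).2.2.2 b ∈ insert (f a).1 (Finset.univ.image (f a).2.2.2) :=
    fun a b => Finset.mem_insert_of_mem (Finset.mem_image_of_mem _ (Finset.mem_univ _))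
  refine ⟨fun a => (f a).1, fun a => (f a).2.1, fun a => (f a).2.2.1, fun a => (f a).2.2.2,
    fun a => (hf a).1, fun a => (hf a).2.1, fun a => (hf a).2.2.1, fun a => (hf a).2.2.2.1,
    fun a => (hf a).2.2.2.2.1, fun a b c hac => (hff c a hac.symm).2 _ (hu c) _ (hw a b),
    fun a c => ?_, fun a b c d => ?_⟩
  · by_cases hac : a = c
    · subst hac; exact G.irrefl
    · exact (hff a c hac).2 _ (hu a) _ (hu c)
  · by_cases hac : a = c
    · subst hac; exact (hf a).2.2.2.2.2 b d
    · exact (hff a c hac).2 _ (hw a b) _ (hw c d)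

/-- What is left of two private neighbourhoods after deleting the forbidden vertices still has `e`
vertices on each side, so coherence gives an edge between them. The edges for different pairs are
chosen greedily. -/
lemma PrivateSystem.exists_edges {ι : Type*} (P : G.PrivateSystem ι z) (h : G.Coherent e)
    (F₀ : Finset V) (idx : Fin m → Fin m → ι) (hidx : ∀ a b, a ≠ b → idx a b ≠ idx b a)
    (hz : e + F₀.card + m * m * (2 * e) ≤ z) :
    ∃ x : Fin m → Fin m → V, (∀ a b, a ≠ b → x a b ∈ P.nbr (idx a b) ∧ x a b ∉ F₀) ∧
      (∀ a b, a ≠ b → G.Adj (x a b) (x b a)) ∧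
      ∀ a b c d, a ≠ b → c ≠ d → s(a, b) ≠ s(c, d) → ¬ G.Adj (x a b) (x c d) := by
  obtain ⟨f, hf, hfF, hff⟩ := h.greedy (ι := {p : Fin m × Fin m // p.1 < p.2}) (α := V × V)
    (fun p x => x.1 ∈ P.nbr (idx p.1.1 p.1.2) ∧ x.2 ∈ P.nbr (idx p.1.2 p.1.1) ∧ G.Adj x.1 x.2)
    (fun x => {x.1, x.2}) 2 F₀ (fun _ _ _ => Finset.card_le_two) (by
      intro p F hF _
      have hcard : Fintype.card {p : Fin m × Fin m // p.1 < p.2} ≤ m * m :=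
        (Fintype.card_subtype_le _).trans (by simp)
      have h0 : F.card ≤ F₀.card + m * m * (2 * e) :=
        hF.trans (Nat.add_le_add_left (Nat.mul_le_mul_right _ hcard) _)
      have h1 : ∀ i, e ≤ (P.nbr i \ F).card := fun i => by
        have h1 := P.le_card i
        have h2 := Finset.le_card_sdiff F (P.nbr i)
        omega
      by_contra hcon
      rcases h.card_lt_of_anti (P.nbr (idx p.1.1 p.1.2) \ F) (P.nbr (idx p.1.2 p.1.1) \ F)
        ((P.disjoint_nbr _ _ (hidx _ _ p.2.ne)).mono Finset.sdiff_subset Finset.sdiff_subset)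
        (fun x hx y hy hxy => hcon ⟨(x, y), ⟨(Finset.mem_sdiff.1 hx).1,
          (Finset.mem_sdiff.1 hy).1, hxy⟩, by
            simp [(Finset.mem_sdiff.1 hx).2, (Finset.mem_sdiff.1 hy).2]⟩) with h2 | h2
      · exact absurd (h1 (idx p.1.1 p.1.2)) (by omega)
      · exact absurd (h1 (idx p.1.2 p.1.1)) (by omega))
  have key : ∀ a b : Fin m, ∃ x : V, (∀ hab : a < b, x = (f ⟨(a, b), hab⟩).1) ∧
      (∀ hba : b < a, x = (f ⟨(b, a), hba⟩).2) ∨ a = b := by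
    intro a b
    rcases lt_trichotomy a b with hab | hab | hab
    · exact ⟨(f ⟨(a, b), hab⟩).1, Or.inl ⟨fun _ => rfl, fun h => absurd h hab.not_gt⟩⟩
    -- The diagonal is never used; any vertex serves as the default.
    · exact ⟨(P.connectedOn (idx a b)).1.choose, Or.inr hab⟩
    · exact ⟨(f ⟨(b, a), hab⟩).2, Or.inl ⟨fun h => absurd h hab.not_gt, fun _ => rfl⟩⟩
  choose x hx using key
  have hx' : ∀ a b, a ≠ b → ∃ p : {p : Fin m × Fin m // p.1 < p.2}, s(p.1.1, p.1.2) = s(a, b) ∧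
      x a b ∈ ({(f p).1, (f p).2} : Finset V) := by
    intro a b hab
    have h1 := (hx a b).resolve_right hab
    rcases lt_or_gt_of_ne hab with hlt | hlt
    · exact ⟨⟨(a, b), hlt⟩, rfl, by simp [h1.1 hlt]⟩
    · exact ⟨⟨(b, a), hlt⟩, Sym2.eq_swap, by simp [h1.2 hlt]⟩
  refine ⟨x, fun a b hab => ⟨?_, ?_⟩, fun a b hab => ?_, fun a b c d hab hcd hne => ?_⟩
  · have h1 := (hx a b).resolve_right hab
    rcases lt_or_gt_of_ne hab with hlt | hlt
    · rw [h1.1 hlt]; exact (hf ⟨(a, b), hlt⟩).1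
    · rw [h1.2 hlt]; exact (hf ⟨(b, a), hlt⟩).2.1
  · obtain ⟨p, -, hp⟩ := hx' a b hab
    exact Finset.disjoint_left.1 (hfF p) hp
  · have h1 := (hx a b).resolve_right hab
    have h2 := (hx b a).resolve_right hab.symm
    rcases lt_or_gt_of_ne hab with hlt | hlt
    · rw [h1.1 hlt, h2.2 hlt]; exact (hf ⟨(a, b), hlt⟩).2.2
    · rw [h1.2 hlt, h2.1 hlt]; exact (hf ⟨(b, a), hlt⟩).2.2.symm
  · obtain ⟨p, hp, hxp⟩ := hx' a b hab
    obtain ⟨q, hq, hxq⟩ := hx' c d hcd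
    have hpq : p ≠ q := fun hpq => hne (hp ▸ hq ▸ hpq ▸ rfl)
    exact (hff p q hpq).2 _ hxp _ hxq

/-- A large private system yields a subdivision model. -/
theorem PrivateSystem.exists_model (P : G.PrivateSystem (Fin m × Fin (2 ^ m)) z)
    (h : G.Coherent e) (he : 0 < e)
    (hz : (4 ^ (2 ^ m) * 4 + m * (m + 1) + 2 * m * m) * e ≤ z) :
    Nonempty (G.SubdivisionModel m) := by
  obtain ⟨u, j, leg, w, hu, hleg, hlegj, hw, huw, huw', huu, hww⟩ := P.exists_stars h he
    (by refine le_trans ?_ hz; nlinarith [Nat.zero_le (2 * m * m * e)])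
  set N : Finset V := Finset.univ.image u ∪ Finset.univ.image fun p : Fin m × Fin m => w p.1 p.2
    with hN
  have huN : ∀ a, u a ∈ N := fun a =>
    Finset.mem_union_left _ (Finset.mem_image_of_mem _ (Finset.mem_univ _))
  have hwN : ∀ a b, w a b ∈ N := fun a b =>
    Finset.mem_union_right _ (Finset.mem_image.2 ⟨(a, b), Finset.mem_univ _, rfl⟩)
  have hNc : N.card ≤ m * (m + 1) := by
    refine (Finset.card_union_le _ _).trans ?_
    have h1 : (Finset.univ.image u).card ≤ m := Finset.card_image_le.trans (by simp)
    have h2 : (Finset.univ.image fun p : Fin m × Fin m => w p.1 p.2).card ≤ m * m :=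
      Finset.card_image_le.trans (by simp)
    nlinarith
  have hidx : ∀ a b c d, (a, b) ≠ (c, d) → (a, leg a b) ≠ (c, leg c d) := by
    intro a b c d hne heq
    rw [Prod.mk.injEq] at heq
    obtain ⟨rfl, h2⟩ := heq
    exact hne (by rw [hleg a h2])
  -- Forbidding the closed neighbourhood of all stars makes the connecting edges anticomplete to
  -- them.
  obtain ⟨x, hx, hxx, hxx'⟩ := P.exists_edges h (G.closedNbrIn N Finset.univ)
    (fun a b => (a, leg a b)) (fun a b hab => hidx _ _ _ _ (by simp [hab])) (by
      have h1 := (h.card_closedNbrIn_le N Finset.univ).trans (Nat.mul_le_mul_right e hNc)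
      have h2 : 1 ≤ 4 ^ (2 ^ m) := Nat.one_le_pow _ _ (by norm_num)
      have h3 : e ≤ 4 ^ (2 ^ m) * 4 * e := by nlinarith
      refine le_trans ?_ hz
      nlinarith)
  have hxN : ∀ a b, a ≠ b → ∀ y ∈ N, ¬ G.Adj y (x a b) := fun a b hab y hy hadj =>
    (hx a b hab).2 (mem_closedNbrIn.2 ⟨Finset.mem_univ _, Or.inr ⟨y, hy, hadj⟩⟩)
  -- the two halves of a link
  set D : Fin m → Fin m → Finset V :=
    fun a b => insert (w a b) (insert (x a b) (P.conn (a, leg a b))) with hD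
  have hDmem : ∀ a b y, y ∈ D a b → y = w a b ∨ y = x a b ∨ y ∈ P.conn (a, leg a b) := by
    intro a b y hy
    simpa [hD] using hy
  have hwD : ∀ a b, w a b ∈ D a b := fun a b => Finset.mem_insert_self _ _
  have hxD : ∀ a b, x a b ∈ D a b := fun a b =>
    Finset.mem_insert_of_mem (Finset.mem_insert_self _ _)
  have hDloc : ∀ a b, a ≠ b → D a b ⊆ P.conn (a, leg a b) ∪ P.nbr (a, leg a b) := by
    intro a b hab y hy
    rw [Finset.mem_union]
    rcases hDmem a b y hy with rfl | rfl | hy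
    · exact Or.inr (hw a b)
    · exact Or.inr (hx a b hab).1
    · exact Or.inl hy
  have hDconn : ∀ a b, a ≠ b → G.ConnectedOn (D a b) := by
    intro a b hab
    obtain ⟨y, hy, hxy⟩ := P.covers _ _ (hx a b hab).1
    obtain ⟨y', hy', hwy⟩ := P.covers _ _ (hw a b)
    exact ((P.connectedOn _).insert_of_adj hy hxy).insert_of_adj
      (Finset.mem_insert_of_mem hy') hwy
  have hDdisj : ∀ a b c d, a ≠ b → c ≠ d → (a, b) ≠ (c, d) → Disjoint (D a b) (D c d) := by
    intro a b c d hab hcd hne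
    have hi := hidx _ _ _ _ hne
    refine Finset.disjoint_of_subset_left (hDloc a b hab)
      (Finset.disjoint_of_subset_right (hDloc c d hcd) ?_)
    rw [Finset.disjoint_union_left, Finset.disjoint_union_right, Finset.disjoint_union_right]
    exact ⟨⟨P.disjoint_conn _ _ hi, P.disjoint_conn_nbr _ _⟩,
      (P.disjoint_conn_nbr _ _).symm, P.disjoint_nbr _ _ hi⟩
  have hDanti : ∀ a b c d, a ≠ b → c ≠ d → s(a, b) ≠ s(c, d) → G.Anti (D a b) (D c d) := by
    intro a b c d hab hcd hne y hy y' hy'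
    have hi := hidx a b c d (fun h => hne (by rw [Prod.mk.injEq] at h; rw [h.1, h.2]))
    rcases hDmem _ _ _ hy with rfl | rfl | hyc
    · rcases hDmem _ _ _ hy' with rfl | rfl | hyc'
      · exact hww _ _ _ _
      · exact hxN _ _ hcd _ (hwN _ _)
      · exact fun hadj => P.anti_conn_nbr _ _ hi.symm _ hyc' _ (hw a b) hadj.symm
    · rcases hDmem _ _ _ hy' with rfl | rfl | hyc'
      · exact fun hadj => hxN _ _ hab _ (hwN _ _) hadj.symm
      · exact hxx' _ _ _ _ hab hcd hne
      · exact fun hadj => P.anti_conn_nbr _ _ hi.symm _ hyc' _ (hx a b hab).1 hadj.symm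
    · rcases hDmem _ _ _ hy' with rfl | rfl | hyc'
      · exact P.anti_conn_nbr _ _ hi _ hyc _ (hw c d)
      · exact P.anti_conn_nbr _ _ hi _ hyc _ (hx c d hcd).1
      · exact P.anti_conn _ _ hi _ hyc _ hyc'
  -- The centre `u c` lies in a private neighbourhood whose index is that of no leaf, so it sees
  -- none of the connected sets used in links.
  have hjidx : ∀ a b c, (c, j c) ≠ (a, leg a b) := by
    intro a b c heq
    rw [Prod.mk.injEq] at heq
    obtain ⟨rfl, h2⟩ := heq
    exact hlegj _ _ h2.symm
  have huD : ∀ a b c, a ≠ b → u c ∉ D a b := by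
    intro a b c hab hmem
    rcases Finset.mem_union.1 (hDloc a b hab hmem) with h1 | h1
    · exact Finset.disjoint_left.1 (P.disjoint_conn_nbr _ _) h1 (hu c)
    · exact Finset.disjoint_left.1 (P.disjoint_nbr _ _ (hjidx a b c)) (hu c) h1
  have huDanti : ∀ a b c, a ≠ b → c ≠ a → ∀ y ∈ D a b, ¬ G.Adj (u c) y := by
    intro a b c hab hca y hy
    rcases hDmem _ _ _ hy with rfl | rfl | hyc
    · exact huw' _ _ _ hca.symm
    · exact hxN _ _ hab _ (huN _)
    · exact fun hadj => P.anti_conn_nbr _ _ (hjidx a b c).symm _ hyc _ (hu c) hadj.symm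
  refine ⟨{
    vert := u
    vert_injective := ?_
    not_adj := huu
    link := fun a b => D a b ∪ D b a
    connectedOn := fun a b hab => (hDconn a b hab.ne).union (hDconn b a hab.ne')
      ⟨x a b, hxD a b, x b a, hxD b a, Or.inr (hxx a b hab.ne)⟩
    adj_left := fun a b _ => ⟨w a b, Finset.mem_union_left _ (hwD a b), huw a b⟩
    adj_right := fun a b _ => ⟨w b a, Finset.mem_union_right _ (hwD b a), huw b a⟩
    vert_notMem := ?_
    vert_anti := ?_
    disjoint := ?_
    anti := ?_ }⟩
  · intro a c hac
    by_contra hne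
    exact Finset.disjoint_left.1 (P.disjoint_nbr (a, j a) (c, j c) (by simp [hne])) (hu a)
      (hac ▸ hu c)
  · intro a b c hab hmem
    rcases Finset.mem_union.1 hmem with h1 | h1
    · exact huD a b c hab.ne h1
    · exact huD b a c hab.ne' h1
  · intro a b c hab hca hcb y hy
    rcases Finset.mem_union.1 hy with h1 | h1
    · exact huDanti a b c hab.ne hca y h1
    · exact huDanti b a c hab.ne' hcb y h1
  · intro a b c d hab hcd hne
    have h1 : (a, b) ≠ (d, c) := fun h => by
      rw [Prod.mk.injEq] at h
      obtain ⟨rfl, rfl⟩ := h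
      exact absurd hab hcd.not_gt
    have h2 : (b, a) ≠ (c, d) := fun h => h1 (by rw [Prod.mk.injEq] at h ⊢; exact h.symm)
    have h3 : (b, a) ≠ (d, c) := fun h => hne (by rw [Prod.mk.injEq] at h ⊢; exact h.symm)
    rw [Finset.disjoint_union_left, Finset.disjoint_union_right, Finset.disjoint_union_right]
    exact ⟨⟨hDdisj _ _ _ _ hab.ne hcd.ne hne, hDdisj _ _ _ _ hab.ne hcd.ne' h1⟩,
      hDdisj _ _ _ _ hab.ne' hcd.ne h2, hDdisj _ _ _ _ hab.ne' hcd.ne' h3⟩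
  · intro a b c d hab hcd hne
    have hs : s(a, b) ≠ s(c, d) := by
      intro h
      rw [Sym2.eq_iff] at h
      rcases h with ⟨rfl, rfl⟩ | ⟨rfl, rfl⟩
      · exact hne rfl
      · exact absurd hab hcd.not_gt
    have hs1 : s(a, b) ≠ s(d, c) := by rwa [Sym2.eq_swap (a := d)]
    have hs2 : s(b, a) ≠ s(c, d) := by rwa [Sym2.eq_swap (a := b)]
    have hs3 : s(b, a) ≠ s(d, c) := by rwa [Sym2.eq_swap (a := d), Sym2.eq_swap (a := b)]
    intro y hy y' hy'
    rcases Finset.mem_union.1 hy with h1 | h1 <;> rcases Finset.mem_union.1 hy' with h2 | h2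
    · exact hDanti _ _ _ _ hab.ne hcd.ne hs _ h1 _ h2
    · exact hDanti _ _ _ _ hab.ne hcd.ne' hs1 _ h1 _ h2
    · exact hDanti _ _ _ _ hab.ne' hcd.ne hs2 _ h1 _ h2
    · exact hDanti _ _ _ _ hab.ne' hcd.ne' hs3 _ h1 _ h2

end PrivateSystem

/-! ### Hubs, the obstruction to a private system. -/

section Hub

variable {V : Type u}

/-- Every connected subset of `W` with at least `g` closed neighbours in `W` covers half
of one of the sets `Z i`. -/
def IsHub (G : SimpleGraph V) {ι : Type*} (W : Finset V) (g : ℕ) (Z : ι → Finset V) : Prop :=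
  ∀ X ⊆ W, G.ConnectedOn X → g ≤ (G.closedNbrIn X W).card →
    ∃ i, (Z i).card ≤ 2 * (G.nbrIn X (Z i)).card

variable {G : SimpleGraph V} {e : ℕ}

/-- Add a connected set to a private system that sees little of it. -/
lemma PrivateSystem.exists_option {ι : Type} (P : G.PrivateSystem ι 0) {W' Q : Finset V}
    (hconn : ∀ i, Disjoint (P.conn i) W' ∧ G.Anti (P.conn i) W')
    (hnbr : ∀ i, Disjoint (P.nbr i) W') (hQ : G.ConnectedOn Q) (hQW : Q ⊆ W') :
    ∃ P' : G.PrivateSystem (Option ι) 0,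
      (∀ i, Disjoint (P'.conn i) (W' \ G.closedNbrIn Q W') ∧
        G.Anti (P'.conn i) (W' \ G.closedNbrIn Q W')) ∧
      (∀ i, Disjoint (P'.nbr i) (W' \ G.closedNbrIn Q W')) ∧
      (P'.nbr none = G.closedNbrIn Q W' \ Q) ∧
      ∀ i, P'.nbr (some i) = P.nbr i \ G.nbrIn Q (P.nbr i) := by
  have hZ : G.closedNbrIn Q W' \ Q ⊆ W' := Finset.sdiff_subset.trans closedNbrIn_subset
  refine ⟨{
    conn := fun o => o.elim Q P.conn
    nbr := fun o => o.elim (G.closedNbrIn Q W' \ Q) fun i => P.nbr i \ G.nbrIn Q (P.nbr i)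
    connectedOn := ?_
    covers := ?_
    le_card := fun _ => Nat.zero_le _
    disjoint_conn := ?_
    anti_conn := ?_
    disjoint_conn_nbr := ?_
    anti_conn_nbr := ?_
    disjoint_nbr := ?_ }, ?_, ?_, rfl, fun _ => rfl⟩
  · rintro (_ | i)
    · exact hQ
    · exact P.connectedOn i
  · rintro (_ | i) y hy
    · obtain ⟨h1, h2⟩ := Finset.mem_sdiff.1 hy
      exact (mem_closedNbrIn.1 h1).2.resolve_left h2
    · exact P.covers i y (Finset.mem_sdiff.1 hy).1
  · rintro (_ | i) (_ | j) hij
    · exact absurd rfl hij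
    · exact ((hconn j).1.mono_right hQW).symm
    · exact (hconn i).1.mono_right hQW
    · exact P.disjoint_conn i j (by simpa using hij)
  · rintro (_ | i) (_ | j) hij
    · exact absurd rfl hij
    · exact ((hconn j).2.mono subset_rfl hQW).symm
    · exact (hconn i).2.mono subset_rfl hQW
    · exact P.anti_conn i j (by simpa using hij)
  · rintro (_ | i) (_ | j)
    · exact Finset.disjoint_sdiff
    · exact ((hnbr j).mono Finset.sdiff_subset hQW).symm
    · exact (hconn i).1.mono_right hZ
    · exact (P.disjoint_conn_nbr i j).mono_right Finset.sdiff_subset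
  · rintro (_ | i) (_ | j) hij
    · exact absurd rfl hij
    · exact anti_sdiff_nbrIn
    · exact (hconn i).2.mono subset_rfl hZ
    · exact (P.anti_conn_nbr i j (by simpa using hij)).mono subset_rfl Finset.sdiff_subset
  · rintro (_ | i) (_ | j) hij
    · exact absurd rfl hij
    · exact ((hnbr j).mono Finset.sdiff_subset hZ).symm
    · exact (hnbr i).mono Finset.sdiff_subset hZ
    · exact (P.disjoint_nbr i j (by simpa using hij)).mono Finset.sdiff_subset
        Finset.sdiff_subset
  · rintro (_ | i)
    · exact ⟨disjoint_sdiff_closedNbrIn, anti_sdiff_closedNbrIn⟩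
    · exact ⟨(hconn i).1.mono_right Finset.sdiff_subset,
        (hconn i).2.mono subset_rfl Finset.sdiff_subset⟩
  · rintro (_ | i)
    · exact Finset.disjoint_sdiff.mono_left Finset.sdiff_subset
    · exact (hnbr i).mono Finset.sdiff_subset Finset.sdiff_subset

variable [Fintype V]

/-- A connected set can be shrunk, around a given vertex, to have a closed neighbourhood of
prescribed size up to `e`. -/
lemma Coherent.exists_connectedOn_card (h : G.Coherent e) {X W : Finset V} {g : ℕ}
    (hX : G.ConnectedOn X) {x : V} (hx : x ∈ X) (hg : g ≤ (G.closedNbrIn X W).card) :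
    ∃ Q ⊆ X, x ∈ Q ∧ G.ConnectedOn Q ∧ g ≤ (G.closedNbrIn Q W).card ∧
      (G.closedNbrIn Q W).card ≤ g + e := by
  obtain ⟨Q, hQX, hxQ, hQ, hgQ, hQ'⟩ := hX.grow hx (fun Q => g ≤ (G.closedNbrIn Q W).card) hg
  refine ⟨Q, hQX, hxQ, hQ, hgQ, ?_⟩
  rcases hQ' with rfl | ⟨Q', y, -, -, hlt, rfl⟩
  · have := h.card_closedNbrIn_le {x} W
    simp only [Finset.card_singleton, one_mul] at this
    omega
  · have := h.card_closedNbrIn_insert_le y Q' W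
    omega

/-- Connected sets are extracted one at a time. If the current private neighbourhoods are not a hub
of `W'`, some connected `X` in `W'` has many neighbours there but covers less than half of each of
them. A part `Q` of `X` with at most `g + e` closed neighbours joins the system, and the earlier
neighbourhoods lose at most half; hence the factor `2 ^ k`. -/
lemma Coherent.exists_privateSystem_or_hub_aux (h : G.Coherent e) {K g : ℕ} {W : Finset V}
    (hW : (K + 1) * (g + e) + e ≤ W.card) :
    ∀ k ≤ K, (∃ (ι : Type) (_ : Fintype ι) (P : G.PrivateSystem ι 0) (W' : Finset V),
        Fintype.card ι = k ∧ W' ⊆ W ∧ W.card ≤ W'.card + k * (g + e) ∧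
        (∀ i, Disjoint (P.conn i) W' ∧ G.Anti (P.conn i) W') ∧ (∀ i, Disjoint (P.nbr i) W') ∧
        (∀ i, P.nbr i ⊆ W) ∧ ∀ i, g ≤ 2 ^ k * (P.nbr i).card + e) ∨
      ∃ (ι : Type) (_ : Fintype ι) (Z : ι → Finset V), Fintype.card ι < K ∧ ∃ W' ⊆ W,
        W.card ≤ W'.card + K * (g + e) ∧ (∀ i, Disjoint (Z i) W') ∧ (∀ i, Z i ⊆ W) ∧
        (∀ i, g ≤ 2 ^ K * (Z i).card + e) ∧ G.IsHub W' g Z := by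
  intro k
  induction k with
  | zero =>
    refine fun _ => Or.inl ⟨Empty, inferInstance,
      ⟨fun _ => ∅, fun _ => ∅, nofun, nofun, nofun, nofun, nofun, nofun, nofun, nofun⟩,
      W, rfl, subset_rfl, by simp, nofun, nofun, nofun, nofun⟩
  | succ k ih =>
    intro hk
    rcases ih (by omega) with ⟨ι, _, P, W', hι, hW'W, hW', hconn, hnbr, hnbrW, hcard⟩ | hr
    swap
    · exact Or.inr hr
    have hkK : k * (g + e) + (g + e) ≤ K * (g + e) := by
      rw [← Nat.succ_mul]; exact Nat.mul_le_mul_right _ hk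
    by_cases hhub : G.IsHub W' g P.nbr
    · refine Or.inr ⟨ι, inferInstance, P.nbr, by omega, W', hW'W, by omega, hnbr, hnbrW,
        fun i => (hcard i).trans ?_, hhub⟩
      exact Nat.add_le_add_right (Nat.mul_le_mul_right _
        (Nat.pow_le_pow_right (by norm_num) (by omega))) _
    · left
      unfold IsHub at hhub
      push Not at hhub
      obtain ⟨X, hXW', hX, hgX, hXZ⟩ := hhub
      obtain ⟨x, hx⟩ := hX.1
      obtain ⟨Q, hQX, -, hQ, hgQ, hQg⟩ := h.exists_connectedOn_card hX hx hgX
      have hQW := hQX.trans hXW'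
      -- Otherwise the closed neighbourhood of `Q`, of size at most `g + e`, would miss fewer than
      -- `e` of the at least `2 * (g + e) + e` vertices of `W'`.
      have hQe : Q.card < e := by
        by_contra hcon
        have h1 := h.card_sdiff_closedNbrIn_lt (not_lt.1 hcon) W'
        have h2 := Finset.card_sdiff_add_card_eq_card
          (closedNbrIn_subset : G.closedNbrIn Q W' ⊆ W')
        rw [Nat.succ_mul] at hW
        omega
      obtain ⟨P', hP1, hP2, hP3, hP4⟩ := P.exists_option hconn hnbr hQ hQW
      refine ⟨Option ι, inferInstance, P', W' \ G.closedNbrIn Q W', by simp [hι],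
        Finset.sdiff_subset.trans hW'W, ?_, hP1, hP2, ?_, ?_⟩
      · have h2 := Finset.card_sdiff_add_card_eq_card
          (closedNbrIn_subset : G.closedNbrIn Q W' ⊆ W')
        rw [Nat.succ_mul]
        omega
      · rintro (_ | i)
        · rw [hP3]
          exact (Finset.sdiff_subset.trans closedNbrIn_subset).trans hW'W
        · rw [hP4]
          exact Finset.sdiff_subset.trans (hnbrW i)
      · rintro (_ | i)
        · rw [hP3]
          have h1 := Finset.le_card_sdiff Q (G.closedNbrIn Q W')
          have h2 := Nat.le_mul_of_pos_left (G.closedNbrIn Q W' \ Q).card (Nat.two_pow_pos (k + 1))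
          omega
        · rw [hP4]
          have h1 := Finset.card_sdiff_add_card_eq_card
            (nbrIn_subset : G.nbrIn Q (P.nbr i) ⊆ P.nbr i)
          have h2 := Finset.card_le_card
            (nbrIn_mono hQX subset_rfl : G.nbrIn Q (P.nbr i) ⊆ G.nbrIn X (P.nbr i))
          have h3 := hXZ i
          have h4 := hcard i
          have h5 : (P.nbr i).card ≤ 2 * (P.nbr i \ G.nbrIn Q (P.nbr i)).card := by omega
          have h6 := Nat.mul_le_mul_left (2 ^ k) h5
          rw [pow_succ]
          nlinarith

/-- In a large set, there is a private system, or some large sets one of which is half covered by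
every connected set with many neighbours in what remains. -/
lemma Coherent.exists_privateSystem_or_hub (h : G.Coherent e) (he : 0 < e) {K z : ℕ}
    {W : Finset V} (hW : (K + 1) * (2 ^ K * z + 2 * e) + 2 * e ≤ W.card) :
    Nonempty (G.PrivateSystem (Fin K) z) ∨
      ∃ (Z : Fin K → Finset V), ∃ W' ⊆ W, W.card ≤ W'.card + K * (2 ^ K * z + 2 * e) ∧
        (∀ i, Disjoint (Z i) W') ∧ (∀ i, Z i ⊆ W) ∧ (∀ i, z ≤ (Z i).card) ∧
        G.IsHub W' (2 ^ K * z + e) Z := by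
  have hg : 2 ^ K * z + e + e = 2 ^ K * z + 2 * e := by ring
  have hz : ∀ n, 2 ^ K * z + e ≤ 2 ^ K * n + e → z ≤ n := fun n hn =>
    Nat.le_of_mul_le_mul_left (Nat.le_of_add_le_add_right hn) (Nat.two_pow_pos K)
  rcases h.exists_privateSystem_or_hub_aux (K := K) (g := 2 ^ K * z + e) (W := W)
    (by rw [hg]; omega) K le_rfl with
    ⟨ι, _, P, W', hι, hW'W, hW', hconn, hnbr, hnbrW, hcard⟩ |
    ⟨ι, _, Z, hι, W', hW'W, hW', hZ, hZW, hcard, hhub⟩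
  · left
    have P' : G.PrivateSystem ι z := { P with le_card := fun i => hz _ (hcard i) }
    exact ⟨P'.comap _ (Fintype.equivFinOfCardEq hι).symm.injective⟩
  · right
    rw [hg] at hW'
    -- The core contains a connected set that sees nearly all of it, so a hub cannot be empty. Its
    -- fewer than `K` sets can then be listed with repetition along `Fin K`.
    have hne : Nonempty ι := by
      by_contra hne
      obtain ⟨X, hXW, hX, hXe⟩ := h.exists_connectedOn he (W := W') (by
        rw [Nat.succ_mul] at hW; omega)
      obtain ⟨i, -⟩ := hhub X hXW hX (by
        have h1 := h.card_sdiff_closedNbrIn_lt hXe W'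
        have h2 := Finset.card_sdiff_add_card_eq_card
          (closedNbrIn_subset : G.closedNbrIn X W' ⊆ W')
        rw [Nat.succ_mul] at hW
        omega)
      exact hne ⟨i⟩
    obtain ⟨f, hf⟩ : ∃ f : Fin K → ι, Function.Surjective f := by
      obtain ⟨f⟩ := Function.Embedding.nonempty_of_card_le (α := ι) (β := Fin K)
        (by simpa using hι.le)
      exact ⟨Function.invFun f, Function.invFun_surjective f.injective⟩
    refine ⟨Z ∘ f, W', hW'W, hW', fun i => hZ _, fun i => hZW _, fun i => hz _ (hcard _), ?_⟩
    intro X hXW hX hgX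
    obtain ⟨i, hi⟩ := hhub X hXW hX hgX
    obtain ⟨j, rfl⟩ := hf i
    exact ⟨j, hi⟩

/-- A decreasing sequence of sets `core t` with hubs `hub t`. -/
structure HubSequence {V : Type u} (G : SimpleGraph V) (e K n : ℕ) (z : ℕ → ℕ) (r : ℕ) where
  /-- the decreasing sequence -/
  core : ℕ → Finset V
  /-- the sets half covered by connected sets in the core -/
  hub : ℕ → Fin K → Finset V
  core_subset : ∀ t < n, ∀ s < t, core t ⊆ core s
  hub_subset : ∀ t < n, ∀ s < t, ∀ i, hub t i ⊆ core s
  disjoint : ∀ t < n, ∀ i, Disjoint (hub t i) (core t)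
  le_card_hub : ∀ t < n, ∀ i, z t ≤ (hub t i).card
  isHub : ∀ t < n, G.IsHub (core t) (2 ^ K * z t + e) (hub t)
  le_card_core : ∀ t < n, r ≤ (core t).card

/-- The dichotomy is applied `n` times, each time inside the previous core, at a cost of at most `K
* D` vertices per round. -/
lemma Coherent.exists_hubSequence (h : G.Coherent e) (he : 0 < e) {K n D r : ℕ} {z : ℕ → ℕ}
    (hD : ∀ t < n, 2 ^ K * z t + 2 * e ≤ D)
    (hpriv : ∀ t < n, ¬ Nonempty (G.PrivateSystem (Fin K) (z t)))
    (hV : n * (K * D) + D + 2 * e + r ≤ Fintype.card V) :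
    Nonempty (G.HubSequence e K n z r) := by
  obtain ⟨f, hf1, hf2⟩ := exists_seq_of_forall (α := Finset V × (Fin K → Finset V)) n
    (fun t x => (∀ i, Disjoint (x.2 i) x.1) ∧ (∀ i, z t ≤ (x.2 i).card) ∧
      G.IsHub x.1 (2 ^ K * z t + e) x.2 ∧ Fintype.card V ≤ x.1.card + (t + 1) * (K * D))
    (fun _ _ x y => y.1 ⊆ x.1 ∧ ∀ i, y.2 i ⊆ x.1) (by
      intro k hk f hf1 hf2
      obtain ⟨W, hW, hWs⟩ : ∃ W : Finset V, Fintype.card V ≤ W.card + k * (K * D) ∧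
          ∀ s < k, W ⊆ (f s).1 := by
        cases k with
        | zero => exact ⟨Finset.univ, by simp, by simp⟩
        | succ k =>
          refine ⟨(f k).1, (hf1 k (by omega)).2.2.2, fun s hs => ?_⟩
          rcases Nat.lt_succ_iff_lt_or_eq.1 hs with hs | rfl
          · exact (hf2 k (by omega) s hs).1
          · exact subset_rfl
      have hkn : k * (K * D) + K * D ≤ n * (K * D) := by
        rw [← Nat.succ_mul]; exact Nat.mul_le_mul_right _ hk
      have hKD := Nat.mul_le_mul_left K (hD k hk)
      have hD' := hD k hk
      rcases h.exists_privateSystem_or_hub he (K := K) (z := z k) (W := W) (by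
        rw [Nat.succ_mul]; omega) with hP | ⟨Z, W', hW'W, hW', hZ, hZW, hcard, hhub⟩
      · exact absurd hP (hpriv k hk)
      · refine ⟨(W', Z), ⟨hZ, hcard, hhub, ?_⟩, fun s hs =>
          ⟨hW'W.trans (hWs s hs), fun i => (hZW i).trans (hWs s hs)⟩⟩
        rw [Nat.succ_mul]
        dsimp only
        omega)
  refine ⟨⟨fun t => (f t).1, fun t => (f t).2, fun t ht s hs => (hf2 t ht s hs).1,
    fun t ht s hs => (hf2 t ht s hs).2, fun t ht => (hf1 t ht).1, fun t ht => (hf1 t ht).2.1,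
    fun t ht => (hf1 t ht).2.2.1, fun t ht => ?_⟩⟩
  have h1 := (hf1 t ht).2.2.2
  have h2 : (t + 1) * (K * D) ≤ n * (K * D) := Nat.mul_le_mul_right _ ht
  omega

end Hub

/-! ### A weighted pigeonhole principle. -/

section Pigeonhole

lemma exists_card_le_mul_filter {α ι : Type*} (s : Finset α) (t : Finset ι) (ht : t.Nonempty)
    (P : ι → α → Prop) [∀ i, DecidablePred (P i)] (h : ∀ x ∈ s, ∃ i ∈ t, P i x) :
    ∃ i ∈ t, s.card ≤ t.card * (s.filter (P i)).card := by
  obtain ⟨i, hi, hmax⟩ := Finset.exists_max_image t (fun i => (s.filter (P i)).card) ht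
  refine ⟨i, hi, ?_⟩
  calc s.card ≤ (t.biUnion fun i => s.filter (P i)).card := by
        refine Finset.card_le_card fun x hx => ?_
        obtain ⟨i, hi, hP⟩ := h x hx
        exact Finset.mem_biUnion.2 ⟨i, hi, Finset.mem_filter.2 ⟨hx, hP⟩⟩
    _ ≤ _ := Finset.card_biUnion_le_card_mul _ _ _ hmax

end Pigeonhole

/-! ### Double counting of vertices touched by a family of sets. -/

section Reach

variable {V : Type u} {G : SimpleGraph V}

/-- The elements `c` of `C` for which `v` has a neighbour in `Q c`. -/
noncomputable def reach (G : SimpleGraph V) (C : Finset V) (Q : V → Finset V) (v : V) : Finset V :=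
  C.filter fun c => ∃ a ∈ Q c, G.Adj a v

lemma mem_reach {C : Finset V} {Q : V → Finset V} {v c : V} :
    c ∈ G.reach C Q v ↔ c ∈ C ∧ ∃ a ∈ Q c, G.Adj a v := by simp [reach]

lemma reach_subset {C : Finset V} {Q : V → Finset V} {v : V} : G.reach C Q v ⊆ C :=
  Finset.filter_subset _ _

lemma sum_card_reach (C Z : Finset V) (Q : V → Finset V) :
    ∑ v ∈ Z, (G.reach C Q v).card = ∑ c ∈ C, (G.nbrIn (Q c) Z).card :=
  (Finset.sum_card_bipartiteAbove_eq_sum_card_bipartiteBelow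
    (fun c v => ∃ a ∈ Q c, G.Adj a v)).symm

/-- Every `Q c` touches half of `Z`, so an average vertex of `Z` is touched by half of the sets. The
vertices of `B`, at most an eighth of `Z`, cannot account for this if all the others are touched by
less than a quarter. -/
lemma exists_card_le_reach {C Z B : Finset V} {Q : V → Finset V} (hZ : Z.Nonempty)
    (hQ : ∀ c ∈ C, Z.card ≤ 2 * (G.nbrIn (Q c) Z).card) (hB : 8 * B.card ≤ Z.card) :
    ∃ v ∈ Z \ B, C.card ≤ 4 * (G.reach C Q v).card := by
  have hZpos := hZ.card_pos
  by_contra! hcon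
  have h1 : C.card * Z.card ≤ 2 * ∑ v ∈ Z, (G.reach C Q v).card := by
    rw [sum_card_reach, Finset.mul_sum, ← smul_eq_mul, ← Finset.sum_const]
    exact Finset.sum_le_sum hQ
  have h2 : ∑ v ∈ Z, 4 * (G.reach C Q v).card ≤
      ∑ v ∈ Z ∩ B, 4 * C.card + ∑ v ∈ Z \ B, C.card := by
    rw [← Finset.sum_inter_add_sum_sdiff Z B]
    refine Nat.add_le_add (Finset.sum_le_sum fun v _ => ?_)
      (Finset.sum_le_sum fun v hv => (hcon v hv).le)
    exact Nat.mul_le_mul_left _ (Finset.card_le_card reach_subset)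
  rw [Finset.sum_const, Finset.sum_const, smul_eq_mul, smul_eq_mul, ← Finset.mul_sum] at h2
  have h3 : (Z ∩ B).card ≤ B.card := Finset.card_le_card Finset.inter_subset_right
  have h4 : (Z \ B).card ≤ Z.card := Finset.card_le_card Finset.sdiff_subset
  obtain ⟨v, hv⟩ : (Z \ B).Nonempty := by
    rw [← Finset.card_pos]
    have := Finset.le_card_sdiff B Z
    omega
  have hC : 0 < C.card := (Nat.zero_le _).trans_lt (hcon v hv)
  have h5 : (Z ∩ B).card * (4 * C.card) ≤ B.card * (4 * C.card) := Nat.mul_le_mul_right _ h3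
  have h6 : (Z \ B).card * C.card ≤ Z.card * C.card := Nat.mul_le_mul_right _ h4
  have h7 : 8 * B.card * C.card ≤ Z.card * C.card := Nat.mul_le_mul_right _ hB
  have h8 : 0 < Z.card * C.card := Nat.mul_pos hZpos hC
  nlinarith

/-- Markov's inequality: there are at most `C.card * d` incidences in all. -/
lemma card_filter_lt_mul_reach_le {C Z : Finset V} {Q : V → Finset V} {d q : ℕ}
    (hQ : ∀ c ∈ C, (G.nbrIn (Q c) Z).card ≤ d) :
    (Z.filter fun v => C.card < q * (G.reach C Q v).card).card ≤ q * d := by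
  set B := Z.filter fun v => C.card < q * (G.reach C Q v).card with hB
  rcases C.eq_empty_or_nonempty with rfl | hC
  · have : B = ∅ := by
      rw [hB, Finset.filter_eq_empty_iff]
      intro v _
      simp [reach]
    simp [this]
  · have h1 : B.card * C.card ≤ ∑ v ∈ B, q * (G.reach C Q v).card := by
      rw [← smul_eq_mul, ← Finset.sum_const]
      exact Finset.sum_le_sum fun v hv => (Finset.mem_filter.1 hv).2.le
    have h2 : ∑ v ∈ B, (G.reach C Q v).card ≤ C.card * d := by
      rw [sum_card_reach, ← smul_eq_mul, ← Finset.sum_const]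
      refine Finset.sum_le_sum fun c hc => (Finset.card_le_card ?_).trans (hQ c hc)
      exact nbrIn_mono subset_rfl (Finset.filter_subset _ _)
    rw [← Finset.mul_sum] at h1
    have h3 := Nat.mul_le_mul_left q h2
    have h4 := hC.card_pos
    refine Nat.le_of_mul_le_mul_right ?_ h4
    calc _ ≤ _ := h1
      _ ≤ _ := h3
      _ = _ := by ring

end Reach

/-! ### Tokens: arms meeting at a common hinge. -/

section Token

variable {V : Type u}

/-- A connected set `conn` such that each `c ∈ ends` has an adjacent `arm c` in it,
adjacent to the common vertex `hinge`. -/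
structure Token (V : Type u) (K : ℕ) where
  /-- the connected set -/
  conn : Finset V
  /-- the vertex adjacent to all arms -/
  hinge : V
  /-- the vertices that have arms -/
  ends : Finset V
  /-- a connected part of `conn` joining an end to the hinge -/
  arm : V → Finset V
  /-- the index of the hub set containing the ends -/
  idx : Fin K

variable {G : SimpleGraph V} {e K M r : ℕ} {z : ℕ → ℕ}

/-- The token `x` has its hinge in the `k`-th hub of `S` and its ends in the `M`-th hub. -/
structure Token.IsAt (x : Token V K) (S : G.HubSequence e K (M + 1) z r) (k : ℕ) : Prop where
  conn_subset : x.conn ⊆ S.core M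
  card_conn : (G.closedNbrIn x.conn (S.core M)).card ≤ 2 ^ K * z M + 2 * e
  hinge_mem : ∃ j, x.hinge ∈ S.hub k j
  ends_subset : x.ends ⊆ S.hub M x.idx
  card_ends : (S.hub M x.idx).card ≤ 8 * K * x.ends.card
  arm_subset : ∀ c ∈ x.ends, x.arm c ⊆ x.conn
  arm_connectedOn : ∀ c ∈ x.ends, G.ConnectedOn (x.arm c)
  arm_adj_end : ∀ c ∈ x.ends, ∃ a ∈ x.arm c, G.Adj c a
  arm_adj_hinge : ∀ c ∈ x.ends, ∃ a ∈ x.arm c, G.Adj a x.hinge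
  card_arm : ∀ c ∈ x.ends, (G.closedNbrIn (x.arm c) (S.core k)).card ≤ 2 ^ K * z k + 2 * e

/-- The token `y` interferes little with the earlier token `x`. -/
structure Token.Far (G : SimpleGraph V) (q : ℕ) (x y : Token V K) : Prop where
  disjoint : Disjoint x.conn y.conn
  anti : G.Anti x.conn y.conn
  hinge_anti : ∀ a ∈ y.conn, ¬ G.Adj x.hinge a
  hinge_hinge : ¬ G.Adj x.hinge y.hinge
  card_reach : q * (G.reach x.ends x.arm y.hinge).card ≤ x.ends.card

variable [Fintype V]

lemma HubSequence.exists_conn (S : G.HubSequence e K (M + 1) z r) (h : G.Coherent e)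
    (he : 0 < e) (F : Finset V) (hF : F.card + 3 * e ≤ r) (hr : 2 ^ K * z M + 2 * e ≤ r) :
    ∃ X ⊆ S.core M \ F, G.ConnectedOn X ∧
      2 ^ K * z M + e ≤ (G.closedNbrIn X (S.core M)).card ∧
      (G.closedNbrIn X (S.core M)).card ≤ 2 ^ K * z M + 2 * e := by
  have hc := S.le_card_core M (by omega)
  have h1 := Finset.le_card_sdiff F (S.core M)
  obtain ⟨X, hXF, hX, hXe⟩ := h.exists_connectedOn he (W := S.core M \ F) (by omega)
  have h2 := h.card_sdiff_closedNbrIn_lt hXe (S.core M)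
  have h3 := Finset.card_sdiff_add_card_eq_card
    (closedNbrIn_subset : G.closedNbrIn X (S.core M) ⊆ S.core M)
  obtain ⟨x, hx⟩ := hX.1
  obtain ⟨Q, hQX, -, hQ, hg, hg'⟩ := h.exists_connectedOn_card hX hx
    (show 2 ^ K * z M + e ≤ (G.closedNbrIn X (S.core M)).card by omega)
  exact ⟨Q, hQX.trans hXF, hQ, hg, by omega⟩

/-- From a neighbour of `c` in `X`, an arm grows until its closed neighbourhood in `core k` reaches
the threshold of the `k`-th hub; `X` is large enough because `z` is monotone and the cores are
nested. Stopping there keeps the arm's neighbourhood small compared with later hubs. -/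
lemma HubSequence.exists_arms (S : G.HubSequence e K (M + 1) z r) (h : G.Coherent e)
    (hz : ∀ s t, s ≤ t → z s ≤ z t) {X : Finset V} (hX : G.ConnectedOn X) (hXM : X ⊆ S.core M)
    (hg : 2 ^ K * z M + e ≤ (G.closedNbrIn X (S.core M)).card) {k : ℕ} (hk : k < M)
    (Y : Finset V) :
    ∃ Q : V → Finset V, ∀ c ∈ G.nbrIn X Y, Q c ⊆ X ∧ G.ConnectedOn (Q c) ∧
      (∃ a ∈ Q c, G.Adj c a) ∧
      (G.closedNbrIn (Q c) (S.core k)).card ≤ 2 ^ K * z k + 2 * e ∧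
      ∃ j, (S.hub k j).card ≤ 2 * (G.nbrIn (Q c) (S.hub k j)).card := by
  have key : ∀ c, ∃ Q : Finset V, c ∈ G.nbrIn X Y → Q ⊆ X ∧ G.ConnectedOn Q ∧
      (∃ a ∈ Q, G.Adj c a) ∧ (G.closedNbrIn Q (S.core k)).card ≤ 2 ^ K * z k + 2 * e ∧
      ∃ j, (S.hub k j).card ≤ 2 * (G.nbrIn Q (S.hub k j)).card := by
    intro c
    by_cases hc : c ∈ G.nbrIn X Y
    swap
    · exact ⟨∅, fun h => absurd h hc⟩
    obtain ⟨-, x, hx, hxc⟩ := mem_nbrIn.1 hc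
    have hMk := S.core_subset M (by omega) k hk
    obtain ⟨Q, hQX, hxQ, hQ, hgQ, hgQ'⟩ := h.exists_connectedOn_card (W := S.core k)
      (g := 2 ^ K * z k + e) hX hx (by
        refine le_trans ?_ (hg.trans (Finset.card_le_card (closedNbrIn_mono subset_rfl hMk)))
        exact Nat.add_le_add_right (Nat.mul_le_mul_left _ (hz _ _ hk.le)) _)
    exact ⟨Q, fun _ => ⟨hQX, hQ, ⟨x, hxQ, hxc.symm⟩, by omega,
      S.isHub k (by omega) Q ((hQX.trans hXM).trans hMk) hQ hgQ⟩⟩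
  choose Q hQ using key
  exact ⟨Q, hQ⟩

lemma HubSequence.exists_token (S : G.HubSequence e K (M + 1) z r) (h : G.Coherent e)
    (he : 0 < e) (hz : ∀ s t, s ≤ t → z s ≤ z t) (hz0 : 0 < z 0)
    (hr : M * (2 ^ K * z M + 3 * e) + 3 * e + (2 ^ K * z M + 2 * e) ≤ r) {k : ℕ} (hk : k < M)
    (hzk : 8 * (M * e + ∑ s ∈ Finset.range k, 4 * M * (2 ^ K * z s + 2 * e)) ≤ z k)
    (f : ℕ → Token V K) (hf : ∀ s < k, (f s).IsAt S s) :
    ∃ y : Token V K, y.IsAt S k ∧ ∀ s < k, (f s).Far G (4 * M) y := by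
  -- Avoiding `F` keeps the new connected set anticomplete to the earlier ones and to the earlier
  -- hinges.
  set F : Finset V := (Finset.range k).biUnion fun s =>
    G.closedNbrIn (f s).conn (S.core M) ∪ G.closedNbrIn {(f s).hinge} Finset.univ with hF
  have hFc : F.card ≤ M * (2 ^ K * z M + 3 * e) := by
    refine (Finset.card_biUnion_le_card_mul _ _ (2 ^ K * z M + 3 * e) fun s hs => ?_).trans ?_
    · have h1 := (hf s (Finset.mem_range.1 hs)).card_conn
      have h2 := h.card_closedNbr_le (f s).hinge
      exact (Finset.card_union_le _ _).trans (by omega)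
    · rw [Finset.card_range]
      exact Nat.mul_le_mul_right _ hk.le
  obtain ⟨X, hXF, hX, hg, hg'⟩ := S.exists_conn h he F (by omega) (by omega)
  have hXM : X ⊆ S.core M := hXF.trans Finset.sdiff_subset
  have hXF' : ∀ a ∈ X, ∀ s < k, a ∉ G.closedNbrIn (f s).conn (S.core M) ∧
      a ∉ G.closedNbrIn {(f s).hinge} Finset.univ := by
    intro a ha s hs
    have h1 := (Finset.mem_sdiff.1 (hXF ha)).2
    rw [hF, Finset.mem_biUnion] at h1
    have h2 : a ∉ G.closedNbrIn (f s).conn (S.core M) ∪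
      G.closedNbrIn {(f s).hinge} Finset.univ := fun h2 => h1 ⟨s, Finset.mem_range.2 hs, h2⟩
    rw [Finset.mem_union, not_or] at h2
    exact h2
  obtain ⟨i, hi⟩ := S.isHub M (by omega) X hXM hX hg
  obtain ⟨Q, hQ⟩ := S.exists_arms h hz hX hXM hg hk (S.hub M i)
  set C₀ := G.nbrIn X (S.hub M i) with hC₀
  obtain ⟨j, -, hj⟩ := exists_card_le_mul_filter C₀ (Finset.univ : Finset (Fin K))
    ⟨i, Finset.mem_univ _⟩
    (fun j c => (S.hub k j).card ≤ 2 * (G.nbrIn (Q c) (S.hub k j)).card)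
    (fun c hc => (hQ c hc).2.2.2.2.imp fun _ h => ⟨Finset.mem_univ _, h⟩)
  rw [Finset.card_univ, Fintype.card_fin] at hj
  set C₁ := C₀.filter fun c => (S.hub k j).card ≤ 2 * (G.nbrIn (Q c) (S.hub k j)).card with hC₁
  -- Bad positions for the hinge: next to an earlier hinge, or touched by more than a `1 / (4 * M)`
  -- fraction of the arms of an earlier token. An arm of token `s` has few neighbours in `core s`,
  -- which contains the `k`-th hub, so `B` is small compared with `z k`.
  set B : Finset V := (Finset.range k).biUnion fun s =>
    G.closedNbrIn {(f s).hinge} Finset.univ ∪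
      (S.hub k j).filter fun v => (f s).ends.card <
        4 * M * (G.reach (f s).ends (f s).arm v).card with hB
  have hBc : 8 * B.card ≤ (S.hub k j).card := by
    refine le_trans (Nat.mul_le_mul_left _ ?_) (hzk.trans (S.le_card_hub k (by omega) j))
    calc B.card ≤ ∑ s ∈ Finset.range k, (e + 4 * M * (2 ^ K * z s + 2 * e)) := by
          refine Finset.card_biUnion_le.trans (Finset.sum_le_sum fun s hs => ?_)
          have hs' := Finset.mem_range.1 hs
          refine (Finset.card_union_le _ _).trans (Nat.add_le_add (h.card_closedNbr_le _) ?_)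
          refine card_filter_lt_mul_reach_le fun c hc => ?_
          refine (Finset.card_le_card ?_).trans ((hf s hs').card_arm c hc)
          exact nbrIn_subset_closedNbrIn (S.hub_subset k (by omega) s hs' j)
      _ ≤ _ := by
          rw [Finset.sum_add_distrib, Finset.sum_const, Finset.card_range, smul_eq_mul]
          exact Nat.add_le_add_right (Nat.mul_le_mul_right _ hk.le) _
  have hZ : (S.hub k j).Nonempty := by
    rw [← Finset.card_pos]
    exact (hz0.trans_le (hz 0 k (Nat.zero_le _))).trans_le (S.le_card_hub k (by omega) j)
  obtain ⟨v, hv, hvC⟩ := exists_card_le_reach hZ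
    (fun c hc => (Finset.mem_filter.1 hc).2 : ∀ c ∈ C₁, _) hBc
  obtain ⟨hvZ, hvB⟩ := Finset.mem_sdiff.1 hv
  have hvB' : ∀ s < k, v ∉ G.closedNbrIn {(f s).hinge} Finset.univ ∧
      4 * M * (G.reach (f s).ends (f s).arm v).card ≤ (f s).ends.card := by
    intro s hs
    rw [hB, Finset.mem_biUnion] at hvB
    refine ⟨fun h2 => hvB ⟨s, Finset.mem_range.2 hs, Finset.mem_union_left _ h2⟩, ?_⟩
    by_contra! hcon
    exact hvB ⟨s, Finset.mem_range.2 hs,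
      Finset.mem_union_right _ (Finset.mem_filter.2 ⟨hvZ, hcon⟩)⟩
  have hC : ∀ c ∈ G.reach C₁ Q v, c ∈ C₀ ∧ ∃ a ∈ Q c, G.Adj a v := by
    intro c hc
    exact ⟨(Finset.mem_filter.1 (mem_reach.1 hc).1).1, (mem_reach.1 hc).2⟩
  refine ⟨⟨X, v, G.reach C₁ Q v, Q, i⟩, ⟨hXM, hg', ⟨j, hvZ⟩,
    fun c hc => nbrIn_subset (hC c hc).1, ?_, fun c hc => (hQ c (hC c hc).1).1,
    fun c hc => (hQ c (hC c hc).1).2.1, fun c hc => (hQ c (hC c hc).1).2.2.1,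
    fun c hc => (hC c hc).2, fun c hc => (hQ c (hC c hc).1).2.2.2.1⟩, fun s hs => ⟨?_, ?_, ?_, ?_,
    (hvB' s hs).2⟩⟩
  -- The constant `8 * K` is two for the half cover of `hub M i`, `K` for the pigeonhole over the
  -- sets of the `k`-th hub, and four for the choice of the hinge.
  · dsimp only
    have h1 := Nat.mul_le_mul_left K hvC
    calc _ ≤ 2 * C₀.card := hi
      _ ≤ 2 * (K * C₁.card) := Nat.mul_le_mul_left _ hj
      _ ≤ 2 * (K * (4 * (G.reach C₁ Q v).card)) := Nat.mul_le_mul_left _ h1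
      _ = _ := by ring
  · refine Finset.disjoint_right.2 fun a ha has => (hXF' a ha s hs).1 ?_
    exact mem_closedNbrIn.2 ⟨hXM ha, Or.inl has⟩
  · exact fun b hb a ha hab =>
      (hXF' a ha s hs).1 (mem_closedNbrIn.2 ⟨hXM ha, Or.inr ⟨b, hb, hab⟩⟩)
  · exact fun a ha hab => (hXF' a ha s hs).2
      (mem_closedNbrIn.2 ⟨Finset.mem_univ _, Or.inr ⟨_, Finset.mem_singleton_self _, hab⟩⟩)
  · exact fun hab => (hvB' s hs).1
      (mem_closedNbrIn.2 ⟨Finset.mem_univ _, Or.inr ⟨_, Finset.mem_singleton_self _, hab⟩⟩)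

end Token

/-! ### Independent sets in digraphs and large common intersections. -/

section Selection

/-- A digraph with bounded out-degrees has a large independent set. -/
lemma exists_independent_of_outDegree_le {α : Type*} (r : α → α → Prop) (d m : ℕ) :
    ∀ C : Finset α, (∀ c ∈ C, (C.filter (r c)).card ≤ d) → m * (2 * d + 1) ≤ C.card →
      ∃ I ⊆ C, I.card = m ∧ ∀ a ∈ I, ∀ b ∈ I, a ≠ b → ¬ r a b := by
  induction m with
  | zero => exact fun C _ _ => ⟨∅, Finset.empty_subset _, rfl, by simp⟩
  | succ m ih =>
    intro C hout hC
    rw [Nat.succ_mul] at hC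
    -- In-degrees and out-degrees have the same sum, so some `c` has in-degree at most `d`. Choosing
    -- it costs at most `2 * d + 1` vertices.
    obtain ⟨c, hc, hin⟩ : ∃ c ∈ C, (C.filter fun b => r b c).card ≤ d := by
      have h1 : ∑ c ∈ C, (C.filter fun b => r b c).card ≤ ∑ c ∈ C, d := by
        exact (Finset.sum_card_bipartiteAbove_eq_sum_card_bipartiteBelow
          (s := C) (t := C) r).symm.le.trans (Finset.sum_le_sum hout)
      exact Finset.exists_le_of_sum_le (Finset.card_pos.1 (by omega)) h1
    set B := insert c (C.filter (r c) ∪ C.filter fun b => r b c) with hB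
    have hBc : B.card ≤ 2 * d + 1 := by
      have h1 : B.card ≤ _ := Finset.card_insert_le c (C.filter (r c) ∪ C.filter fun b => r b c)
      have h2 := Finset.card_union_le (C.filter (r c)) (C.filter fun b => r b c)
      have h3 := hout c hc
      omega
    obtain ⟨I, hI, hIm, hind⟩ := ih (C \ B)
      (fun a ha => (Finset.card_le_card (Finset.filter_subset_filter _ Finset.sdiff_subset)).trans
        (hout a (Finset.mem_sdiff.1 ha).1)) (by
        have := Finset.le_card_sdiff B C
        omega)
    have hIB : ∀ a ∈ I, a ∈ C ∧ a ≠ c ∧ ¬ r c a ∧ ¬ r a c := by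
      intro a ha
      obtain ⟨h1, h2⟩ := Finset.mem_sdiff.1 (hI ha)
      rw [hB] at h2
      simp only [Finset.mem_insert, Finset.mem_union, Finset.mem_filter, not_or, not_and] at h2
      exact ⟨h1, h2.1, h2.2.1 h1, h2.2.2 h1⟩
    have hcI : c ∉ I := fun h => (hIB c h).2.1 rfl
    refine ⟨insert c I, Finset.insert_subset hc fun a ha => (hIB a ha).1, by
      rw [Finset.card_insert_of_notMem hcI, hIm], fun a ha b hb hab => ?_⟩
    rcases Finset.mem_insert.1 ha with ha | ha
    · rcases Finset.mem_insert.1 hb with hb | hb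
      · exact absurd (ha.trans hb.symm) hab
      · exact ha ▸ (hIB b hb).2.2.1
    · rcases Finset.mem_insert.1 hb with hb | hb
      · exact hb ▸ (hIB a ha).2.2.2
      · exact hind a ha b hb hab

/-- Among many dense subsets of `Y`, some `N` have a large intersection. -/
lemma exists_large_inter {α ι : Type*} {Y : Finset α} {T : Finset ι} {D : ι → Finset α}
    {k N : ℕ} (hY : Y.Nonempty) (hD : ∀ t ∈ T, D t ⊆ Y) (hcard : ∀ t ∈ T, Y.card ≤ k * (D t).card)
    (hT : 2 * k * N ≤ T.card) (hk : 0 < k) (hN : 0 < N) :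
    ∃ S ⊆ T, N ≤ S.card ∧ ∃ C : Finset α, (∀ t ∈ S, C ⊆ D t) ∧
      Y.card ≤ T.card * (2 ^ T.card * C.card) := by
  set I : α → Finset ι := fun c => T.filter fun t => c ∈ D t with hI
  set big := Y.filter fun c => N ≤ (I c).card with hbig
  have h1 : ∑ c ∈ Y, (I c).card = ∑ t ∈ T, (D t).card := by
    refine (Finset.sum_card_bipartiteAbove_eq_sum_card_bipartiteBelow
      (s := T) (t := Y) (fun t c => c ∈ D t)).symm.trans ?_
    refine Finset.sum_congr rfl fun t ht => ?_
    congr 1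
    ext c
    simp only [Finset.bipartiteAbove, Finset.mem_filter]
    exact ⟨fun h => h.2, fun h => ⟨hD t ht h, h⟩⟩
  have h2 : T.card * Y.card ≤ k * ∑ t ∈ T, (D t).card := by
    rw [Finset.mul_sum, ← smul_eq_mul, ← Finset.sum_const]
    exact Finset.sum_le_sum hcard
  have h3 : 2 * N * Y.card ≤ ∑ t ∈ T, (D t).card := by
    refine Nat.le_of_mul_le_mul_left ?_ hk
    calc k * (2 * N * Y.card) = 2 * k * N * Y.card := by ring
      _ ≤ T.card * Y.card := Nat.mul_le_mul_right _ hT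
      _ ≤ _ := h2
  have h4 : ∑ c ∈ Y, (I c).card ≤ N * Y.card + T.card * big.card := by
    calc ∑ c ∈ Y, (I c).card ≤ ∑ c ∈ Y, (N + if N ≤ (I c).card then T.card else 0) := by
          refine Finset.sum_le_sum fun c _ => ?_
          split_ifs with h
          · exact (Finset.card_le_card (Finset.filter_subset _ _)).trans (Nat.le_add_left _ _)
          · omega
      _ = _ := by
          rw [Finset.sum_add_distrib, Finset.sum_const, smul_eq_mul, ← Finset.sum_filter,
            Finset.sum_const, smul_eq_mul, mul_comm, mul_comm big.card]
  have h5 : N * Y.card ≤ T.card * big.card := by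
    have : 2 * N * Y.card = N * Y.card + N * Y.card := by ring
    omega
  have hYN : Y.card ≤ N * Y.card := Nat.le_mul_of_pos_left _ hN
  have hYpos := hY.card_pos
  -- Many elements lie in at least `N` of the sets; they are now sorted by the exact collection of
  -- sets containing them, with at most `2 ^ T.card` classes.
  obtain ⟨S, hS, hSc⟩ := exists_card_le_mul_filter big T.powerset ⟨∅, by simp⟩
    (fun S c => I c = S) (fun c _ => ⟨I c, by simp [hI], rfl⟩)
  rw [Finset.card_powerset] at hSc
  have hle : Y.card ≤ T.card * (2 ^ T.card * (big.filter fun c => I c = S).card) :=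
    (hYN.trans h5).trans (Nat.mul_le_mul_left _ hSc)
  obtain ⟨c, hc⟩ : (big.filter fun c => I c = S).Nonempty := by
    rw [Finset.nonempty_iff_ne_empty]
    intro h0
    rw [h0, Finset.card_empty, mul_zero, mul_zero] at hle
    omega
  refine ⟨S, Finset.mem_powerset.1 hS, ?_, _, fun t ht c hc => ?_, hle⟩
  · obtain ⟨hc1, rfl⟩ := Finset.mem_filter.1 hc
    exact (Finset.mem_filter.1 hc1).2
  · obtain ⟨-, rfl⟩ := Finset.mem_filter.1 hc
    exact (Finset.mem_filter.1 ht).2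

end Selection

/-! ### Tokens yield subdivision models. -/

section Assembly

variable {V : Type u} [Fintype V] {G : SimpleGraph V} {e K M m r : ℕ} {z : ℕ → ℕ}

/-- The ends of the `t`-th token that are undisturbed by the hinges of the other tokens. -/
noncomputable def freeEnds (G : SimpleGraph V) (f : ℕ → Token V K) (M t : ℕ) : Finset V :=
  (f t).ends \ (Finset.range M).biUnion fun s =>
    G.closedNbrIn {(f s).hinge} Finset.univ ∪
      if t < s then G.reach (f t).ends (f t).arm (f s).hinge else ∅

/-- Each of the `M` hinges spoils at most `e` ends by adjacency and a `1 / (4 * M)` fraction through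
the arms; by `he` each kind takes at most a quarter in total. -/
lemma Coherent.card_ends_le_card_freeEnds (h : G.Coherent e) {f : ℕ → Token V K} {t : ℕ}
    (hM : 0 < M) (hfar : ∀ s < M, t < s → (f t).Far G (4 * M) (f s))
    (he : 4 * M * e ≤ (f t).ends.card) :
    (f t).ends.card ≤ 2 * (G.freeEnds f M t).card := by
  set B := (Finset.range M).biUnion fun s =>
    G.closedNbrIn {(f s).hinge} Finset.univ ∪
      if t < s then G.reach (f t).ends (f t).arm (f s).hinge else ∅ with hB
  have h1 : 4 * M * B.card ≤ M * (4 * M * e + (f t).ends.card) := by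
    calc 4 * M * B.card ≤ 4 * M * ∑ s ∈ Finset.range M,
          (G.closedNbrIn {(f s).hinge} Finset.univ ∪
            if t < s then G.reach (f t).ends (f t).arm (f s).hinge else ∅).card :=
          Nat.mul_le_mul_left _ Finset.card_biUnion_le
      _ ≤ ∑ s ∈ Finset.range M, (4 * M * e + (f t).ends.card) := by
          rw [Finset.mul_sum]
          refine Finset.sum_le_sum fun s hs => ?_
          refine (Nat.mul_le_mul_left _ (Finset.card_union_le _ _)).trans ?_
          rw [Nat.mul_add]
          refine Nat.add_le_add (Nat.mul_le_mul_left _ (h.card_closedNbr_le _)) ?_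
          split_ifs with hts
          · exact (hfar s (Finset.mem_range.1 hs) hts).card_reach
          · simp
      _ = _ := by simp
  have h2 : 4 * B.card ≤ 4 * M * e + (f t).ends.card := by
    refine Nat.le_of_mul_le_mul_left ?_ hM
    calc M * (4 * B.card) = 4 * M * B.card := by ring
      _ ≤ _ := h1
  have h3 := Finset.le_card_sdiff B (f t).ends
  have h4 : G.freeEnds f M t = (f t).ends \ B := rfl
  rw [h4]
  omega

lemma mem_freeEnds {f : ℕ → Token V K} {t : ℕ} {c : V} (hc : c ∈ G.freeEnds f M t) :
    c ∈ (f t).ends ∧ (∀ s < M, ¬ G.Adj (f s).hinge c) ∧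
      ∀ s < M, t < s → ∀ a ∈ (f t).arm c, ¬ G.Adj a (f s).hinge := by
  obtain ⟨h1, h2⟩ := Finset.mem_sdiff.1 hc
  refine ⟨h1, fun s hs hadj => h2 (Finset.mem_biUnion.2 ⟨s, Finset.mem_range.2 hs, ?_⟩),
    fun s hs hts a ha hadj => h2 (Finset.mem_biUnion.2 ⟨s, Finset.mem_range.2 hs, ?_⟩)⟩
  · exact Finset.mem_union_left _
      (mem_closedNbrIn.2 ⟨Finset.mem_univ _, Or.inr ⟨_, Finset.mem_singleton_self _, hadj⟩⟩)
  · rw [if_pos hts]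
    exact Finset.mem_union_right _ (mem_reach.2 ⟨h1, a, ha, hadj⟩)

/-- The arms of one token, attached to its hinge, form the link between two ends. -/
noncomputable def Token.link (x : Token V K) (c d : V) : Finset V :=
  insert x.hinge (x.arm c) ∪ insert x.hinge (x.arm d)

omit [Fintype V] in
lemma Token.mem_link {x : Token V K} {c d y : V} :
    y ∈ x.link c d ↔ y = x.hinge ∨ y ∈ x.arm c ∨ y ∈ x.arm d := by
  simp only [Token.link, Finset.mem_union, Finset.mem_insert]
  tauto

/-- For two tokens, the later connected set avoids the earlier hinge and connected set by
`Token.Far`, while the earlier arms avoid the later hinge because the ends are free. Disjointness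
comes from the nesting of hubs and cores. -/
lemma HubSequence.exists_model (S : G.HubSequence e K (M + 1) z r) (f : ℕ → Token V K)
    (hf : ∀ t < M, (f t).IsAt S t) (hfar : ∀ t < M, ∀ s < t, (f s).Far G (4 * M) (f t))
    (τ : Fin m × Fin m → ℕ) (hτ : Function.Injective τ) (hτM : ∀ p, τ p < M)
    (c : Fin m → V) (hc : Function.Injective c) (hcfree : ∀ p a, c a ∈ G.freeEnds f M (τ p))
    (hcc : ∀ a b, a ≠ b → ¬ G.Adj (c a) (c b))
    (hcarm : ∀ p a b, a ≠ b → ∀ y ∈ (f (τ p)).arm (c a), ¬ G.Adj y (c b)) :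
    Nonempty (G.SubdivisionModel m) := by
  have hfree := fun p a => mem_freeEnds (hcfree p a)
  have hcore : ∀ p, ∃ i, ∀ a, c a ∈ S.hub M i := fun p =>
    ⟨_, fun a => (hf _ (hτM p)).ends_subset (hfree p a).1⟩
  have hc_core : ∀ a, c a ∉ S.core M := by
    intro a ha
    obtain ⟨i, hi⟩ := hcore (a, a)
    exact Finset.disjoint_left.1 (S.disjoint M (by omega) i) (hi a) ha
  have harm : ∀ p a, (f (τ p)).arm (c a) ⊆ (f (τ p)).conn := fun p a =>
    (hf _ (hτM p)).arm_subset _ (hfree p a).1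
  have harm_core : ∀ p a, (f (τ p)).arm (c a) ⊆ S.core M := fun p a =>
    (harm p a).trans (hf _ (hτM p)).conn_subset
  have hinge_core : ∀ t < M, (f t).hinge ∉ S.core M := by
    intro t ht hmem
    obtain ⟨j, hj⟩ := (hf t ht).hinge_mem
    exact Finset.disjoint_left.1 (S.disjoint t (by omega) j) hj
      (S.core_subset M (by omega) t ht hmem)
  have hc_hinge : ∀ p a, c a ≠ (f (τ p)).hinge := by
    intro p a heq
    obtain ⟨i, hi⟩ := hcore p
    obtain ⟨j, hj⟩ := (hf _ (hτM p)).hinge_mem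
    refine Finset.disjoint_left.1 (S.disjoint (τ p) ((hτM p).trans (Nat.lt_succ_self _)) j) hj ?_
    exact heq ▸ S.hub_subset M (by omega) _ (hτM p) i (hi a)
  have hinge_ne : ∀ s t, s < t → t < M → (f s).hinge ≠ (f t).hinge := by
    intro s t hst ht heq
    obtain ⟨i, hi⟩ := (hf t ht).hinge_mem
    obtain ⟨j, hj⟩ := (hf s (hst.trans ht)).hinge_mem
    refine Finset.disjoint_left.1 (S.disjoint s (by omega) j) hj ?_
    exact heq ▸ S.hub_subset t (by omega) s hst i hi
  have hlink : ∀ p q, τ p < τ q → ∀ a b a' b',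
      Disjoint ((f (τ p)).link (c a) (c b)) ((f (τ q)).link (c a') (c b')) ∧
      G.Anti ((f (τ p)).link (c a) (c b)) ((f (τ q)).link (c a') (c b')) := by
    intro p q hpq a b a' b'
    have hF := hfar _ (hτM q) _ hpq
    constructor
    · rw [Finset.disjoint_left]
      intro y hy hy'
      rw [Token.mem_link] at hy hy'
      have h1 : ∀ a a', y ∈ (f (τ p)).arm (c a) → y ∉ (f (τ q)).arm (c a') := fun a a' h h' =>
        Finset.disjoint_left.1 hF.disjoint (harm _ _ h) (harm _ _ h')
      rcases hy with rfl | hy | hy <;> rcases hy' with hy' | hy' | hy'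
      · exact hinge_ne _ _ hpq (hτM q) hy'
      · exact hinge_core _ (hτM p) (harm_core _ _ hy')
      · exact hinge_core _ (hτM p) (harm_core _ _ hy')
      · exact hinge_core _ (hτM q) (hy' ▸ harm_core _ _ hy)
      · exact h1 _ _ hy hy'
      · exact h1 _ _ hy hy'
      · exact hinge_core _ (hτM q) (hy' ▸ harm_core _ _ hy)
      · exact h1 _ _ hy hy'
      · exact h1 _ _ hy hy'
    · intro y hy y' hy'
      rw [Token.mem_link] at hy hy'
      have h1 : ∀ a a', y ∈ (f (τ p)).arm (c a) → y' ∈ (f (τ q)).arm (c a') → ¬ G.Adj y y' :=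
        fun a a' h h' => hF.anti _ (harm _ _ h) _ (harm _ _ h')
      rcases hy with rfl | hy | hy <;> rcases hy' with rfl | hy' | hy'
      · exact hF.hinge_hinge
      · exact hF.hinge_anti _ (harm _ _ hy')
      · exact hF.hinge_anti _ (harm _ _ hy')
      · exact (hfree p _).2.2 _ (hτM q) hpq _ hy
      · exact h1 _ _ hy hy'
      · exact h1 _ _ hy hy'
      · exact (hfree p _).2.2 _ (hτM q) hpq _ hy
      · exact h1 _ _ hy hy'
      · exact h1 _ _ hy hy'
  refine ⟨{
    vert := c
    vert_injective := hc
    not_adj := ?_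
    link := fun a b => (f (τ (a, b))).link (c a) (c b)
    connectedOn := ?_
    adj_left := ?_
    adj_right := ?_
    vert_notMem := ?_
    vert_anti := ?_
    disjoint := ?_
    anti := ?_ }⟩
  · intro a b
    by_cases hab : a = b
    · subst hab; exact G.irrefl
    · exact hcc a b hab
  · intro a b _
    have h1 : ∀ d, G.ConnectedOn (insert (f (τ (a, b))).hinge ((f (τ (a, b))).arm (c d))) := by
      intro d
      obtain ⟨y, hy, hadj⟩ := (hf _ (hτM (a, b))).arm_adj_hinge _ (hfree _ d).1
      exact ((hf _ (hτM (a, b))).arm_connectedOn _ (hfree _ d).1).insert_of_adj hy hadj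
    exact (h1 a).union (h1 b)
      ⟨_, Finset.mem_insert_self _ _, _, Finset.mem_insert_self _ _, Or.inl rfl⟩
  · intro a b _
    obtain ⟨y, hy, hadj⟩ := (hf _ (hτM (a, b))).arm_adj_end _ (hfree _ a).1
    exact ⟨y, Token.mem_link.2 (Or.inr (Or.inl hy)), hadj⟩
  · intro a b _
    obtain ⟨y, hy, hadj⟩ := (hf _ (hτM (a, b))).arm_adj_end _ (hfree _ b).1
    exact ⟨y, Token.mem_link.2 (Or.inr (Or.inr hy)), hadj⟩
  · intro a b d _ hmem
    rcases Token.mem_link.1 hmem with h1 | h1 | h1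
    · exact hc_hinge _ _ h1
    · exact hc_core _ (harm_core _ _ h1)
    · exact hc_core _ (harm_core _ _ h1)
  · intro a b d _ hda hdb y hy hadj
    rcases Token.mem_link.1 hy with rfl | h1 | h1
    · exact (hfree (a, b) d).2.1 _ (hτM _) hadj.symm
    · exact hcarm _ _ _ hda.symm _ h1 hadj.symm
    · exact hcarm _ _ _ hdb.symm _ h1 hadj.symm
  · intro a b a' b' _ _ hne
    rcases lt_or_gt_of_ne (hτ.ne hne) with hlt | hlt
    · exact (hlink _ _ hlt _ _ _ _).1
    · exact (hlink _ _ hlt _ _ _ _).1.symm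
  · intro a b a' b' _ _ hne
    rcases lt_or_gt_of_ne (hτ.ne hne) with hlt | hlt
    · exact (hlink _ _ hlt _ _ _ _).2
    · exact (hlink _ _ hlt _ _ _ _).2.symm

/-- Of the `M` tokens, `M / K` have their ends in the same set of the last hub, each with free ends
of density at least `1 / (16 * K)`. The value of `M` is what `exists_large_inter` needs to find `m *
m` of them with a large common set of free ends. -/
lemma HubSequence.exists_model_of_tokens (S : G.HubSequence e K (M + 1) z r) (h : G.Coherent e)
    (f : ℕ → Token V K)
    (hf : ∀ t < M, (f t).IsAt S t) (hfar : ∀ t < M, ∀ s < t, (f s).Far G (4 * M) (f t))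
    (hm : 0 < m) (hK : 0 < K) (hM : M = 32 * K * K * (m * m)) (hzM : 32 * K * M * e ≤ z M)
    (hzM' : M * 2 ^ M * (m * (2 * (e + ∑ t ∈ Finset.range M, (2 ^ K * z t + 2 * e)) + 1)) ≤ z M)
    (hz0 : 0 < z M) :
    Nonempty (G.SubdivisionModel m) := by
  have hmm : 0 < m * m := Nat.mul_pos hm hm
  have hMpos : 0 < M := by rw [hM]; positivity
  obtain ⟨i, -, hi⟩ := exists_card_le_mul_filter (Finset.range M) (Finset.univ : Finset (Fin K))
    ⟨⟨0, hK⟩, Finset.mem_univ _⟩ (fun i t => (f t).idx = i) (fun t _ => ⟨_, Finset.mem_univ _, rfl⟩)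
  rw [Finset.card_range, Finset.card_univ, Fintype.card_fin] at hi
  set T := (Finset.range M).filter fun t => (f t).idx = i with hT
  have hTM : ∀ t ∈ T, t < M ∧ (f t).idx = i := fun t ht => by simpa [hT] using ht
  have hTc : 2 * (16 * K) * (m * m) ≤ T.card := by
    refine Nat.le_of_mul_le_mul_left ?_ hK
    calc K * (2 * (16 * K) * (m * m)) = 32 * K * K * (m * m) := by ring
      _ ≤ _ := hM ▸ hi
  have hTM' : T.card ≤ M := (Finset.card_filter_le _ _).trans (Finset.card_range M).le
  have hYc := S.le_card_hub M (by omega) i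
  have hends : ∀ t ∈ T, 4 * M * e ≤ (f t).ends.card := by
    intro t ht
    obtain ⟨ht1, ht2⟩ := hTM t ht
    have h1 := (hf t ht1).card_ends
    rw [ht2] at h1
    refine Nat.le_of_mul_le_mul_left ?_ (show 0 < 8 * K by omega)
    calc 8 * K * (4 * M * e) = 32 * K * M * e := by ring
      _ ≤ _ := (hzM.trans hYc).trans h1
  obtain ⟨R, hRT, hRc, C, hC, hCc⟩ := exists_large_inter (Y := S.hub M i) (T := T)
    (D := G.freeEnds f M) (k := 16 * K) (N := m * m)
    (Finset.card_pos.1 (hz0.trans_le hYc))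
    (fun t ht => by
      obtain ⟨ht1, ht2⟩ := hTM t ht
      exact ht2 ▸ Finset.sdiff_subset.trans (hf t ht1).ends_subset)
    (fun t ht => by
      obtain ⟨ht1, ht2⟩ := hTM t ht
      have h1 := (hf t ht1).card_ends
      rw [ht2] at h1
      have h2 := h.card_ends_le_card_freeEnds hMpos (t := t)
        (fun s hs hts => hfar s hs t hts) (hends t ht)
      refine (h1.trans (Nat.mul_le_mul_left _ h2)).trans (le_of_eq (by ring)))
    hTc (by omega) hmm
  set d := e + ∑ t ∈ Finset.range M, (2 ^ K * z t + 2 * e) with hd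
  have hCd : m * (2 * d + 1) ≤ C.card := by
    refine Nat.le_of_mul_le_mul_left ?_ (show 0 < M * 2 ^ M by positivity)
    refine (hzM'.trans hYc).trans (hCc.trans ?_)
    rw [mul_assoc M]
    exact Nat.mul_le_mul hTM' (Nat.mul_le_mul_right _ (Nat.pow_le_pow_right (by norm_num) hTM'))
  have hRM : ∀ t ∈ R, t < M := fun t ht => (hTM t (hRT ht)).1
  have hRne : R.Nonempty := Finset.card_pos.1 (hmm.trans_le hRc)
  have hCY : C ⊆ S.hub M i := by
    obtain ⟨t, ht⟩ := hRne
    obtain ⟨ht1, ht2⟩ := hTM t (hRT ht)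
    exact (hC t ht).trans (ht2 ▸ Finset.sdiff_subset.trans (hf t ht1).ends_subset)
  -- Conflicts between ends are directed: an arm of `a` touches `b`. Since `b` lies in every earlier
  -- core, where the arms of `a` have small closed neighbourhoods, out-degrees are at most `d`, far
  -- below the size of `C`.
  obtain ⟨rel, hrel⟩ : ∃ rel : V → V → Prop, ∀ a b, rel a b ↔
      G.Adj a b ∨ ∃ t ∈ R, ∃ y ∈ (f t).arm a, G.Adj y b := ⟨_, fun _ _ => Iff.rfl⟩
  obtain ⟨I, hIC, hIm, hI⟩ := exists_independent_of_outDegree_le rel d m C (by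
      intro a ha
      calc _ ≤ (G.closedNbrIn {a} Finset.univ ∪
            R.biUnion fun t => G.closedNbrIn ((f t).arm a) (S.core t)).card := by
            refine Finset.card_le_card fun b hb => ?_
            obtain ⟨hbC, hb⟩ := Finset.mem_filter.1 hb
            rw [Finset.mem_union]
            rw [hrel] at hb
            rcases hb with hb | ⟨t, ht, y, hy, hb⟩
            · exact Or.inl (mem_closedNbrIn.2 ⟨Finset.mem_univ _,
                Or.inr ⟨a, Finset.mem_singleton_self _, hb⟩⟩)
            · refine Or.inr (Finset.mem_biUnion.2 ⟨t, ht, mem_closedNbrIn.2 ⟨?_,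
                Or.inr ⟨y, hy, hb⟩⟩⟩)
              exact S.hub_subset M (by omega) t (hRM t ht) i (hCY hbC)
        _ ≤ e + ∑ t ∈ R, (2 ^ K * z t + 2 * e) := by
            refine (Finset.card_union_le _ _).trans (Nat.add_le_add (h.card_closedNbr_le a) ?_)
            refine Finset.card_biUnion_le.trans (Finset.sum_le_sum fun t ht => ?_)
            exact (hf t (hRM t ht)).card_arm a (mem_freeEnds (hC t ht ha)).1
        _ ≤ d := by
            refine Nat.add_le_add_left (Finset.sum_le_sum_of_subset fun t ht => ?_) _
            exact Finset.mem_range.2 (hRM t ht)) hCd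
  obtain ⟨τ⟩ := Function.Embedding.nonempty_of_card_le (α := Fin m × Fin m) (β := R)
    (by simpa using hRc)
  let σ := (Finset.equivFinOfCardEq hIm).symm
  have hσC : ∀ a, (σ a : V) ∈ C := fun a => hIC (σ a).2
  have hσ : ∀ a b, a ≠ b → ¬ rel (σ a) (σ b) := fun a b hab =>
    hI _ (σ a).2 _ (σ b).2 fun heq => hab (σ.injective (Subtype.ext heq))
  simp only [hrel, not_or, not_exists, not_and] at hσ
  exact S.exists_model f hf hfar (fun p => τ p) (fun p q hpq => τ.injective (Subtype.ext hpq))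
    (fun p => hRM _ (τ p).2) (fun a => σ a) (fun a b hab => σ.injective (Subtype.ext hab))
    (fun p a => hC _ (τ p).2 (hσC a)) (fun a b hab => (hσ a b hab).1)
    (fun p a b hab => (hσ a b hab).2 _ (τ p).2)

end Assembly

/-! ### Choice of constants for coherent graphs. -/

section CoherentModel

/-- For `z s = e * A * (1 + A) ^ s`, every term is exactly `A` times `e` plus the sum of all earlier
terms; this is how each hub dominates everything before it. -/
lemma mul_add_sum_geom_eq (e A k : ℕ) :
    A * (e + ∑ s ∈ Finset.range k, e * A * (1 + A) ^ s) = e * A * (1 + A) ^ k := by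
  induction k with
  | zero => simp [mul_comm]
  | succ k ih =>
    rw [Finset.sum_range_succ, ← add_assoc, mul_add, ih]
    ring

/-- Large coherent graphs contain subdivision models of any given size. -/
theorem exists_subdivisionModel_of_coherent (m : ℕ) : ∃ L : ℕ, ∀ (V : Type u) [Fintype V]
    (G : SimpleGraph V) (e : ℕ), G.Coherent e → 0 < e → L * e ≤ Fintype.card V →
      Nonempty (G.SubdivisionModel m) := by
  rcases Nat.eq_zero_or_pos m with rfl | hm
  · exact ⟨0, fun V _ G e _ _ _ => ⟨⟨Fin.elim0, fun a => a.elim0, fun a => a.elim0,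
      fun a => a.elim0, fun a => a.elim0, fun a => a.elim0, fun a => a.elim0, fun a => a.elim0,
      fun a => a.elim0, fun a => a.elim0, fun a => a.elim0⟩⟩⟩
  obtain ⟨K, hK⟩ : ∃ K, K = m * 2 ^ m := ⟨_, rfl⟩
  obtain ⟨M, hM⟩ : ∃ M, M = 32 * K * K * (m * m) := ⟨_, rfl⟩
  obtain ⟨c, hc⟩ : ∃ c, c = 4 ^ (2 ^ m) * 4 + m * (m + 1) + 2 * m * m := ⟨_, rfl⟩
  obtain ⟨P, hP⟩ : ∃ P, P = 2 ^ K + 2 := ⟨_, rfl⟩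
  -- The summands serve in turn the model from a private system, the choice of hinges, the free
  -- ends, and the independent choice of ends. The factor `P` absorbs `2 ^ K * z s + 2 * e` into `P
  -- * z s`.
  obtain ⟨A, hA⟩ : ∃ A, A = c + 32 * M * P + 32 * K * M + M * 2 ^ M * (m * (3 * P)) := ⟨_, rfl⟩
  obtain ⟨B, hB⟩ : ∃ B, B = A * (1 + A) ^ M := ⟨_, rfl⟩
  have hP0 : 0 < P := by rw [hP]; positivity
  have hK0 : 0 < K := by rw [hK]; positivity
  have hc0 : 0 < c := by rw [hc]; positivity
  have hA0 : 0 < A := by omega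
  refine ⟨(M + 1) * (K * (2 ^ K * B + 2)) + (2 ^ K * B + 2) + 2 +
    (M * (2 ^ K * B + 3) + 3 + (2 ^ K * B + 2)), fun V _ G e h he hV => ?_⟩
  have : Nonempty V := by
    rw [← Fintype.card_pos_iff]
    refine lt_of_lt_of_le (Nat.mul_pos ?_ he) hV
    omega
  set z : ℕ → ℕ := fun t => e * A * (1 + A) ^ t with hz
  have hzmono : ∀ s t, s ≤ t → z s ≤ z t := fun s t hst =>
    Nat.mul_le_mul_left _ (Nat.pow_le_pow_right (by omega) hst)
  have hz0 : z 0 = e * A := by simp [hz]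
  have hez : ∀ t, e * A ≤ z t := fun t => hz0 ▸ hzmono 0 t (Nat.zero_le _)
  have hzM : z M = B * e := by simp only [hz, hB]; ring
  have hsum : ∀ k, A * (e + ∑ s ∈ Finset.range k, z s) = z k := mul_add_sum_geom_eq e A
  have hsumP : ∀ k, ∑ s ∈ Finset.range k, (2 ^ K * z s + 2 * e) ≤
      P * ∑ s ∈ Finset.range k, z s := by
    intro k
    rw [Finset.mul_sum]
    refine Finset.sum_le_sum fun s _ => ?_
    have := (Nat.le_mul_of_pos_right e hA0).trans (hez s)
    rw [hP, Nat.add_mul]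
    omega
  by_contra hmodel
  have hpriv : ∀ t < M + 1, ¬ Nonempty (G.PrivateSystem (Fin K) (z t)) := by
    rintro t - ⟨Q⟩
    subst hK
    refine hmodel ((Q.comap finProdFinEquiv finProdFinEquiv.injective).exists_model h he ?_)
    rw [← hc]
    refine le_trans ?_ (hez t)
    rw [mul_comm]
    exact Nat.mul_le_mul_left _ (by omega)
  obtain ⟨S⟩ := h.exists_hubSequence he (K := K) (n := M + 1) (D := 2 ^ K * z M + 2 * e)
    (r := M * (2 ^ K * z M + 3 * e) + 3 * e + (2 ^ K * z M + 2 * e)) (z := z)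
    (fun t ht => Nat.add_le_add_right (Nat.mul_le_mul_left _ (hzmono _ _ (by omega))) _) hpriv
    (by
      rw [hzM]
      refine le_trans (le_of_eq ?_) hV
      ring)
  have hzpos : 0 < z 0 := by rw [hz0]; positivity
  have : Nonempty (Token V K) :=
    ⟨⟨∅, Classical.arbitrary V, ∅, fun _ => ∅, ⟨0, hK0⟩⟩⟩
  obtain ⟨f, hf, hfar⟩ := exists_seq_of_forall M (fun k (x : Token V K) => x.IsAt S k)
    (fun _ _ x y => x.Far G (4 * M) y) (fun k hk f hf _ =>
      S.exists_token h he hzmono hzpos le_rfl hk (by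
        rw [← Finset.mul_sum, ← hsum k]
        calc 8 * (M * e + 4 * M * ∑ s ∈ Finset.range k, (2 ^ K * z s + 2 * e))
            ≤ 8 * (M * e + 4 * M * (P * ∑ s ∈ Finset.range k, z s)) :=
              Nat.mul_le_mul_left _ (Nat.add_le_add_left (Nat.mul_le_mul_left _ (hsumP k)) _)
          _ ≤ 8 * (4 * M * (P * e) + 4 * M * (P * ∑ s ∈ Finset.range k, z s)) := by
              have h2 : M * e ≤ M * (P * e) :=
                Nat.mul_le_mul_left _ (Nat.le_mul_of_pos_left _ hP0)
              have h3 : 4 * M * (P * e) = 4 * (M * (P * e)) := by ring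
              omega
          _ = 32 * M * P * (e + ∑ s ∈ Finset.range k, z s) := by ring
          _ ≤ _ := Nat.mul_le_mul_right _ (by omega)) f hf)
  refine hmodel (S.exists_model_of_tokens h f hf hfar hm hK0 hM ?_ ?_
    (hzpos.trans_le (hzmono 0 M (Nat.zero_le _))))
  · refine le_trans ?_ (hez M)
    rw [mul_comm]
    exact Nat.mul_le_mul_left _ (by omega)
  · rw [← hsum M]
    have h1 : 2 * (e + ∑ t ∈ Finset.range M, (2 ^ K * z t + 2 * e)) + 1 ≤
        3 * P * (e + ∑ t ∈ Finset.range M, z t) := by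
      have h2 := hsumP M
      have h3 : e ≤ P * e := Nat.le_mul_of_pos_left _ hP0
      have h4 : 3 * P * (e + ∑ t ∈ Finset.range M, z t) =
        3 * (P * e) + 3 * (P * ∑ t ∈ Finset.range M, z t) := by ring
      omega
    calc _ ≤ M * 2 ^ M * (m * (3 * P * (e + ∑ t ∈ Finset.range M, z t))) :=
          Nat.mul_le_mul_left _ (Nat.mul_le_mul_left _ h1)
      _ = M * 2 ^ M * (m * (3 * P)) * (e + ∑ t ∈ Finset.range M, z t) := by ring
      _ ≤ _ := Nat.mul_le_mul_right _ (by omega)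

end CoherentModel

/-! ### Sparse pairs in graphs without an induced copy of `H`. -/

section Embedding

variable {V : Type u} {G : SimpleGraph V}

/-- If a graph has no copy of `H` with prescribed bags for the vertices, then there is a sparse
pair, in the graph or in its complement, between subsets of two bags. -/
lemma exists_sparse_pair {k : ℕ} (hk : 0 < k) : ∀ (n r : ℕ) (H : SimpleGraph (Fin n)) (U : Fin n → Finset V),
    0 < r → (∀ i, (U i).card = r) → (∀ i j, i ≠ j → Disjoint (U i) (U j)) →
    (¬ ∃ f : Fin n → V, (∀ i, f i ∈ U i) ∧ ∀ i j, i ≠ j → (G.Adj (f i) (f j) ↔ H.Adj i j)) →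
    ∃ i j, i ≠ j ∧ ∃ A ⊆ U i, ∃ B ⊆ U j, B.card ≤ n * A.card ∧ r ≤ k ^ n * B.card ∧
      ((∀ a ∈ A, k * (G.nbrIn {a} B).card ≤ B.card) ∨
        ∀ a ∈ A, k * (Gᶜ.nbrIn {a} B).card ≤ B.card) := by
  intro n
  induction n with
  | zero => exact fun r H U _ _ _ hno => absurd ⟨fun i => i.elim0, fun i => i.elim0,
      fun i => i.elim0⟩ hno
  | succ n ih =>
    intro r H U hr hU hdisj hno
    let T : V → Fin n → Finset V := fun v j =>
      (U j.succ).filter fun w => G.Adj v w ↔ H.Adj 0 j.succ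
    -- If some `v` keeps a `1 / k` fraction of every later bag, it is taken as the image of `0` and
    -- the induction continues in the shrunken bags. If not, each vertex of `U 0` fails for some
    -- bag, and a most frequent failing bag gives the sparse pair, in `G` or in the complement
    -- according to the adjacency in `H`.
    by_cases hex : ∃ v ∈ U 0, ∀ j, r ≤ k * (T v j).card
    · obtain ⟨v, hv, hT⟩ := hex
      obtain ⟨r', hr', hkr, hr'T⟩ : ∃ r', 0 < r' ∧ r ≤ k * r' ∧ ∀ j, r' ≤ (T v j).card := by
        rcases isEmpty_or_nonempty (Fin n) with hn | hn
        · exact absurd ⟨fun _ => v, fun i => by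
            rcases Fin.eq_zero_or_eq_succ i with rfl | ⟨j, rfl⟩
            · exact hv
            · exact isEmptyElim j, fun i j hij => by
            rcases Fin.eq_zero_or_eq_succ i with rfl | ⟨i, rfl⟩
            · rcases Fin.eq_zero_or_eq_succ j with rfl | ⟨j, rfl⟩
              · exact absurd rfl hij
              · exact isEmptyElim j
            · exact isEmptyElim i⟩ hno
        · obtain ⟨j, hj⟩ := Finite.exists_min fun j => (T v j).card
          exact ⟨_, Nat.pos_of_ne_zero fun h => by
            have := hT j
            rw [h] at this
            omega, hT j, hj⟩
      choose U' hU'T hU' using fun j => Finset.exists_subset_card_eq (hr'T j)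
      have hU'U : ∀ j, U' j ⊆ U j.succ := fun j => (hU'T j).trans (Finset.filter_subset _ _)
      obtain ⟨i, j, hij, A, hA, B, hB, hAB, hrB, hs⟩ := ih r' (H.comap Fin.succ) U' hr' hU'
        (fun i j hij => (hdisj _ _ (by simpa using hij)).mono (hU'U i) (hU'U j)) (by
          rintro ⟨f, hf, hfH⟩
          have hvf : ∀ j, G.Adj v (f j) ↔ H.Adj 0 j.succ := fun j =>
            (Finset.mem_filter.1 (hU'T j (hf j))).2
          refine hno ⟨Fin.cons v f, fun i => ?_, fun i j hij => ?_⟩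
          · rcases Fin.eq_zero_or_eq_succ i with rfl | ⟨i, rfl⟩
            · exact hv
            · exact hU'U i (hf i)
          · rcases Fin.eq_zero_or_eq_succ i with rfl | ⟨i, rfl⟩ <;>
              rcases Fin.eq_zero_or_eq_succ j with rfl | ⟨j, rfl⟩
            · exact absurd rfl hij
            · exact hvf j
            · rw [G.adj_comm, H.adj_comm]
              exact hvf i
            · exact hfH i j (by simpa using hij))
      refine ⟨i.succ, j.succ, by simpa using hij, A, hA.trans (hU'U i), B, hB.trans (hU'U j),
        hAB.trans (Nat.mul_le_mul_right _ (Nat.le_succ n)), ?_, hs⟩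
      calc r ≤ k * r' := hkr
        _ ≤ k * (k ^ n * B.card) := Nat.mul_le_mul_left _ hrB
        _ = k ^ (n + 1) * B.card := by ring
    · push Not at hex
      obtain ⟨v, hv⟩ : (U 0).Nonempty := Finset.card_pos.1 (by rw [hU]; exact hr)
      obtain ⟨j₀, -⟩ := hex v hv
      obtain ⟨j, -, hj⟩ := exists_card_le_mul_filter (U 0) (Finset.univ : Finset (Fin n))
        ⟨j₀, Finset.mem_univ _⟩ (fun j v => k * (T v j).card < r)
        (fun v hv => (hex v hv).imp fun j hj => ⟨Finset.mem_univ _, hj⟩)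
      rw [Finset.card_univ, Fintype.card_fin, hU 0] at hj
      refine ⟨0, j.succ, (Fin.succ_ne_zero j).symm, (U 0).filter fun v => k * (T v j).card < r,
        Finset.filter_subset _ _, U j.succ, subset_rfl, ?_, ?_, ?_⟩
      · rw [hU]
        exact hj.trans (Nat.mul_le_mul_right _ (Nat.le_succ n))
      · rw [hU]
        exact Nat.le_mul_of_pos_left _ (by positivity)
      · by_cases hH : H.Adj 0 j.succ
        · refine Or.inl fun a ha => ?_
          rw [hU]
          refine le_trans (Nat.mul_le_mul_left _ (Finset.card_le_card fun w hw => ?_))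
            (Finset.mem_filter.1 ha).2.le
          obtain ⟨h1, x, hx, h2⟩ := mem_nbrIn.1 hw
          rw [Finset.mem_singleton.1 hx] at h2
          exact Finset.mem_filter.2 ⟨h1, iff_of_true h2 hH⟩
        · refine Or.inr fun a ha => ?_
          rw [hU]
          refine le_trans (Nat.mul_le_mul_left _ (Finset.card_le_card fun w hw => ?_))
            (Finset.mem_filter.1 ha).2.le
          obtain ⟨h1, x, hx, h2⟩ := mem_nbrIn.1 hw
          rw [Finset.mem_singleton.1 hx] at h2
          exact Finset.mem_filter.2 ⟨h1, iff_of_false ((G.compl_adj _ _).1 h2).2 hH⟩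

/-- In a large set in a graph with no induced copy of `H`, there is a sparse pair, in the graph
or in its complement. -/
lemma exists_sparse_pair_of_isEmpty_embedding {n : ℕ} (H : SimpleGraph (Fin n))
    (hG : IsEmpty (H ↪g G)) {k : ℕ} (hk : 0 < k) {U : Finset V} (hU : n ≤ U.card) :
    ∃ A ⊆ U, ∃ B ⊆ U, Disjoint A B ∧ B.card ≤ A.card ∧ U.card ≤ 2 * n * n * k ^ n * B.card ∧
      ((∀ a ∈ A, k * (G.nbrIn {a} B).card ≤ n * B.card) ∨
        ∀ a ∈ A, k * (Gᶜ.nbrIn {a} B).card ≤ n * B.card) := by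
  have hn : 0 < n := by
    rcases Nat.eq_zero_or_pos n with rfl | hn
    · exact hG.elim ⟨⟨fun i => i.elim0, fun i => i.elim0⟩, fun {i} => i.elim0⟩
    · exact hn
  set r := U.card / n with hr
  have hrpos : 0 < r := Nat.div_pos hU hn
  have hUr : U.card ≤ 2 * n * r := by
    have h1 := Nat.div_add_mod U.card n
    have h2 := Nat.mod_lt U.card hn
    have h3 : n ≤ n * r := Nat.le_mul_of_pos_right _ hrpos
    rw [← hr] at h1
    rw [mul_assoc]
    omega
  obtain ⟨g⟩ := Function.Embedding.nonempty_of_card_le (α := Fin n × Fin r) (β := U) (by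
    simp only [Fintype.card_prod, Fintype.card_fin, Fintype.card_coe]
    exact Nat.mul_div_le _ _)
  have hginj : ∀ p q, (g p : V) = g q → p = q := fun p q h => g.injective (Subtype.ext h)
  obtain ⟨i, j, hij, A, hA, B, hB, hAB, hrB, hs⟩ := exists_sparse_pair (G := G) hk n r H
    (fun i => Finset.univ.image fun t => (g (i, t) : V)) hrpos
    (fun i => by
      rw [Finset.card_image_of_injective, Finset.card_univ, Fintype.card_fin]
      intro t t' h
      simpa using hginj _ _ h)
    (fun i j hij => by
      rw [Finset.disjoint_left]
      intro y hy hy'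
      obtain ⟨t, -, rfl⟩ := Finset.mem_image.1 hy
      obtain ⟨t', -, h⟩ := Finset.mem_image.1 hy'
      exact hij (congrArg Prod.fst (hginj _ _ h)).symm)
    (by
      rintro ⟨f, hf, hfH⟩
      have hfinj : Function.Injective f := by
        intro i j hfij
        obtain ⟨t, -, h⟩ := Finset.mem_image.1 (hf i)
        obtain ⟨t', -, h'⟩ := Finset.mem_image.1 (hf j)
        exact congrArg Prod.fst (hginj _ _ (h.trans (hfij.trans h'.symm)))
      refine hG.elim ⟨⟨f, hfinj⟩, fun {i j} => ?_⟩
      by_cases hij : i = j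
      · subst hij
        exact iff_of_false G.irrefl H.irrefl
      · exact hfH i j hij)
  have hsub : ∀ i, (Finset.univ.image fun t => (g (i, t) : V)) ⊆ U := by
    intro i y hy
    obtain ⟨t, -, rfl⟩ := Finset.mem_image.1 hy
    exact (g (i, t)).2
  -- `B` is trimmed to at most the size of `A`, which costs a factor `n` in its size and in the
  -- density.
  obtain ⟨b, hbA, hBb, hbB⟩ : ∃ b, b ≤ A.card ∧ B.card ≤ n * b ∧ b ≤ B.card := by
    refine ⟨min A.card B.card, min_le_left _ _, ?_, min_le_right _ _⟩
    rcases le_total A.card B.card with h | h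
    · rwa [min_eq_left h]
    · rw [min_eq_right h]
      exact Nat.le_mul_of_pos_left _ hn
  obtain ⟨B', hB', rfl⟩ := Finset.exists_subset_card_eq hbB
  refine ⟨A, hA.trans (hsub i), B', hB'.trans (hB.trans (hsub j)), ?_, hbA, ?_, ?_⟩
  · refine Finset.disjoint_left.2 fun y hy hy' => ?_
    obtain ⟨t, -, h⟩ := Finset.mem_image.1 (hA hy)
    obtain ⟨t', -, h'⟩ := Finset.mem_image.1 (hB (hB' hy'))
    exact hij (congrArg Prod.fst (hginj _ _ (h.trans h'.symm)))
  · calc U.card ≤ 2 * n * r := hUr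
      _ ≤ 2 * n * (k ^ n * (n * B'.card)) :=
        Nat.mul_le_mul_left _ (hrB.trans (Nat.mul_le_mul_left _ hBb))
      _ = _ := by ring
  · refine hs.imp (fun hs a ha => ?_) fun hs a ha => ?_
    · refine le_trans (Nat.mul_le_mul_left _ (Finset.card_le_card ?_)) ((hs a ha).trans hBb)
      exact nbrIn_mono subset_rfl hB'
    · refine le_trans (Nat.mul_le_mul_left _ (Finset.card_le_card ?_)) ((hs a ha).trans hBb)
      exact nbrIn_mono subset_rfl hB'

end Embedding

/-! ### Rödl's theorem. -/

section Rodl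

/-- The sum of the degrees in the subgraph induced on `S`. -/
noncomputable def degSum {V : Type u} (G : SimpleGraph V) (S : Finset V) : ℕ :=
  ∑ a ∈ S, (G.nbrIn {a} S).card

variable {V : Type u} {G : SimpleGraph V}

lemma degSum_union_le {A S : Finset V} {d : ℕ} (hAS : Disjoint A S)
    (hd : ∀ a ∈ A, (G.nbrIn {a} S).card ≤ d) :
    G.degSum (A ∪ S) ≤ G.degSum S + A.card * A.card + 2 * (A.card * d) := by
  have hunion : ∀ a, (G.nbrIn {a} (A ∪ S)).card ≤
      (G.nbrIn {a} A).card + (G.nbrIn {a} S).card := by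
    intro a
    refine le_trans (Finset.card_le_card ?_) (Finset.card_union_le _ _)
    simp only [nbrIn, Finset.filter_union]
    exact subset_rfl
  have hswap : ∑ s ∈ S, (G.nbrIn {s} A).card = ∑ a ∈ A, (G.nbrIn {a} S).card := by
    have h1 : ∀ (x : V) (Y : Finset V), G.nbrIn {x} Y = Y.filter fun y => G.Adj x y := by
      intro x Y
      simp [nbrIn]
    simp only [h1]
    refine (Finset.sum_card_bipartiteAbove_eq_sum_card_bipartiteBelow
      (s := S) (t := A) fun a b => G.Adj a b).trans ?_
    simp only [Finset.bipartiteBelow, G.adj_comm]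
  have hA : ∑ a ∈ A, (G.nbrIn {a} S).card ≤ A.card * d := by
    rw [← smul_eq_mul, ← Finset.sum_const]
    exact Finset.sum_le_sum hd
  have hAA : ∑ a ∈ A, (G.nbrIn {a} A).card ≤ A.card * A.card := by
    rw [← smul_eq_mul, ← Finset.sum_const]
    exact Finset.sum_le_sum fun a _ => Finset.card_le_card nbrIn_subset
  unfold degSum
  rw [Finset.sum_union hAS]
  have h1 := Finset.sum_le_sum fun a (_ : a ∈ A) => hunion a
  have h2 := Finset.sum_le_sum fun a (_ : a ∈ S) => hunion a
  rw [Finset.sum_add_distrib] at h1 h2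
  omega

/-- With `k = 2 * n * D`, a vertex of `A` has at most `s / 2` neighbours in `B`. So `s` vertices of
`A` added to `S` raise the degree sum by at most `s ^ 2` among themselves and `s ^ 2` for the edges
to `S`, counted from both ends. -/
lemma exists_sparse_union {A B S : Finset V} {k n D p s : ℕ} (hn : 0 < n) (hD : 0 < D)
    (hk : k = 2 * n * D) (hAB : Disjoint A B) (hBA : B.card ≤ A.card)
    (hs : ∀ a ∈ A, k * (G.nbrIn {a} B).card ≤ n * B.card) (hSB : S ⊆ B) (hS : S.card = p * s)
    (hdeg : G.degSum S ≤ 2 * p * s ^ 2) (hBs : B.card ≤ D * s) (hsB : s ≤ B.card) :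
    ∃ S' ⊆ A ∪ B, S'.card = (p + 1) * s ∧ G.degSum S' ≤ 2 * (p + 1) * s ^ 2 := by
  obtain ⟨A', hA', rfl⟩ := Finset.exists_subset_card_eq (hsB.trans hBA)
  have hdisj : Disjoint A' S := hAB.mono hA' hSB
  have hd : ∀ a ∈ A', 2 * (G.nbrIn {a} S).card ≤ A'.card := by
    intro a ha
    refine Nat.le_of_mul_le_mul_left ?_ (Nat.mul_pos hn hD)
    calc n * D * (2 * (G.nbrIn {a} S).card) = k * (G.nbrIn {a} S).card := by rw [hk]; ring
      _ ≤ k * (G.nbrIn {a} B).card :=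
        Nat.mul_le_mul_left _ (Finset.card_le_card (nbrIn_mono subset_rfl hSB))
      _ ≤ n * (D * A'.card) := (hs a (hA' ha)).trans (Nat.mul_le_mul_left _ hBs)
      _ = _ := by ring
  refine ⟨A' ∪ S, Finset.union_subset_union hA' hSB, ?_, ?_⟩
  · rw [Finset.card_union_of_disjoint hdisj, hS]
    ring
  · have h1 := degSum_union_le (G := G) (d := A'.card / 2) hdisj fun a ha => by
      have := hd a ha
      omega
    have h2 : A'.card * (A'.card / 2) * 2 ≤ A'.card * A'.card := by
      rw [mul_assoc]
      exact Nat.mul_le_mul_left _ (Nat.div_mul_le_self _ _)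
    have h3 : 2 * (p + 1) * A'.card ^ 2 = 2 * p * A'.card ^ 2 + 2 * (A'.card * A'.card) := by ring
    omega

/-- Rödl's theorem: graphs with no induced copy of `H` have linear sized subsets that are
arbitrarily sparse, in the graph or in its complement. -/
theorem exists_degSum_le {n : ℕ} (H : SimpleGraph (Fin n)) (N : ℕ) : ∀ p q, p + q ≤ N →
    ∃ D r₀ : ℕ, 0 < D ∧ ∀ (V : Type u) (G : SimpleGraph V), IsEmpty (H ↪g G) →
      ∀ U : Finset V, r₀ ≤ U.card → ∃ s, U.card ≤ D * s ∧ s ≤ U.card ∧ ∃ S ⊆ U,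
        (S.card = p * s ∧ G.degSum S ≤ 2 * p * s ^ 2) ∨
        (S.card = q * s ∧ Gᶜ.degSum S ≤ 2 * q * s ^ 2) := by
  induction N with
  | zero =>
    intro p q hpq
    obtain rfl : p = 0 := by omega
    exact ⟨1, 0, one_pos, fun V G _ U _ => ⟨U.card, by simp, le_rfl, ∅, Finset.empty_subset _,
      Or.inl ⟨by simp, by simp [degSum]⟩⟩⟩
  | succ N ih =>
    rintro (_ | p) q hpq
    · exact ⟨1, 0, one_pos, fun V G _ U _ => ⟨U.card, by simp, le_rfl, ∅, Finset.empty_subset _,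
        Or.inl ⟨by simp, by simp [degSum]⟩⟩⟩
    rcases q with _ | q
    · exact ⟨1, 0, one_pos, fun V G _ U _ => ⟨U.card, by simp, le_rfl, ∅, Finset.empty_subset _,
        Or.inr ⟨by simp, by simp [degSum]⟩⟩⟩
    rcases Nat.eq_zero_or_pos n with rfl | hn
    · exact ⟨1, 0, one_pos, fun V G hG =>
        hG.elim ⟨⟨fun i => i.elim0, fun i => i.elim0⟩, fun {i} => i.elim0⟩⟩
    obtain ⟨D₁, r₁, hD₁, h₁⟩ := ih p (q + 1) (by omega)
    obtain ⟨D₂, r₂, hD₂, h₂⟩ := ih (p + 1) q (by omega)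
    -- As in Ramsey's theorem, the induction lowers `p` or `q` inside `B`, according to where the
    -- pair is sparse. The sparsity must beat the ratio of `B.card` to `s` in either case, so `k` is
    -- fixed after both constants.
    set k := 2 * n * (D₁ + D₂) with hk
    have hk0 : 0 < k := by positivity
    have hC : 0 < 2 * n * n * k ^ n := by positivity
    refine ⟨2 * n * n * k ^ n * (D₁ + D₂), n + 2 * n * n * k ^ n * (r₁ + r₂), by positivity,
      fun V G hG U hU => ?_⟩
    obtain ⟨A, hA, B, hB, hAB, hBA, hUB, hs⟩ :=
      exists_sparse_pair_of_isEmpty_embedding H hG hk0 (U := U) (by omega)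
    have hBr : r₁ + r₂ ≤ B.card := Nat.le_of_mul_le_mul_left (by omega) hC
    have hBU := Finset.card_le_card hB
    have hABU : A ∪ B ⊆ U := Finset.union_subset hA hB
    have hlin : ∀ D s, D ≤ D₁ + D₂ → B.card ≤ D * s →
        B.card ≤ (D₁ + D₂) * s ∧ U.card ≤ 2 * n * n * k ^ n * (D₁ + D₂) * s := by
      intro D s hD hBs
      have h1 := hBs.trans (Nat.mul_le_mul_right s hD)
      refine ⟨h1, hUB.trans ?_⟩
      rw [mul_assoc _ (D₁ + D₂)]
      exact Nat.mul_le_mul_left _ h1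
    rcases hs with hs | hs
    · obtain ⟨s, hBs, hsB, S, hSB, hS | hS⟩ := h₁ V G hG B (by omega)
      · obtain ⟨h1, h2⟩ := hlin D₁ s (by omega) hBs
        obtain ⟨S', hS', h3⟩ := exists_sparse_union hn (by omega) hk hAB hBA hs hSB hS.1 hS.2
          h1 hsB
        exact ⟨s, h2, hsB.trans hBU, S', hS'.trans hABU, Or.inl h3⟩
      · exact ⟨s, (hlin D₁ s (by omega) hBs).2, hsB.trans hBU, S, hSB.trans hB, Or.inr hS⟩
    · obtain ⟨s, hBs, hsB, S, hSB, hS | hS⟩ := h₂ V G hG B (by omega)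
      · exact ⟨s, (hlin D₂ s (by omega) hBs).2, hsB.trans hBU, S, hSB.trans hB, Or.inl hS⟩
      · obtain ⟨h1, h2⟩ := hlin D₂ s (by omega) hBs
        obtain ⟨S', hS', h3⟩ := exists_sparse_union hn (by omega) hk hAB hBA hs hSB hS.1 hS.2
          h1 hsB
        exact ⟨s, h2, hsB.trans hBU, S', hS'.trans hABU, Or.inr h3⟩

/-- The average degree is at most `2 * s`, so at most half of the vertices have degree above `4 *
s`. -/
lemma exists_subset_card_nbrIn_le {S : Finset V} {p s : ℕ} (hs : 0 < s) (hS : S.card = p * s)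
    (hdeg : G.degSum S ≤ 2 * p * s ^ 2) :
    ∃ S' ⊆ S, p * s ≤ 2 * S'.card ∧ ∀ a ∈ S', (G.nbrIn {a} S').card ≤ 4 * s := by
  set B := S.filter fun a => 4 * s < (G.nbrIn {a} S).card with hB
  have h1 : B.card * (4 * s) ≤ 2 * p * s ^ 2 := by
    refine le_trans ?_ hdeg
    calc B.card * (4 * s) = ∑ _ ∈ B, 4 * s := by rw [Finset.sum_const, smul_eq_mul]
      _ ≤ ∑ a ∈ B, (G.nbrIn {a} S).card :=
        Finset.sum_le_sum fun a ha => (Finset.mem_filter.1 ha).2.le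
      _ ≤ G.degSum S := Finset.sum_le_sum_of_subset (Finset.filter_subset _ _)
  have h2 : 2 * B.card ≤ p * s := by
    refine Nat.le_of_mul_le_mul_left ?_ (show 0 < 2 * s by omega)
    calc 2 * s * (2 * B.card) = B.card * (4 * s) := by ring
      _ ≤ 2 * p * s ^ 2 := h1
      _ = _ := by ring
  refine ⟨S \ B, Finset.sdiff_subset, ?_, fun a ha => ?_⟩
  · have := Finset.le_card_sdiff B S
    omega
  · obtain ⟨ha, haB⟩ := Finset.mem_sdiff.1 ha
    refine (Finset.card_le_card (nbrIn_mono subset_rfl Finset.sdiff_subset)).trans ?_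
    by_contra! hcon
    exact haB (Finset.mem_filter.2 ⟨ha, hcon⟩)

end Rodl

/-! ### Anticomplete pairs from sparse sets, and the theorem. -/

section Conclusion

variable {W : Type v}

/-- A sparse set of vertices in a graph without induced subdivisions of `H` contains a linear
sized anticomplete pair. -/
lemma exists_anti_of_card_nbrIn_le {m : ℕ} (σ : W ≃ Fin m) (H : SimpleGraph W) : ∃ L : ℕ, 0 < L ∧
    ∀ (V : Type u) (G : SimpleGraph V), ¬ G.ContainsInducedSubdivision H →
      ∀ (S : Finset V) (d : ℕ), (∀ a ∈ S, (G.nbrIn {a} S).card ≤ d) → L * (d + 1) ≤ S.card →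
        ∃ A B : Finset V, Disjoint A B ∧ d + 1 ≤ A.card ∧ d + 1 ≤ B.card ∧ G.Anti A B := by
  obtain ⟨L, hL⟩ := exists_subdivisionModel_of_coherent.{u} m
  refine ⟨L + 1, Nat.succ_pos L, fun V G hG S d hd hS => ?_⟩
  by_contra! hcon
  let ψ : (S : Set V) ↪ V := Function.Embedding.subtype _
  have hψ : ∀ x, ψ x ∈ S := fun x => x.2
  -- The degree bound and the absence of a pair are together coherence with parameter `d + 1`, the
  -- extra one being the vertex itself.
  have hcoh : (G.induce (S : Set V)).Coherent (d + 1) := by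
    refine ⟨fun v => ?_, fun A B hAB hanti => ?_⟩
    · refine le_trans ?_ (Nat.succ_le_succ (hd v v.2))
      rw [← Finset.card_map ψ]
      refine (Finset.card_le_card fun y hy => ?_).trans
        (Finset.card_insert_le (v : V) (G.nbrIn {(v : V)} S))
      obtain ⟨x, hx, rfl⟩ := Finset.mem_map.1 hy
      rcases (mem_closedNbrIn.1 hx).2 with hx | ⟨w, hw, hwx⟩
      · rw [Finset.mem_singleton.1 hx]
        exact Finset.mem_insert_self _ _
      · rw [Finset.mem_singleton.1 hw] at hwx
        exact Finset.mem_insert_of_mem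
          (mem_nbrIn.2 ⟨hψ x, v, Finset.mem_singleton_self _, hwx⟩)
    · by_contra! hge
      refine hcon (A.map ψ) (B.map ψ) ((Finset.disjoint_map ψ).2 hAB)
        (by rw [Finset.card_map]; exact hge.1) (by rw [Finset.card_map]; exact hge.2) ?_
      intro a ha b hb hab
      obtain ⟨x, hx, rfl⟩ := Finset.mem_map.1 ha
      obtain ⟨y, hy, rfl⟩ := Finset.mem_map.1 hb
      exact hanti x hx y hy hab
  obtain ⟨M⟩ := hL _ (G.induce (S : Set V)) (d + 1) hcoh (Nat.succ_pos d) (by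
    rw [← Nat.card_eq_fintype_card, Nat.card_coe_set_eq, Set.ncard_coe_finset]
    exact (Nat.mul_le_mul_right _ (Nat.le_succ L)).trans hS)
  exact hG ((M.containsInducedSubdivision H σ).of_embedding (Embedding.induce _))

/-- Large graphs without induced subdivisions of `H`, in the graph and in the complement, have a
linear sized complete or anticomplete pair. -/
lemma exists_anti_or_compl_anti [Finite W] (H : SimpleGraph W) : ∃ D r₀ : ℕ, 0 < D ∧
    ∀ (V : Type u) [Fintype V] (G : SimpleGraph V), ¬ G.ContainsInducedSubdivision H →
      ¬ Gᶜ.ContainsInducedSubdivision H → r₀ ≤ Fintype.card V →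
      ∃ A B : Finset V, Disjoint A B ∧ Fintype.card V ≤ D * A.card ∧
        Fintype.card V ≤ D * B.card ∧ (G.Anti A B ∨ Gᶜ.Anti A B) := by
  obtain ⟨m, ⟨σ⟩⟩ := Finite.exists_equiv_fin W
  obtain ⟨L, hL0, hL⟩ := exists_anti_of_card_nbrIn_le.{u} σ H
  let H' : SimpleGraph (Fin m) := H.comap σ.symm
  -- With `16 * L` blocks of size `s`, the set of bounded degree has at least `8 * L * s` vertices,
  -- enough for `L * (4 * s + 1)` once `s` is positive.
  obtain ⟨D, r₀, hD, h⟩ := exists_degSum_le.{u} H' (16 * L + 16 * L) (16 * L) (16 * L) le_rfl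
  refine ⟨D, r₀ + 1, hD, fun V _ G hG hGc hV => ?_⟩
  have hemb : IsEmpty (H' ↪g G) := by
    refine ⟨fun f => hG (containsInducedSubdivision_of_embedding ?_)⟩
    exact (Iso.comap σ.symm H).symm.toEmbedding.trans f
  obtain ⟨s, hVs, -, S, -, hS⟩ := h V G hemb Finset.univ (by rw [Finset.card_univ]; omega)
  rw [Finset.card_univ] at hVs
  have hs : 0 < s := by
    rcases Nat.eq_zero_or_pos s with rfl | hs
    · omega
    · exact hs
  have key : ∀ G' : SimpleGraph V, ¬ G'.ContainsInducedSubdivision H → S.card = 16 * L * s →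
      G'.degSum S ≤ 2 * (16 * L) * s ^ 2 → ∃ A B : Finset V, Disjoint A B ∧
        Fintype.card V ≤ D * A.card ∧ Fintype.card V ≤ D * B.card ∧ G'.Anti A B := by
    intro G' hG' hSc hdeg
    obtain ⟨S', -, hS', hS'd⟩ := exists_subset_card_nbrIn_le hs hSc hdeg
    obtain ⟨A, B, hAB, hA, hB, hanti⟩ := hL V G' hG' S' (4 * s) hS'd (by
      have h1 : L ≤ L * s := Nat.le_mul_of_pos_right _ hs
      have h2 : L * (4 * s + 1) = 4 * (L * s) + L := by ring
      have h3 : 16 * L * s = 16 * (L * s) := by ring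
      omega)
    exact ⟨A, B, hAB, hVs.trans (Nat.mul_le_mul_left _ (by omega)),
      hVs.trans (Nat.mul_le_mul_left _ (by omega)), hanti⟩
  rcases hS with hS | hS
  · obtain ⟨A, B, hAB, hA, hB, hanti⟩ := key G hG hS.1 hS.2
    exact ⟨A, B, hAB, hA, hB, Or.inl hanti⟩
  · obtain ⟨A, B, hAB, hA, hB, hanti⟩ := key Gᶜ hGc hS.1 hS.2
    exact ⟨A, B, hAB, hA, hB, Or.inr hanti⟩

end Conclusion

end SimpleGraph

theorem mainTheorem5 {W : Type v} [Finite W] (H : SimpleGraph W) :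
    (inducedSubdivisionFreeIdeal.{u, v} H).HasStrongErdosHajnalProperty := by
  obtain ⟨D, r₀, hD, h⟩ := SimpleGraph.exists_anti_or_compl_anti.{u} H
  have hD' : (0 : ℝ) < D := Nat.cast_pos.2 hD
  have hpos : (0 : ℝ) < D + r₀ := add_pos_of_pos_of_nonneg hD' (Nat.cast_nonneg _)
  -- Below `r₀` vertices, two single vertices are large enough for this constant; any such pair is
  -- complete or anticomplete.
  refine ⟨1 / (D + r₀), by positivity, fun V _ G hG hV => ?_⟩
  have hcard : ∀ n : ℕ, Nat.card V ≤ (D + r₀) * n →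
      1 / ((D : ℝ) + r₀) * (Nat.card V : ℝ) ≤ n := by
    intro n hn
    rw [one_div, inv_mul_le_iff₀ hpos]
    exact_mod_cast hn
  have := Fintype.ofFinite V
  rcases lt_or_ge (Fintype.card V) r₀ with hr | hr
  · have : Nontrivial V := Finite.one_lt_card_iff_nontrivial.1 hV
    obtain ⟨x, y, hxy⟩ := exists_pair_ne V
    have hle : 1 / ((D : ℝ) + r₀) * (Nat.card V : ℝ) ≤ (1 : ℕ) := hcard 1 (by
      rw [Nat.card_eq_fintype_card]
      omega)
    refine ⟨{x}, {y}, by simpa using hxy, by rwa [Set.ncard_singleton],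
      by rwa [Set.ncard_singleton], ?_⟩
    by_cases hadj : G.Adj x y
    · exact Or.inl (by rintro a rfl b rfl; exact hadj)
    · exact Or.inr (by rintro a rfl b rfl; exact hadj)
  · obtain ⟨A, B, hAB, hA, hB, hanti⟩ := h V G hG.1 hG.2 hr
    rw [← Nat.card_eq_fintype_card] at hA hB
    refine ⟨A, B, Finset.disjoint_coe.2 hAB, ?_, ?_, ?_⟩
    · rw [Set.ncard_coe_finset]
      exact hcard _ (hA.trans (Nat.mul_le_mul_right _ (Nat.le_add_right _ _)))
    · rw [Set.ncard_coe_finset]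
      exact hcard _ (hB.trans (Nat.mul_le_mul_right _ (Nat.le_add_right _ _)))
    · rcases hanti with hanti | hanti
      · exact Or.inr hanti
      · refine Or.inl fun a ha b hb => ?_
        have hne : a ≠ b := fun hab => Finset.disjoint_left.1 hAB ha (hab ▸ hb)
        by_contra hadj
        exact hanti a ha b hb ((G.compl_adj a b).2 ⟨hne, hadj⟩)
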